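/- Let $E/\mathbb{C}$ be an elliptic curve with $j$-invariant $j_E$. Fix a complex uniformization, i.e. a biholomorphic group isomorphism $E(\mathbb{C})\simeq\mathbb{C}/L$ with $L=\mathbb{Z}+\tau\mathbb{Z}$, $\operatorname{Im}\tau>0$, and let $\mu$ be the unit Haar measure on $E(\mathbb{C})$. Let $\lambda:E(\mathbb{C})\setminus\{O\}\to\mathbb{R}$ be the Néron function, given with $u=e^{2\pi iz}$, $q=e^{2\pi i\tau}$, $B_2(T)=T^2-T+\tfrac16$ by $$\lambda(z)=-\tfrac12 B_2\Big(\frac{\log|u|}{\log|q|}\Big)\log|q|-\log|1-u|-\sum_{n\ge1}\log\big|(1-q^nu)(1-q^n/u)\big| .$$ (It does not depend on the choice of uniformization.) Let $\Gamma_E$ be the group of continuous homomorphisms from $E(\mathbb{C})$ to the circle group, with trivial character $\gamma_0$, and for $\gamma\in\Gamma_E$ let $\widehat\lambda(\gamma)=\int_{E(\mathbb{C})}\lambda(P)\overline{\gamma(P)}\,d\mu(P)$; put $c_{\gamma_0}=0$ and $c_\gamma=1/\widehat\lambda(\gamma)$ for $\gamma\ne\gamma_0$. For $t>0$ let $g_t(P)=\sum_{\gamma\in\Gamma_E}e^{-tc_\gamma}\gamma(P)$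 be the heat kernel and $\lambda_t(P)=\int_{E(\mathbb{C})}\lambda(Q)g_t(P-Q)\,d\mu(Q)$. For a set $Z=\{P_1,\dots,P_N\}\subset E(\mathbb{C})$ of $N\ge1$ distinct points define its discrepancy by $$D(Z)=\frac1{N^2}\sum_{1\le i,j\le N}\lambda_{1/N}(P_i-P_j).$$ Then $D(Z)>0$, and $$\sum_{\substack{1\le i,j\le N\\ i\ne j}}\lambda(P_i-P_j)\ \ge\ N^2D(Z)-\frac{N\log N}{2}-\frac{N}{12}\log^+|j_E|-\frac{16N}{5},$$ where $\log^+x=\max(0,\log x)$ (and $\log^+0=0$). -/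

import Mathlib

open MeasureTheory UpperHalfPlane
open scoped Real

noncomputable section

namespace EllipticDiscrepancy

/-- The normalized lattice `ℤ + τℤ` in `ℂ`. -/
def lattice (τ : ℍ) : AddSubgroup ℂ := AddSubgroup.closure {1, (τ : ℂ)}

/-- The complex torus `ℂ / (ℤ + τℤ)`, with the quotient topology and quotient σ-algebra. -/
abbrev Torus (τ : ℍ) : Type := ℂ ⧸ lattice τ

/-- The unit Haar measure on `ℂ / (ℤ + τℤ)`: normalized Lebesgue measure on the fundamental
parallelogram, i.e. the image of `dr₁ dr₂` on the unit square under
`(r₁, r₂) ↦ r₁ + r₂ τ`. -/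
def haar (τ : ℍ) : Measure (Torus τ) :=
  Measure.map (fun r : ℝ × ℝ => (((r.1 : ℂ) + (r.2 : ℂ) * (τ : ℂ) : ℂ) : Torus τ))
    ((volume : Measure (ℝ × ℝ)).restrict (Set.Icc 0 1 ×ˢ Set.Icc 0 1))

/-- The dual group of the torus: continuous homomorphisms into the circle group. -/
abbrev Dual (τ : ℍ) : Type := {γ : AddChar (Torus τ) Circle // Continuous γ}

/-- The Fourier coefficient `∫ f(P) conj(γ(P)) dμ(P)` of a real valued function. -/
def fourierCoefficient {τ : ℍ} (f : Torus τ → ℝ) (γ : Dual τ) : ℂ :=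
  ∫ P, (f P : ℂ) * (starRingEnd ℂ) (γ.1 P : ℂ) ∂(haar τ)

/-- The second Bernoulli polynomial. -/
def bernoulliTwo (T : ℝ) : ℝ := T ^ 2 - T + 1 / 6

/-- The explicit formula for the Néron function in the coordinate `z`, with `u = exp (2πiz)` and
`q = exp (2πiτ)`:
`-(1/2) B₂(log|u| / log|q|) log|q| - log|1 - u| - ∑_{n ≥ 1} log|(1 - qⁿu)(1 - qⁿ/u)|`.
For `z` outside `ℤ + τℤ` the series converges absolutely and the value depends only on `z` modulo
`ℤ + τℤ`. -/
def neronFormula (τ : ℍ) (z : ℂ) : ℝ :=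
  let u : ℂ := Complex.exp (2 * π * Complex.I * z);
  let q : ℂ := Complex.exp (2 * π * Complex.I * (τ : ℂ));
  (-1 / 2) * bernoulliTwo (Real.log (norm u) / Real.log (norm q)) * Real.log (norm q)
    - Real.log (norm (1 - u))
    - ∑' n : ℕ, Real.log (norm ((1 - q ^ (n + 1) * u) * (1 - q ^ (n + 1) / u)))

/-- The Néron function on `ℂ / (ℤ + τℤ)` away from the origin (its value at the origin is
irrelevant). -/
def torusNeron (τ : ℍ) (P : Torus τ) : ℝ := neronFormula τ (Quotient.out P)

open Classical in
/-- `c_γ`, where `-c_γ` is the eigenvalue of the Laplacian at the character `γ`: it is `0` for the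
trivial character and the inverse of the Fourier coefficient of the Néron function otherwise. -/
def eigenvalue {τ : ℍ} (γ : Dual τ) : ℂ :=
  if γ.1 = 1 then 0 else 1 / fourierCoefficient (torusNeron τ) γ

/-- The heat kernel `g_t(P) = ∑_γ exp(-t c_γ) γ(P)`, for `t > 0`. -/
def heatKernel (τ : ℍ) (t : ℝ) (P : Torus τ) : ℂ :=
  ∑' γ : Dual τ, Complex.exp (-(t : ℂ) * eigenvalue γ) * (γ.1 P : ℂ)

/-- The convolution `λ_t = λ * g_t` on the torus, for `t > 0`. The integral is a real number. -/
def torusNeronHeat (τ : ℍ) (t : ℝ) (P : Torus τ) : ℝ :=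
  (∫ Q, (torusNeron τ Q : ℂ) * heatKernel τ t (P - Q) ∂(haar τ)).re

/-- `e` is a complex uniformization `ℂ / (ℤ + τℤ) ≃ E(ℂ)`: a group isomorphism which is
holomorphic, that is, whose affine coordinates are meromorphic functions on `ℂ` which are
holomorphic outside the lattice. -/
structure IsUniformization {E : WeierstrassCurve ℂ} {τ : ℍ}
    (e : Torus τ →+ E.toAffine.Point) : Prop where
  bijective : Function.Bijective e
  holomorphic : ∃ X Y : ℂ → ℂ, Meromorphic X ∧ Meromorphic Y ∧
    DifferentiableOn ℂ X (lattice τ : Set ℂ)ᶜ ∧ DifferentiableOn ℂ Y (lattice τ : Set ℂ)ᶜ ∧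
    ∀ z : ℂ, z ∉ lattice τ →
      ∃ h : E.toAffine.Nonsingular (X z) (Y z), e (z : Torus τ) = .some (X z) (Y z) h

/-- A chosen parameter `τ` and uniformization `ℂ / (ℤ + τℤ) ≃ E(ℂ)` of an elliptic curve. -/
def uniformization (E : WeierstrassCurve ℂ) : Σ τ : ℍ, Torus τ →+ E.toAffine.Point :=
  Classical.epsilon (fun p => IsUniformization p.2)

/-- The point of the torus corresponding to a point of `E(ℂ)`. -/
def toTorus (E : WeierstrassCurve ℂ) (P : E.toAffine.Point) : Torus (uniformization E).1 :=
  Function.invFun (uniformization E).2 P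

/-- The Néron function `λ` on `E(ℂ) ∖ {O}` (its value at `O` is irrelevant). -/
def neron (E : WeierstrassCurve ℂ) (P : E.toAffine.Point) : ℝ :=
  torusNeron (uniformization E).1 (toTorus E P)

/-- The smoothed Néron function `λ_t = λ * g_t` on `E(ℂ)`, for `t > 0`. -/
def neronHeat (E : WeierstrassCurve ℂ) (t : ℝ) (P : E.toAffine.Point) : ℝ :=
  torusNeronHeat (uniformization E).1 t (toTorus E P)

/-- The discrepancy `D(Z) = N⁻² ∑_{i,j} λ_{1/N}(Pᵢ - Pⱼ)` of a set `Z` of `N` points. -/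
def discrepancy (E : WeierstrassCurve ℂ) (Z : Finset E.toAffine.Point) : ℝ :=
  1 / (Z.card : ℝ) ^ 2 * ∑ P ∈ Z, ∑ Q ∈ Z, neronHeat E (1 / (Z.card : ℝ)) (P - Q)

end EllipticDiscrepancy

end

/-! The proof is Fourier analysis on ℂ/(ℤ+ℤτ). Write e(x) = exp(2πix). The characters are r₁ + r₂τ ↦
e(mr₁ + nr₂) with m, n integers. There λ has the coefficient Im τ/(2π|mτ - n|²), which is positive
except at the trivial character, where it is 0 (`fourierCoefficient_torusNeron`). Hence λ_t is the
absolutely convergent sum of λ̂(γ)e^{-t/λ̂(γ)}γ over γ ≠ γ₀. With t = 1/N, N²D(Z) is the sum of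
λ̂(γ)e^{-t/λ̂(γ)}|∑γ(P_i)|². It is positive because the power sums of a finite nonempty family of
nonzero numbers cannot all vanish (`sum_sum_torusNeronHeat_pos`).

For the lower bound, dλ_s/ds = 1 - g_s, so formally λ - λ_t + t is the integral of g_s over 0 < s ≤
t. Poisson summation shows g_s ≥ 0, whence λ(P) ≥ λ_t(P) - t for P ≠ O (`torusNeronHeat_sub_le`).
The double Fourier series of λ does not converge absolutely, so a Gaussian damping in one index is
inserted and removed at the end. Summing over i ≠ j with t = 1/N gives N²D(Z) - Nλ_{1/N}(O) - (N-1)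
as a lower bound.

It remains to bound λ_{1/N}(O) from above (`heatAtZero_le_log`). This number is SL₂(ℤ)-invariant, so
τ may be taken in the fundamental domain. The row m = 0 contributes at most π Im τ/6, which
(1/12)log⁺|j| absorbs because |j| grows like |q|⁻¹. The rows m = ±k together contribute about
e^{-ck²/N}/k with c = 2π Im τ, and these add up to (log N)/2 + O(1).

The curve enters only through τ. The chosen uniformization is genuine because one exists
(`exists_isUniformization`): j is surjective on the upper half plane, and ℘, ℘' parametrize the
curve by the addition theorem. Whatever uniformization the choice returns, j(τ) = j_E
(`j_eq_jFunction`), because its x-coordinate is necessarily an affine function of ℘, and the values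
at the half periods determine j. -/

noncomputable section

open Filter Topology

/-! ### Elliptic functions and the addition theorem for ℘. -/

section

namespace PeriodPair

variable (L : PeriodPair)

/-- Removable singularities together with Liouville's theorem: an elliptic function without poles
is constant. -/
lemma exists_tendsto_of_elliptic {f : ℂ → ℂ} (hper : ∀ z, ∀ l ∈ L.lattice, f (z + l) = f z)
    (hf : ∀ z, ∃ g, AnalyticAt ℂ g z ∧ f =ᶠ[𝓝[≠] z] g) :
    ∃ c, ∀ z, Tendsto f (𝓝[≠] z) (𝓝 c) := by
  set F : ℂ → ℂ := fun z => limUnder (𝓝[≠] z) f with hF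
  have key : ∀ z g, AnalyticAt ℂ g z → f =ᶠ[𝓝[≠] z] g → Tendsto f (𝓝[≠] z) (𝓝 (g z)) :=
    fun z g hg h => (hg.continuousAt.tendsto.mono_left nhdsWithin_le_nhds).congr' h.symm
  have hFt : ∀ z, Tendsto f (𝓝[≠] z) (𝓝 (F z)) := fun z => by
    obtain ⟨g, hg, h⟩ := hf z
    exact tendsto_nhds_limUnder ⟨_, key z g hg h⟩
  have hFa : ∀ z, DifferentiableAt ℂ F z := by
    intro z
    obtain ⟨g, hg, h⟩ := hf z
    refine (hg.congr ?_).differentiableAt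
    have h1 : ∀ᶠ w in 𝓝 z, w ∈ ({z}ᶜ : Set ℂ) → f w = g w := eventually_nhdsWithin_iff.mp h
    filter_upwards [h1.eventually_nhds, hg.eventually_analyticAt] with w hw hgw
    refine (tendsto_nhds_unique (hFt w) (key w g hgw ?_)).symm
    by_cases hwz : w = z
    · subst hwz; exact h
    · filter_upwards [mem_nhdsWithin_of_mem_nhds hw,
        mem_nhdsWithin_of_mem_nhds (isOpen_compl_singleton.mem_nhds hwz)] with v hv hv'
      exact hv hv'
  have hFp : ∀ z, ∀ l ∈ L.lattice, F (z + l) = F z := by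
    intro z l hl
    have h1 : Tendsto (fun w => w + l) (𝓝[≠] z) (𝓝[≠] (z + l)) := by
      refine tendsto_nhdsWithin_iff.mpr ⟨?_, ?_⟩
      · exact ((continuous_id.add continuous_const).tendsto z).mono_left nhdsWithin_le_nhds
      · filter_upwards [self_mem_nhdsWithin] with w hw
        simpa using hw
    refine tendsto_nhds_unique (((hFt (z + l)).comp h1).congr fun w => ?_) (hFt z)
    exact hper w l hl
  have hFd : Differentiable ℂ F := hFa
  have hb := (IsZLattice.isCompact_range_of_periodic L.lattice F hFd.continuous hFp).isBounded
  refine ⟨F 0, fun z => ?_⟩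
  rw [hFd.apply_eq_apply_of_bounded hb 0 z]
  exact hFt z

/-- By periodicity a singularity need only be removed at one representative of its class modulo the
lattice. -/
lemma exists_analytic_of_add {f : ℂ → ℂ} (hper : ∀ z, ∀ l ∈ L.lattice, f (z + l) = f z)
    {z l : ℂ} (hl : l ∈ L.lattice) (h : ∃ g, AnalyticAt ℂ g z ∧ f =ᶠ[𝓝[≠] z] g) :
    ∃ g, AnalyticAt ℂ g (z + l) ∧ f =ᶠ[𝓝[≠] (z + l)] g := by
  obtain ⟨g, hg, h⟩ := h
  refine ⟨fun w => g (w - l), ?_, ?_⟩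
  · have : AnalyticAt ℂ g (z + l - l) := by simpa using hg
    exact this.comp (f := fun w => w - l) (by fun_prop)
  · have h1 : Tendsto (fun w => w - l) (𝓝[≠] (z + l)) (𝓝[≠] z) := by
      refine tendsto_nhdsWithin_iff.mpr ⟨?_, ?_⟩
      · have : Tendsto (fun w : ℂ => w - l) (𝓝 (z + l)) (𝓝 (z + l - l)) :=
          Continuous.tendsto (by fun_prop) _
        rw [add_sub_cancel_right] at this
        exact this.mono_left nhdsWithin_le_nhds
      · filter_upwards [self_mem_nhdsWithin] with w hw
        simpa [sub_eq_iff_eq_add] using hw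
    filter_upwards [h1.eventually h] with w hw
    rw [← hw, ← hper (w - l) l hl, sub_add_cancel]

lemma eventually_notMem_lattice (z : ℂ) : ∀ᶠ w in 𝓝[≠] z, w ∉ L.lattice := by
  filter_upwards [self_mem_nhdsWithin,
    mem_nhdsWithin_of_mem_nhds (L.compl_lattice_sdiff_singleton_mem_nhds z)] with w hw hw'
  simp_all

lemma eventually_notMem_lattice_of_notMem {z : ℂ} (hz : z ∉ L.lattice) :
    ∀ᶠ w in 𝓝 z, w ∉ L.lattice :=
  L.isClosed_lattice.isOpen_compl.mem_nhds hz

lemma analyticAt_weierstrassP {z : ℂ} (hz : z ∉ L.lattice) : AnalyticAt ℂ L.weierstrassP z :=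
  L.analyticOnNhd_weierstrassP z hz

lemma analyticAt_derivWeierstrassP {z : ℂ} (hz : z ∉ L.lattice) :
    AnalyticAt ℂ L.derivWeierstrassP z :=
  L.analyticOnNhd_derivWeierstrassP z hz

lemma hasDerivAt_weierstrassP {z : ℂ} (hz : z ∉ L.lattice) :
    HasDerivAt L.weierstrassP (L.derivWeierstrassP z) z := by
  rw [← L.deriv_weierstrassP]
  exact (L.analyticAt_weierstrassP hz).differentiableAt.hasDerivAt

/-- The regular part of ℘ at 0 vanishes there together with its first derivative. The identity also
holds at z = 0, since 1/0 = 0. -/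
lemma weierstrassP_expansion : ∃ F : ℂ → ℂ, AnalyticAt ℂ F 0 ∧
    ∀ z, L.weierstrassP z = 1 / z ^ 2 + z ^ 2 * F z := by
  obtain ⟨F, hF, h⟩ := (L.analyticAt_weierstrassPExcept 0).exists_eq_sum_add_pow_mul 2
  refine ⟨F, hF, fun z => ?_⟩
  have h1 := h z
  simp only [Finset.sum_range_succ, Finset.sum_range_zero, iteratedDeriv_zero, iteratedDeriv_one,
    L.weierstrassPExcept_zero, L.deriv_weierstrassPExcept_same,
    L.derivWeierstrassPExcept_zero_zero, zero_add, smul_eq_mul] at h1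
  have h2 := L.weierstrassPExcept_add 0 z
  simp only [ZeroMemClass.coe_zero, sub_zero] at h2
  rw [← h2, h1]
  simp
  ring

lemma derivWeierstrassP_expansion : ∃ F : ℂ → ℂ, AnalyticAt ℂ F 0 ∧
    ∀ z, L.derivWeierstrassP z = -2 / z ^ 3 + z * F z := by
  obtain ⟨F, hF, h⟩ := (L.analyticAt_derivWeierstrassPExcept 0).exists_eq_sum_add_pow_mul 1
  refine ⟨F, hF, fun z => ?_⟩
  have h1 := h z
  simp only [Finset.sum_range_succ, Finset.sum_range_zero, iteratedDeriv_zero,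
    L.derivWeierstrassPExcept_zero_zero, zero_add, smul_eq_mul, pow_one] at h1
  have h2 := L.derivWeierstrassPExcept_sub 0 z
  simp only [ZeroMemClass.coe_zero, sub_zero] at h2
  rw [← h2, h1]
  ring

lemma order_derivWeierstrassP_ne_top (z : ℂ) :
    meromorphicOrderAt L.derivWeierstrassP z ≠ ⊤ := by
  have h0 : meromorphicOrderAt L.derivWeierstrassP 0 ≠ ⊤ := by
    rw [← L.deriv_weierstrassP, meromorphicOrderAt_deriv_eq_sub_one (n := -2) (by norm_num)
      (L.order_weierstrassP 0 (zero_mem _))]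
    exact WithTop.coe_ne_top
  have hm : MeromorphicOn L.derivWeierstrassP Set.univ :=
    fun z _ => L.meromorphic_derivWeierstrassP z
  exact hm.meromorphicOrderAt_ne_top_of_isPreconnected isPreconnected_univ
    (Set.mem_univ 0) (Set.mem_univ z) h0

lemma eventually_derivWeierstrassP_ne_zero (z : ℂ) :
    ∀ᶠ w in 𝓝[≠] z, L.derivWeierstrassP w ≠ 0 :=
  (meromorphicOrderAt_ne_top_iff_eventually_ne_zero (L.meromorphic_derivWeierstrassP z)).mp
    (L.order_derivWeierstrassP_ne_top z)

/-- Differentiate ℘'² = 4℘³ - g₂℘ - g₃ and cancel 2℘' at the nearby points where it is nonzero.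
Continuity carries the formula to the zeros of ℘'. -/
lemma hasDerivAt_derivWeierstrassP {z : ℂ} (hz : z ∉ L.lattice) :
    HasDerivAt L.derivWeierstrassP (6 * L.weierstrassP z ^ 2 - L.g₂ / 2) z := by
  have han := L.analyticAt_derivWeierstrassP hz
  have hd : deriv L.derivWeierstrassP z = 6 * L.weierstrassP z ^ 2 - L.g₂ / 2 := by
    have hc1 : ContinuousAt (deriv L.derivWeierstrassP) z := han.deriv.continuousAt
    have hc2 : ContinuousAt (fun z => 6 * L.weierstrassP z ^ 2 - L.g₂ / 2) z :=
      (((L.analyticAt_weierstrassP hz).continuousAt.pow 2).const_mul _).sub_const _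
    refine tendsto_nhds_unique (hc1.tendsto.mono_left nhdsWithin_le_nhds)
      ((hc2.tendsto.mono_left (nhdsWithin_le_nhds (s := {z}ᶜ))).congr' ?_)
    filter_upwards [L.eventually_derivWeierstrassP_ne_zero z, L.eventually_notMem_lattice z]
      with w hw hwL
    have e1 : HasDerivAt (fun z => L.derivWeierstrassP z ^ 2)
        (2 * L.derivWeierstrassP w * deriv L.derivWeierstrassP w) w := by
      simpa using! ((L.analyticAt_derivWeierstrassP hwL).differentiableAt.hasDerivAt.pow 2)
    have e2 : HasDerivAt (fun z => 4 * L.weierstrassP z ^ 3 - L.g₂ * L.weierstrassP z - L.g₃)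
        (4 * (3 * L.weierstrassP w ^ 2 * L.derivWeierstrassP w)
          - L.g₂ * L.derivWeierstrassP w) w := by
      have := L.hasDerivAt_weierstrassP hwL
      simpa using! ((((this.pow 3).const_mul 4).sub (this.const_mul L.g₂)).sub_const L.g₃)
    have e3 : (fun z => L.derivWeierstrassP z ^ 2) =ᶠ[𝓝 w]
        (fun z => 4 * L.weierstrassP z ^ 3 - L.g₂ * L.weierstrassP z - L.g₃) := by
      filter_upwards [L.eventually_notMem_lattice_of_notMem hwL] with v hv
      exact L.derivWeierstrassP_sq v hv
    have e4 := e1.unique (e2.congr_of_eventuallyEq e3)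
    apply mul_left_cancel₀ hw
    linear_combination (-1 / 2) * e4
  rw [← hd]
  exact han.differentiableAt.hasDerivAt

/-- The third derivative of `℘`. -/
lemma iteratedDeriv_weierstrassP {w : ℂ} (hw : w ∉ L.lattice) :
    iteratedDeriv 2 L.weierstrassP w = 6 * L.weierstrassP w ^ 2 - L.g₂ / 2 ∧
    iteratedDeriv 3 L.weierstrassP w = 12 * L.weierstrassP w * L.derivWeierstrassP w := by
  have h2 : ∀ w ∉ L.lattice,
      iteratedDeriv 2 L.weierstrassP w = 6 * L.weierstrassP w ^ 2 - L.g₂ / 2 := by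
    intro w hw
    rw [iteratedDeriv_succ, iteratedDeriv_one, L.deriv_weierstrassP]
    exact (L.hasDerivAt_derivWeierstrassP hw).deriv
  refine ⟨h2 w hw, ?_⟩
  rw [iteratedDeriv_succ]
  have e : iteratedDeriv 2 L.weierstrassP =ᶠ[𝓝 w]
      fun w => 6 * L.weierstrassP w ^ 2 - L.g₂ / 2 := by
    filter_upwards [L.eventually_notMem_lattice_of_notMem hw] with v hv using h2 v hv
  rw [e.deriv_eq]
  have := ((((L.hasDerivAt_weierstrassP hw).pow 2).const_mul 6).sub_const (L.g₂ / 2)).deriv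
  refine Eq.trans this ?_
  simp
  ring

/-- `4(℘(z+w) + ℘(z) + ℘(w))(℘(z) - ℘(w))² - (℘'(z) - ℘'(w))²`, which vanishes identically. -/
def additionRelation (w z : ℂ) : ℂ :=
  4 * (L.weierstrassP (z + w) + L.weierstrassP z + L.weierstrassP w)
    * (L.weierstrassP z - L.weierstrassP w) ^ 2
  - (L.derivWeierstrassP z - L.derivWeierstrassP w) ^ 2

lemma additionRelation_add (w z : ℂ) {l : ℂ} (hl : l ∈ L.lattice) :
    L.additionRelation w (z + l) = L.additionRelation w z := by
  lift l to L.lattice using hl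
  simp only [additionRelation, L.weierstrassP_add_coe, L.derivWeierstrassP_add_coe,
    add_right_comm z l.1 w]

/-- The differential equation removes the pole of order 6, leaving 4(℘(z+w) - ℘(w))℘(z)² as the
worst term. Expanding ℘(z+w) to third order makes the coefficients of z⁻³, z⁻² and z⁻¹ cancel. -/
lemma exists_analytic_additionRelation_zero {w : ℂ} (hw : w ∉ L.lattice) :
    ∃ g, AnalyticAt ℂ g 0 ∧ L.additionRelation w =ᶠ[𝓝[≠] 0] g := by
  obtain ⟨F, hF, hPF⟩ := L.weierstrassP_expansion
  obtain ⟨B, hB, hPB⟩ := L.derivWeierstrassP_expansion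
  have ha : AnalyticAt ℂ (fun z => L.weierstrassP (z + w)) 0 := by
    have : AnalyticAt ℂ L.weierstrassP (0 + w) := by simpa using L.analyticAt_weierstrassP hw
    exact this.comp (f := fun z => z + w) (by fun_prop)
  obtain ⟨C, hC, hPC⟩ := ha.exists_eq_sum_add_pow_mul 4
  obtain ⟨d2, d3⟩ := L.iteratedDeriv_weierstrassP hw
  have hQ : ∀ z, L.weierstrassP (z + w) = L.weierstrassP w + z * L.derivWeierstrassP w
      + z ^ 2 * (3 * L.weierstrassP w ^ 2 - L.g₂ / 4)
      + z ^ 3 * (2 * L.weierstrassP w * L.derivWeierstrassP w) + z ^ 4 * C z := by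
    intro z
    have := hPC z
    simp only [Finset.sum_range_succ, Finset.sum_range_zero, iteratedDeriv_comp_add_const,
      zero_add, smul_eq_mul, d2, d3, iteratedDeriv_zero, iteratedDeriv_one,
      L.deriv_weierstrassP] at this
    rw [this]
    norm_num [Nat.factorial]
    ring
  set p := L.weierstrassP w
  set p' := L.derivWeierstrassP w
  set c2 := 3 * p ^ 2 - L.g₂ / 4
  refine ⟨fun z => 4 * C z + 4 * (z * p' + z ^ 2 * c2 + z ^ 3 * (2 * p * p') + z ^ 4 * C z) *
      (2 * F z + z ^ 4 * F z ^ 2)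
    + (-8 * p * L.weierstrassP (z + w) - 4 * p ^ 2 + L.g₂) * (z ^ 2 * F z)
    - 8 * p * (c2 + z * (2 * p * p') + z ^ 2 * C z) + 2 * p' * (z * B z)
    + 4 * L.weierstrassP (z + w) * p ^ 2 + 4 * p ^ 3 + L.g₃ - p' ^ 2, by fun_prop, ?_⟩
  filter_upwards [self_mem_nhdsWithin, L.eventually_notMem_lattice 0] with z hz hzL
  have hz : z ≠ 0 := hz
  have hde := L.derivWeierstrassP_sq z hzL
  have e1 : L.additionRelation w z =
      4 * (L.weierstrassP (z + w) - p) * L.weierstrassP z ^ 2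
      + (-8 * p * L.weierstrassP (z + w) - 4 * p ^ 2 + L.g₂) * L.weierstrassP z
      + 2 * p' * L.derivWeierstrassP z
      + 4 * L.weierstrassP (z + w) * p ^ 2 + 4 * p ^ 3 + L.g₃ - p' ^ 2 := by
    simp only [additionRelation]
    linear_combination (-1) * hde
  rw [e1, hPF z, hPB z, hQ z]
  simp only [c2]
  field_simp
  ring

/-- The double pole of ℘(z+w) at -w meets the double zero of (℘(z) - ℘(w))². The value left is
4℘'(w)² - (2℘'(w))² = 0, which later identifies the constant. -/
lemma exists_analytic_additionRelation_neg {w : ℂ} (hw : w ∉ L.lattice) :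
    ∃ g, AnalyticAt ℂ g (-w) ∧ L.additionRelation w =ᶠ[𝓝[≠] (-w)] g ∧ g (-w) = 0 := by
  obtain ⟨F, hF, hPF⟩ := L.weierstrassP_expansion
  have hw' : -w ∉ L.lattice := by simpa using hw
  have ha : AnalyticAt ℂ (fun z => L.weierstrassP (z + -w)) 0 := by
    have : AnalyticAt ℂ L.weierstrassP (0 + -w) := by simpa using L.analyticAt_weierstrassP hw'
    exact this.comp (f := fun z => z + -w) (by fun_prop)
  obtain ⟨D, hD, hPD⟩ := ha.exists_eq_sum_add_pow_mul 2
  have hQ : ∀ z, L.weierstrassP z = L.weierstrassP w - (z + w) * L.derivWeierstrassP w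
      + (z + w) ^ 2 * D (z + w) := by
    intro z
    have := hPD (z + w)
    simp only [Finset.sum_range_succ, Finset.sum_range_zero, iteratedDeriv_comp_add_const,
      zero_add, smul_eq_mul, iteratedDeriv_zero, iteratedDeriv_one, add_neg_cancel_right,
      L.deriv_weierstrassP, L.weierstrassP_neg, L.derivWeierstrassP_neg] at this
    rw [this]
    norm_num [Nat.factorial]
    ring
  have hF' : AnalyticAt ℂ (fun z => F (z + w)) (-w) := by
    have : AnalyticAt ℂ F (-w + w) := by simpa using hF
    exact this.comp (f := fun z => z + w) (by fun_prop)
  have hD' : AnalyticAt ℂ (fun z => D (z + w)) (-w) := by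
    have : AnalyticAt ℂ D (-w + w) := by simpa using hD
    exact this.comp (f := fun z => z + w) (by fun_prop)
  have hP := L.analyticAt_weierstrassP hw'
  have hP' := L.analyticAt_derivWeierstrassP hw'
  set p := L.weierstrassP w
  set p' := L.derivWeierstrassP w with hp'
  refine ⟨fun z => 4 * (1 + (z + w) ^ 2 * ((z + w) ^ 2 * F (z + w) + L.weierstrassP z + p)) *
    (-p' + (z + w) * D (z + w)) ^ 2 - (L.derivWeierstrassP z - p') ^ 2, ?_, ?_, ?_⟩
  · refine AnalyticAt.sub (AnalyticAt.mul (analyticAt_const.mul ?_) (AnalyticAt.pow ?_ 2))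
      ((hP'.sub analyticAt_const).pow 2)
    · exact analyticAt_const.add ((by fun_prop : AnalyticAt ℂ (fun z => (z + w) ^ 2) (-w)).mul
        ((((by fun_prop : AnalyticAt ℂ (fun z => (z + w) ^ 2) (-w)).mul hF').add hP).add
          analyticAt_const))
    · exact analyticAt_const.add
        ((by fun_prop : AnalyticAt ℂ (fun z => z + w) (-w)).mul hD')
  · filter_upwards [self_mem_nhdsWithin] with z hz
    have hz : z + w ≠ 0 := fun h => hz (eq_neg_of_add_eq_zero_left h)
    have e1 : L.weierstrassP z - p = (z + w) * (-p' + (z + w) * D (z + w)) := by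
      rw [hQ z]; ring
    simp only [additionRelation]
    rw [e1, hPF (z + w)]
    field_simp
    ring
  · simp [L.derivWeierstrassP_neg, ← hp']
    ring

lemma additionRelation_eq_zero {w z : ℂ} (hw : w ∉ L.lattice) (hz : z ∉ L.lattice)
    (hzw : z + w ∉ L.lattice) : L.additionRelation w z = 0 := by
  have han : ∀ z, z ∉ L.lattice → z + w ∉ L.lattice →
      AnalyticAt ℂ (L.additionRelation w) z := by
    intro z hz hzw
    have h1 := L.analyticAt_weierstrassP hz
    have h2 := L.analyticAt_derivWeierstrassP hz
    have h3 : AnalyticAt ℂ (fun z => L.weierstrassP (z + w)) z :=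
      (L.analyticAt_weierstrassP hzw).comp (f := fun z => z + w) (by fun_prop)
    unfold additionRelation
    fun_prop
  have hper : ∀ z, ∀ l ∈ L.lattice, L.additionRelation w (z + l) = L.additionRelation w z :=
    fun z l hl => L.additionRelation_add w z hl
  obtain ⟨g, hg, hgeq, hg0⟩ := L.exists_analytic_additionRelation_neg hw
  obtain ⟨c, hc⟩ := L.exists_tendsto_of_elliptic hper (by
    intro z
    by_cases hz : z ∈ L.lattice
    · have := L.exists_analytic_of_add hper hz (L.exists_analytic_additionRelation_zero hw)
      simpa using this
    by_cases hzw : z + w ∈ L.lattice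
    · have := L.exists_analytic_of_add hper hzw ⟨g, hg, hgeq⟩
      simpa [add_comm z w] using this
    · exact ⟨_, han z hz hzw, .rfl⟩)
  have hc0 : c = 0 := by
    refine tendsto_nhds_unique (hc (-w)) ?_
    rw [← hg0]
    exact (hg.continuousAt.tendsto.mono_left nhdsWithin_le_nhds).congr' hgeq.symm
  rw [← hc0]
  exact tendsto_nhds_unique
    ((han z hz hzw).continuousAt.tendsto.mono_left (nhdsWithin_le_nhds (s := {z}ᶜ))) (hc z)

/-- With ℘'(w) = 0 the addition relation reads kf² = f'², where f = ℘ - ℘(w) and k is analytic at z.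
A zero of f of order n ≥ 1 at z would give 2n ≤ 2(n-1). -/
lemma weierstrassP_ne_of_derivWeierstrassP_eq_zero {w z : ℂ} (hw : w ∉ L.lattice)
    (hz : z ∉ L.lattice) (hzw : z + w ∉ L.lattice) (h0 : L.derivWeierstrassP w = 0) :
    L.weierstrassP z ≠ L.weierstrassP w := by
  intro heq
  set f : ℂ → ℂ := fun v => L.weierstrassP v - L.weierstrassP w with hf
  have hfa : AnalyticAt ℂ f z := (L.analyticAt_weierstrassP hz).sub analyticAt_const
  have hdf : deriv f = L.derivWeierstrassP := by
    rw [← L.deriv_weierstrassP]; ext v; simp [hf]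
  have hft : meromorphicOrderAt f z ≠ ⊤ := by
    intro h
    have h1 : ∀ᶠ v in 𝓝[≠] z, f v = 0 := meromorphicOrderAt_eq_top_iff.mp h
    have h2 : f =ᶠ[𝓝 z] fun _ => 0 := by
      filter_upwards [eventually_nhdsWithin_iff.mp h1] with v hv
      by_cases hvz : v = z
      · subst hvz; simp [hf, heq]
      · exact hv hvz
    have h3 := h2.deriv
    rw [hdf] at h3
    obtain ⟨v, hv, hv'⟩ := ((h3.filter_mono (nhdsWithin_le_nhds (s := {z}ᶜ))).and
      (L.eventually_derivWeierstrassP_ne_zero z)).exists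
    exact hv' (by simpa using hv)
  obtain ⟨n, hn⟩ := WithTop.ne_top_iff_exists.mp hft
  have hnpos : 0 < n := by
    have : 0 < meromorphicOrderAt f z := by
      rw [← tendsto_zero_iff_meromorphicOrderAt_pos hfa.meromorphicAt]
      have := hfa.continuousAt.tendsto.mono_left (nhdsWithin_le_nhds (s := {z}ᶜ))
      simpa [hf, heq] using this
    rw [← hn] at this
    exact_mod_cast this
  have hd : meromorphicOrderAt L.derivWeierstrassP z = ↑(n - 1) := by
    rw [← hdf]
    exact meromorphicOrderAt_deriv_eq_sub_one (by exact_mod_cast hnpos.ne') hn.symm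
  set k : ℂ → ℂ := fun v => 4 * (L.weierstrassP (v + w) + L.weierstrassP v + L.weierstrassP w)
  have hk : AnalyticAt ℂ k z := by
    have h1 := L.analyticAt_weierstrassP hz
    have h3 : AnalyticAt ℂ (fun z => L.weierstrassP (z + w)) z :=
      (L.analyticAt_weierstrassP hzw).comp (f := fun z => z + w) (by fun_prop)
    fun_prop
  have hE : k * f ^ 2 =ᶠ[𝓝[≠] z] L.derivWeierstrassP ^ 2 := by
    have h1 : ∀ᶠ v in 𝓝 z, v + w ∉ L.lattice :=
      (continuous_id.add continuous_const).tendsto z |>.eventually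
        (L.eventually_notMem_lattice_of_notMem hzw)
    filter_upwards [mem_nhdsWithin_of_mem_nhds (L.eventually_notMem_lattice_of_notMem hz),
      mem_nhdsWithin_of_mem_nhds h1] with v hv hv'
    have := L.additionRelation_eq_zero hw hv hv'
    simp only [additionRelation, h0, sub_zero] at this
    simp only [Pi.mul_apply, Pi.pow_apply, k, hf]
    linear_combination this
  have h5 := meromorphicOrderAt_congr hE
  rw [meromorphicOrderAt_mul hk.meromorphicAt (hfa.meromorphicAt.pow 2),
    meromorphicOrderAt_pow hfa.meromorphicAt,
    meromorphicOrderAt_pow (L.meromorphic_derivWeierstrassP z), hd, ← hn] at h5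
  have h6 := hk.meromorphicOrderAt_nonneg
  have h7 : ((2 : ℕ) : WithTop ℤ) * (n : WithTop ℤ) ≤ ((2 : ℕ) : WithTop ℤ) * ↑(n - 1) := by
    rw [← h5]
    exact le_add_of_nonneg_left h6
  have h8 : ((2 * n : ℤ) : WithTop ℤ) ≤ ((2 * (n - 1) : ℤ) : WithTop ℤ) := h7
  rw [WithTop.coe_le_coe] at h8
  omega

lemma derivWeierstrassP_ne_zero {w : ℂ} (hw : w ∉ L.lattice) (h2w : w + w ∉ L.lattice) :
    L.derivWeierstrassP w ≠ 0 := fun h0 =>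
  L.weierstrassP_ne_of_derivWeierstrassP_eq_zero hw hw h2w h0 rfl

/-- `℘` separates points modulo `±1` and the lattice. -/
lemma weierstrassP_eq_iff {w z : ℂ} (hw : w ∉ L.lattice) (hz : z ∉ L.lattice) :
    L.weierstrassP z = L.weierstrassP w ↔ z + w ∈ L.lattice ∨ z - w ∈ L.lattice := by
  constructor
  · intro h
    by_contra! hcon
    obtain ⟨h1, h2⟩ := hcon
    have hw' : -w ∉ L.lattice := by simpa using hw
    -- The relation for w and for -w, with ℘(z) = ℘(w), gives ℘'(z) = ℘'(w) and ℘'(z) = -℘'(w). So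
    -- ℘'(w) = 0, the case already excluded.
    have e1 := L.additionRelation_eq_zero hw hz h1
    have e2 := L.additionRelation_eq_zero hw' hz (by simpa [sub_eq_add_neg] using h2)
    simp only [additionRelation, L.weierstrassP_neg, L.derivWeierstrassP_neg, h] at e1 e2
    have e3 : L.derivWeierstrassP z - L.derivWeierstrassP w = 0 := by
      rw [← sq_eq_zero_iff]; linear_combination -e1
    have e4 : L.derivWeierstrassP z + L.derivWeierstrassP w = 0 := by
      rw [← sq_eq_zero_iff]; linear_combination -e2
    have e5 : L.derivWeierstrassP w = 0 := by linear_combination (e4 - e3) / 2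
    exact L.weierstrassP_ne_of_derivWeierstrassP_eq_zero hw hz h1 e5 h
  · rintro (h | h)
    · have := L.weierstrassP_add_coe (-w) ⟨_, h⟩
      rw [L.weierstrassP_neg] at this
      rw [← this]; congr 1; ring
    · have := L.weierstrassP_add_coe w ⟨_, h⟩
      rw [← this]; congr 1; ring

/-- If ℘ omitted c, then 1/(℘ - c) would be elliptic without poles, hence constant, and it tends to
0 at the lattice points. But an inverse is nonzero elsewhere. -/
lemma exists_weierstrassP_eq (c : ℂ) : ∃ z ∉ L.lattice, L.weierstrassP z = c := by
  by_contra! hne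
  obtain ⟨F, hF, hPF⟩ := L.weierstrassP_expansion
  have hper : ∀ z, ∀ l ∈ L.lattice, (fun z => (L.weierstrassP z - c)⁻¹) (z + l) =
      (fun z => (L.weierstrassP z - c)⁻¹) z := by
    intro z l hl
    lift l to L.lattice using hl
    simp
  have h0 : ∃ g, AnalyticAt ℂ g 0 ∧ (fun z => (L.weierstrassP z - c)⁻¹) =ᶠ[𝓝[≠] 0] g
      ∧ g 0 = 0 := by
    refine ⟨fun z => z ^ 2 / (1 + z ^ 2 * (z ^ 2 * F z - c)), ?_, ?_, by simp⟩
    · refine AnalyticAt.div (by fun_prop) (by fun_prop) (by simp)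
    · filter_upwards [self_mem_nhdsWithin] with z hz
      have hz : z ≠ 0 := hz
      show (L.weierstrassP z - c)⁻¹ = _
      rw [hPF z, inv_eq_one_div]
      have : 1 / z ^ 2 + z ^ 2 * F z - c = (1 + z ^ 2 * (z ^ 2 * F z - c)) / z ^ 2 := by
        field_simp
        ring
      rw [this, one_div_div]
  have han : ∀ z ∉ L.lattice, AnalyticAt ℂ (fun z => (L.weierstrassP z - c)⁻¹) z := by
    intro z hz
    exact ((L.analyticAt_weierstrassP hz).sub analyticAt_const).inv (sub_ne_zero.mpr (hne z hz))
  obtain ⟨g, hg, hgeq, hg0⟩ := h0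
  obtain ⟨d, hd⟩ := L.exists_tendsto_of_elliptic hper (by
    intro z
    by_cases hz : z ∈ L.lattice
    · simpa using L.exists_analytic_of_add hper hz ⟨g, hg, hgeq⟩
    · exact ⟨_, han z hz, .rfl⟩)
  have hd0 : d = 0 := by
    refine tendsto_nhds_unique (hd 0) (Eq.subst (motive := fun x => Tendsto _ _ (𝓝 x)) hg0 ?_)
    exact (hg.continuousAt.tendsto.mono_left nhdsWithin_le_nhds).congr' hgeq.symm
  have hz := L.ω₁_div_two_notMem_lattice
  have := tendsto_nhds_unique ((han _ hz).continuousAt.tendsto.mono_left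
    (nhdsWithin_le_nhds (s := {L.ω₁ / 2}ᶜ))) (hd (L.ω₁ / 2))
  rw [hd0, inv_eq_zero, sub_eq_zero] at this
  exact hne _ hz this

/-- The addition theorem for `℘`. -/
lemma weierstrassP_add {w z : ℂ} (hw : w ∉ L.lattice) (hz : z ∉ L.lattice)
    (hzw : z + w ∉ L.lattice) (hne : L.weierstrassP z ≠ L.weierstrassP w) :
    L.weierstrassP (z + w) = ((L.derivWeierstrassP z - L.derivWeierstrassP w) /
      (L.weierstrassP z - L.weierstrassP w)) ^ 2 / 4 - L.weierstrassP z - L.weierstrassP w := by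
  have h := L.additionRelation_eq_zero hw hz hzw
  have h1 : L.weierstrassP z - L.weierstrassP w ≠ 0 := sub_ne_zero.mpr hne
  simp only [additionRelation] at h
  field_simp
  linear_combination h

/-- The addition theorem for `℘'`. -/
lemma derivWeierstrassP_add {w z : ℂ} (hw : w ∉ L.lattice) (hz : z ∉ L.lattice)
    (hzw : z + w ∉ L.lattice) (hne : L.weierstrassP z ≠ L.weierstrassP w) :
    L.derivWeierstrassP (z + w) = -L.derivWeierstrassP z -
      (L.derivWeierstrassP z - L.derivWeierstrassP w) / (L.weierstrassP z - L.weierstrassP w) *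
      (L.weierstrassP (z + w) - L.weierstrassP z) := by
  have hx := L.weierstrassP_add hw hz hzw hne
  have h1 : L.weierstrassP z - L.weierstrassP w ≠ 0 := sub_ne_zero.mpr hne
  have dP := L.hasDerivAt_weierstrassP hz
  have dP' := L.hasDerivAt_derivWeierstrassP hz
  -- The addition theorem for ℘ is differentiated in z. The Weierstrass equations at z and w then
  -- reduce the result to the chord formula.
  have dPw : HasDerivAt (fun v => L.weierstrassP (v + w)) (L.derivWeierstrassP (z + w)) z :=
    (L.hasDerivAt_weierstrassP hzw).comp_add_const z w
  have dS := ((((dP'.sub_const (L.derivWeierstrassP w)).div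
    (dP.sub_const (L.weierstrassP w)) h1).pow 2).div_const 4).sub dP
  have dS' := dS.sub_const (L.weierstrassP w)
  have hev : (fun v => L.weierstrassP (v + w)) =ᶠ[𝓝 z] fun v =>
      ((L.derivWeierstrassP v - L.derivWeierstrassP w) /
      (L.weierstrassP v - L.weierstrassP w)) ^ 2 / 4 - L.weierstrassP v - L.weierstrassP w := by
    have e1 : ∀ᶠ v in 𝓝 z, v + w ∉ L.lattice :=
      (continuous_id.add continuous_const).tendsto z |>.eventually
        (L.eventually_notMem_lattice_of_notMem hzw)
    filter_upwards [L.eventually_notMem_lattice_of_notMem hz, e1,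
      (L.analyticAt_weierstrassP hz).continuousAt.eventually_ne hne] with v hv hv' hv''
    exact L.weierstrassP_add hw hv hv' hv''
  have e := dPw.unique (dS'.congr_of_eventuallyEq hev)
  rw [e, hx]
  have hdz := L.derivWeierstrassP_sq z hz
  have hdw := L.derivWeierstrassP_sq w hw
  simp only [Pi.div_apply]
  set a := L.weierstrassP z
  set b := L.weierstrassP w
  set a' := L.derivWeierstrassP z
  set b' := L.derivWeierstrassP w
  norm_num
  field_simp
  linear_combination (a' - b') * (hdw - hdz)

end PeriodPair

end

/-! ### Parametrization of a Weierstrass curve by ℘ and ℘'. -/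

section

namespace PeriodPair

variable (L : PeriodPair)

/-- The Weierstrass curve `y² = x³ - (g₂/4)x - g₃/4` of a lattice. -/
def curve : WeierstrassCurve ℂ := ⟨0, 0, 0, -L.g₂ / 4, -L.g₃ / 4⟩

variable {L} {E : WeierstrassCurve ℂ} (C : WeierstrassCurve.VariableChange ℂ)

/-- Explicit coefficients turn the later identities on E into polynomial identities in ℘, ℘' and the
parameters of C. -/
lemma coefficients_of_smul_eq_curve (h : C • E = L.curve) :
    E.a₁ = -2 * C.s ∧ E.a₂ = -3 * C.r - C.s ^ 2 ∧ E.a₃ = 2 * C.r * C.s - 2 * C.t ∧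
    E.a₄ = -C.u ^ 4 * L.g₂ / 4 + 3 * C.r ^ 2 + 2 * C.r * C.s ^ 2 - 2 * C.s * C.t ∧
    E.a₆ = -C.u ^ 6 * L.g₃ / 4 + C.u ^ 4 * L.g₂ / 4 * C.r - (C.r * C.s - C.t) ^ 2 - C.r ^ 3 := by
  have hu : (C.u : ℂ) ≠ 0 := C.u.ne_zero
  have e1 : (C • E).a₁ = 0 := by rw [h]; rfl
  have e2 : (C • E).a₂ = 0 := by rw [h]; rfl
  have e3 : (C • E).a₃ = 0 := by rw [h]; rfl
  have e4 : (C • E).a₄ = -L.g₂ / 4 := by rw [h]; rfl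
  have e6 : (C • E).a₆ = -L.g₃ / 4 := by rw [h]; rfl
  rw [WeierstrassCurve.variableChange_a₁, Units.val_inv_eq_inv_val] at e1
  rw [WeierstrassCurve.variableChange_a₂, Units.val_inv_eq_inv_val] at e2
  rw [WeierstrassCurve.variableChange_a₃, Units.val_inv_eq_inv_val] at e3
  rw [WeierstrassCurve.variableChange_a₄, Units.val_inv_eq_inv_val] at e4
  rw [WeierstrassCurve.variableChange_a₆, Units.val_inv_eq_inv_val] at e6
  have h1 : E.a₁ = -2 * C.s := by
    field_simp at e1; linear_combination e1
  have h2 : E.a₂ = -3 * C.r - C.s ^ 2 := by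
    field_simp at e2; rw [h1] at e2; linear_combination e2
  have h3 : E.a₃ = 2 * C.r * C.s - 2 * C.t := by
    field_simp at e3; rw [h1] at e3; linear_combination e3
  have h4 : E.a₄ = -C.u ^ 4 * L.g₂ / 4 + 3 * C.r ^ 2 + 2 * C.r * C.s ^ 2 - 2 * C.s * C.t := by
    field_simp at e4; rw [h1, h2, h3] at e4; linear_combination e4 / 4
  refine ⟨h1, h2, h3, h4, ?_⟩
  field_simp at e6; rw [h1, h2, h3, h4] at e6; linear_combination e6 / 4

variable (L)

/-- The `x`-coordinate of the parametrization of a curve isomorphic to `L.curve`. -/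
def coordX (z : ℂ) : ℂ := C.u ^ 2 * L.weierstrassP z + C.r

/-- The `y`-coordinate of the parametrization of a curve isomorphic to `L.curve`. -/
def coordY (z : ℂ) : ℂ :=
  C.u ^ 3 * (L.derivWeierstrassP z / 2) + C.u ^ 2 * C.s * L.weierstrassP z + C.t

variable {L}

lemma equation_coord (h : C • E = L.curve) {z : ℂ} (hz : z ∉ L.lattice) :
    E.toAffine.Equation (L.coordX C z) (L.coordY C z) := by
  obtain ⟨h1, h2, h3, h4, h6⟩ := coefficients_of_smul_eq_curve C h
  rw [WeierstrassCurve.Affine.equation_iff]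
  rw [h1, h2, h3, h4, h6]
  have := L.derivWeierstrassP_sq z hz
  simp only [coordX, coordY]
  linear_combination C.u ^ 6 / 4 * this

lemma nonsingular_coord [E.IsElliptic] (h : C • E = L.curve) {z : ℂ} (hz : z ∉ L.lattice) :
    E.toAffine.Nonsingular (L.coordX C z) (L.coordY C z) :=
  WeierstrassCurve.Affine.equation_iff_nonsingular.mp (equation_coord C h hz)

lemma some_congr {x y x' y' : ℂ} {h : E.toAffine.Nonsingular x y}
    {h' : E.toAffine.Nonsingular x' y'} (hx : x = x') (hy : y = y') :
    (WeierstrassCurve.Affine.Point.some x y h : E.toAffine.Point) = .some x' y' h' := by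
  subst hx hy; rfl

open Classical in
/-- The parametrization of a curve isomorphic to `L.curve` by the complex plane. -/
def param [E.IsElliptic] (h : C • E = L.curve) (z : ℂ) : E.toAffine.Point :=
  if hz : z ∈ L.lattice then 0 else .some _ _ (nonsingular_coord C h hz)

section

variable [E.IsElliptic] (h : C • E = L.curve)

lemma param_of_mem {z : ℂ} (hz : z ∈ L.lattice) : param C h z = 0 := dif_pos hz

lemma param_of_notMem {z : ℂ} (hz : z ∉ L.lattice) :
    param C h z = .some _ _ (nonsingular_coord C h hz) := dif_neg hz

lemma param_eq_zero_iff {z : ℂ} : param C h z = 0 ↔ z ∈ L.lattice := by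
  refine ⟨fun h0 => ?_, param_of_mem C h⟩
  by_contra hz
  rw [param_of_notMem C h hz] at h0
  exact WeierstrassCurve.Affine.Point.some_ne_zero _ h0

lemma param_add_lattice (z : ℂ) {l : ℂ} (hl : l ∈ L.lattice) :
    param C h (z + l) = param C h z := by
  by_cases hz : z ∈ L.lattice
  · rw [param_of_mem C h hz, param_of_mem C h (add_mem hz hl)]
  · have hz' : z + l ∉ L.lattice := fun hc => hz (by simpa using sub_mem hc hl)
    rw [param_of_notMem C h hz, param_of_notMem C h hz']
    lift l to L.lattice using hl
    exact some_congr (by simp [coordX, L.weierstrassP_add_coe])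
      (by simp [coordY, L.weierstrassP_add_coe, L.derivWeierstrassP_add_coe])

lemma param_neg (z : ℂ) : param C h (-z) = -param C h z := by
  by_cases hz : z ∈ L.lattice
  · rw [param_of_mem C h hz, param_of_mem C h (neg_mem hz), neg_zero]
  · have hz' : -z ∉ L.lattice := by simpa using hz
    rw [param_of_notMem C h hz, param_of_notMem C h hz', WeierstrassCurve.Affine.Point.neg_some]
    obtain ⟨h1, h2, h3, h4, h6⟩ := coefficients_of_smul_eq_curve C h
    refine some_congr (by simp [coordX, L.weierstrassP_neg]) ?_
    rw [WeierstrassCurve.Affine.negY]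
    change _ = _ - E.a₁ * _ - E.a₃
    rw [h1, h3]
    simp only [coordX, coordY, L.weierstrassP_neg, L.derivWeierstrassP_neg]
    ring

/-- The two x-coordinates differ, so the sum is given by the chord. Its slope is affine in (℘'(z) -
℘'(w))/(℘(z) - ℘(w)), and the addition theorems for ℘ and ℘' are exactly the chord law. -/
lemma param_add_of_generic {z w : ℂ} (hz : z ∉ L.lattice) (hw : w ∉ L.lattice)
    (hzw : z + w ∉ L.lattice) (hzw' : z - w ∉ L.lattice) :
    param C h (z + w) = param C h z + param C h w := by
  have hne : L.weierstrassP z ≠ L.weierstrassP w := by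
    rw [Ne, L.weierstrassP_eq_iff hw hz]; tauto
  have hne' : L.weierstrassP z - L.weierstrassP w ≠ 0 := sub_ne_zero.mpr hne
  have hu : (C.u : ℂ) ≠ 0 := C.u.ne_zero
  have hX : L.coordX C z ≠ L.coordX C w := by
    simp only [coordX, ne_eq, add_left_inj, mul_eq_mul_left_iff, not_or]
    exact ⟨hne, pow_ne_zero _ hu⟩
  obtain ⟨h1, h2, h3, h4, h6⟩ := coefficients_of_smul_eq_curve C h
  rw [param_of_notMem C h hz, param_of_notMem C h hw, param_of_notMem C h hzw,
    WeierstrassCurve.Affine.Point.add_of_X_ne hX]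
  have hslope : E.toAffine.slope (L.coordX C z) (L.coordX C w) (L.coordY C z) (L.coordY C w) =
      C.u / 2 * ((L.derivWeierstrassP z - L.derivWeierstrassP w) /
      (L.weierstrassP z - L.weierstrassP w)) + C.s := by
    rw [WeierstrassCurve.Affine.slope_of_X_ne hX]
    have : L.coordX C z - L.coordX C w = C.u ^ 2 * (L.weierstrassP z - L.weierstrassP w) := by
      simp only [coordX]; ring
    rw [this]
    simp only [coordY]
    field_simp
    ring
  have ex := L.weierstrassP_add hw hz hzw hne
  have ey := L.derivWeierstrassP_add hw hz hzw hne
  set S := (L.derivWeierstrassP z - L.derivWeierstrassP w) /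
      (L.weierstrassP z - L.weierstrassP w)
  have hx : L.coordX C (z + w) = E.toAffine.addX (L.coordX C z) (L.coordX C w)
      (E.toAffine.slope (L.coordX C z) (L.coordX C w) (L.coordY C z) (L.coordY C w)) := by
    rw [hslope, WeierstrassCurve.Affine.addX]
    change _ = _ + E.a₁ * _ - E.a₂ - _ - _
    rw [h1, h2]
    simp only [coordX, ex]
    ring
  refine some_congr hx ?_
  rw [WeierstrassCurve.Affine.addY, WeierstrassCurve.Affine.negAddY,
    WeierstrassCurve.Affine.negY, ← hx, hslope]
  change _ = _ - E.a₁ * _ - E.a₃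
  rw [h1, h3]
  simp only [coordX, coordY, ey]
  ring

/-- The tangent law is avoided: z + z = (z + v) + (z - v) for a small generic v, and the generic
addition law applies to this sum and to each of z ± v. If 2z is a period, z and -z have the same
image. -/
lemma param_add_self (z : ℂ) : param C h (z + z) = param C h z + param C h z := by
  by_cases hz : z ∈ L.lattice
  · rw [param_of_mem C h hz, param_of_mem C h (add_mem hz hz), add_zero]
  by_cases h2z : z + z ∈ L.lattice
  · have : param C h z = -param C h z := by
      rw [← param_neg, ← param_add_lattice C h (-z) h2z]; congr 1; ring
    nth_rewrite 2 [this]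
    rw [param_of_mem C h h2z, add_neg_cancel]
  have t1 : ∀ᶠ v in 𝓝[≠] (0 : ℂ), v + v ∉ L.lattice := by
    have : Tendsto (fun v : ℂ => v + v) (𝓝[≠] 0) (𝓝[≠] 0) := by
      refine tendsto_nhdsWithin_iff.mpr ⟨?_, ?_⟩
      · have : Tendsto (fun v : ℂ => v + v) (𝓝 0) (𝓝 (0 + 0)) :=
          Continuous.tendsto (by fun_prop) _
        rw [add_zero] at this
        exact this.mono_left nhdsWithin_le_nhds
      · filter_upwards [self_mem_nhdsWithin] with w hw
        simpa using hw
    exact this.eventually (L.eventually_notMem_lattice 0)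
  have t2 : ∀ᶠ v in 𝓝[≠] (0 : ℂ), z + v ∉ L.lattice := by
    have : Tendsto (fun v : ℂ => z + v) (𝓝 0) (𝓝 (z + 0)) := Continuous.tendsto (by fun_prop) _
    rw [add_zero] at this
    exact (this.eventually (L.eventually_notMem_lattice_of_notMem hz)).filter_mono
      nhdsWithin_le_nhds
  have t3 : ∀ᶠ v in 𝓝[≠] (0 : ℂ), z - v ∉ L.lattice := by
    have : Tendsto (fun v : ℂ => z - v) (𝓝 0) (𝓝 (z - 0)) := Continuous.tendsto (by fun_prop) _
    rw [sub_zero] at this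
    exact (this.eventually (L.eventually_notMem_lattice_of_notMem hz)).filter_mono
      nhdsWithin_le_nhds
  obtain ⟨v, hv, h2v, hzv, hzv'⟩ :=
    ((L.eventually_notMem_lattice 0).and (t1.and (t2.and t3))).exists
  have e1 := param_add_of_generic C h hz hv hzv hzv'
  have e2 := param_add_of_generic C h (w := -v) hz (by simpa using hv)
    (by simpa [← sub_eq_add_neg] using hzv') (by simpa using hzv)
  have e3 := param_add_of_generic C h hzv hzv' (by rwa [show z + v + (z - v) = z + z by ring])
    (by rwa [show z + v - (z - v) = v + v by ring])
  rw [param_neg, ← sub_eq_add_neg] at e2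
  rw [e1, e2] at e3
  have : z + v + (z - v) = z + z := by ring
  rw [this] at e3
  rw [e3]
  abel

lemma param_add (z w : ℂ) : param C h (z + w) = param C h z + param C h w := by
  by_cases hw : w ∈ L.lattice
  · rw [param_add_lattice C h z hw, param_of_mem C h hw, add_zero]
  by_cases hz : z ∈ L.lattice
  · rw [add_comm, param_add_lattice C h w hz, param_of_mem C h hz, zero_add]
  by_cases hzw : z + w ∈ L.lattice
  · have : param C h w = -param C h z := by
      rw [← param_neg, ← param_add_lattice C h (-z) hzw]; congr 1; ring
    rw [this, param_of_mem C h hzw, add_neg_cancel]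
  by_cases hzw' : z - w ∈ L.lattice
  · have e : param C h z = param C h w := by
      rw [← param_add_lattice C h w hzw']; congr 1; ring
    rw [e, ← param_add_self, ← param_add_lattice C h (w + w) hzw']; congr 1; ring
  exact param_add_of_generic C h hz hw hzw hzw'

/-- Some z has the required x-coordinate because ℘ takes every value. Points with equal x are equal
or opposite, so z or -z works. -/
lemma param_surjective : Function.Surjective (param C h) := by
  rintro (_ | ⟨x, y, hxy⟩)
  · exact ⟨0, param_of_mem C h (zero_mem _)⟩
  · have hu : (C.u : ℂ) ≠ 0 := C.u.ne_zero
    obtain ⟨z, hz, hzx⟩ := L.exists_weierstrassP_eq ((x - C.r) / C.u ^ 2)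
    have hX : x = L.coordX C z := by
      simp only [coordX, hzx]; field_simp; ring
    rcases (WeierstrassCurve.Affine.Point.X_eq_iff (h₁ := hxy)
      (h₂ := nonsingular_coord C h hz)).mp hX with h1 | h1
    · exact ⟨z, by rw [param_of_notMem C h hz, h1]⟩
    · exact ⟨-z, by rw [param_neg, param_of_notMem C h hz, h1]⟩

/-- The parametrization as a homomorphism from the complex plane. -/
def paramHom : ℂ →+ E.toAffine.Point where
  toFun := param C h
  map_zero' := param_of_mem C h (zero_mem _)
  map_add' := param_add C h

end

end PeriodPair

namespace EllipticDiscrepancy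

lemma linearIndependent_one_tau (τ : ℍ) : LinearIndependent ℝ ![(1 : ℂ), (τ : ℂ)] := by
  rw [LinearIndependent.pair_iff]
  intro s t h
  have him := congrArg Complex.im h
  have hre := congrArg Complex.re h
  simp at him hre
  have ht : t = 0 := by
    rcases him with h | h
    · exact h
    · exact absurd h τ.im_ne_zero
  subst ht
  simpa using hre

/-- The period pair `(1, τ)`. -/
def periodPair (τ : ℍ) : PeriodPair := ⟨1, τ, linearIndependent_one_tau τ⟩

lemma mem_lattice_iff {τ : ℍ} {z : ℂ} : z ∈ lattice τ ↔ ∃ m n : ℤ, z = m + n * (τ : ℂ) := by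
  rw [lattice, AddSubgroup.mem_closure_pair]
  simp [eq_comm]

lemma mem_periodPair_lattice {τ : ℍ} {z : ℂ} : z ∈ (periodPair τ).lattice ↔ z ∈ lattice τ := by
  rw [PeriodPair.mem_lattice, mem_lattice_iff]
  simp [periodPair, eq_comm]

lemma exists_isUniformization_of_smul_eq {E : WeierstrassCurve ℂ} [E.IsElliptic] {τ : ℍ}
    (C : WeierstrassCurve.VariableChange ℂ) (h : C • E = (periodPair τ).curve) :
    ∃ e : Torus τ →+ E.toAffine.Point, IsUniformization e := by
  have hker : ∀ z ∈ lattice τ, PeriodPair.paramHom C h z = 0 := fun z hz =>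
    PeriodPair.param_of_mem C h (mem_periodPair_lattice.mpr hz)
  refine ⟨QuotientAddGroup.lift (lattice τ) (PeriodPair.paramHom C h) hker, ⟨?_, ?_⟩, ?_⟩
  · rw [injective_iff_map_eq_zero]
    intro P hP
    induction P using QuotientAddGroup.induction_on with
    | H z =>
      have : PeriodPair.param C h z = 0 := hP
      rw [PeriodPair.param_eq_zero_iff, mem_periodPair_lattice] at this
      exact (QuotientAddGroup.eq_zero_iff z).mpr this
  · intro P
    obtain ⟨z, hz⟩ := PeriodPair.param_surjective C h P
    exact ⟨(z : Torus τ), hz⟩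
  · have hd : ∀ z ∈ (lattice τ : Set ℂ)ᶜ, z ∉ (periodPair τ).lattice := fun z hz hz' =>
      hz (mem_periodPair_lattice.mp hz')
    have m1 := (periodPair τ).meromorphic_weierstrassP
    have m2 := (periodPair τ).meromorphic_derivWeierstrassP
    refine ⟨(periodPair τ).coordX C, (periodPair τ).coordY C, ?_, ?_, ?_, ?_, ?_⟩
    · unfold PeriodPair.coordX; fun_prop
    · unfold PeriodPair.coordY; fun_prop
    · intro z hz
      have := ((periodPair τ).analyticAt_weierstrassP (hd z hz)).differentiableAt
      apply DifferentiableAt.differentiableWithinAt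
      unfold PeriodPair.coordX; fun_prop
    · intro z hz
      have := ((periodPair τ).analyticAt_weierstrassP (hd z hz)).differentiableAt
      have := ((periodPair τ).analyticAt_derivWeierstrassP (hd z hz)).differentiableAt
      apply DifferentiableAt.differentiableWithinAt
      unfold PeriodPair.coordY; fun_prop
    · intro z hz
      exact ⟨_, PeriodPair.param_of_notMem C h (hd z hz)⟩

end EllipticDiscrepancy

end

/-! ### The j-function, its surjectivity, and the existence of a uniformization. -/

section

open Filter Topology ModularForm EisensteinSeries ModularGroup
open scoped MatrixGroups Modular

namespace EllipticDiscrepancy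

lemma G_periodPair {k : ℕ} (hk : 3 ≤ k) (τ : ℍ) :
    (periodPair τ).G k = 2 * riemannZeta k * ModularForm.E hk τ := by
  have h1 : (periodPair τ).G k = ∑' v : Fin 2 → ℤ, eisSummand k v τ := by
    -- The coordinates are swapped: the period pair puts the coefficient of 1 first, the Eisenstein
    -- summand that of τ.
    rw [PeriodPair.G, ← (((finTwoArrowEquiv ℤ).trans (Equiv.prodComm ℤ ℤ)).trans
      (periodPair τ).latticeEquivProd.symm.toEquiv).tsum_eq]
    refine tsum_congr fun v => ?_
    have := (periodPair τ).latticeEquiv_symm_apply (v 1, v 0)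
    change (((periodPair τ).latticeEquivProd.symm (v 1, v 0) : ℂ) ^ k)⁻¹ = _
    rw [this, eisSummand]
    simp [periodPair, add_comm]
  rw [h1, tsum_eisSummand_eq_riemannZeta_mul_eisensteinSeries hk]
  have : ModularForm.E hk τ = (1 / 2 : ℂ) • eisensteinSeriesSIF (N := 1) 0 k τ := rfl
  rw [this, eisensteinSeriesSIF_apply, smul_eq_mul]
  ring

lemma riemannZeta_six : riemannZeta 6 = (π : ℂ) ^ 6 / 945 := by
  have h := riemannZeta_two_mul_nat (k := 3) (by norm_num)
  have hb : bernoulli (2 * 3) = 1 / 42 := by decide +kernel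
  rw [hb] at h
  norm_num [Nat.factorial] at h
  rw [h]
  ring

lemma g₂_periodPair (τ : ℍ) : (periodPair τ).g₂ = 4 * (π : ℂ) ^ 4 / 3 * E₄ τ := by
  rw [PeriodPair.g₂, G_periodPair (by norm_num : 3 ≤ 4)]
  norm_num [riemannZeta_four]
  ring

lemma g₃_periodPair (τ : ℍ) : (periodPair τ).g₃ = 8 * (π : ℂ) ^ 6 / 27 * E₆ τ := by
  rw [PeriodPair.g₃, G_periodPair (by norm_num : 3 ≤ 6)]
  norm_num [riemannZeta_six]
  ring

/-- The `j`-function on the upper half plane. -/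
def jFunction (τ : ℍ) : ℂ := E₄ τ ^ 3 / ModularForm.discriminant τ

lemma discriminant_periodPair (τ : ℍ) :
    (periodPair τ).g₂ ^ 3 - 27 * (periodPair τ).g₃ ^ 2 =
      4096 * (π : ℂ) ^ 12 * ModularForm.discriminant τ := by
  rw [g₂_periodPair, g₃_periodPair, discriminant_eq_E₄_cube_sub_E₆_sq]
  ring

lemma discriminant_periodPair_ne_zero (τ : ℍ) :
    (periodPair τ).g₂ ^ 3 - 27 * (periodPair τ).g₃ ^ 2 ≠ 0 := by
  rw [discriminant_periodPair]
  have hπ : (π : ℂ) ≠ 0 := by exact_mod_cast Real.pi_ne_zero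
  exact mul_ne_zero (mul_ne_zero (by norm_num) (pow_ne_zero _ hπ))
    (ModularForm.discriminant_ne_zero τ)

lemma jFunction_eq (τ : ℍ) : jFunction τ = 1728 * (periodPair τ).g₂ ^ 3 /
    ((periodPair τ).g₂ ^ 3 - 27 * (periodPair τ).g₃ ^ 2) := by
  rw [discriminant_periodPair, g₂_periodPair, jFunction]
  have := ModularForm.discriminant_ne_zero τ
  have hπ : (π : ℂ) ≠ 0 := by exact_mod_cast Real.pi_ne_zero
  field_simp
  ring

lemma curve_Δ (τ : ℍ) : (periodPair τ).curve.Δ =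
    (periodPair τ).g₂ ^ 3 - 27 * (periodPair τ).g₃ ^ 2 := by
  simp only [PeriodPair.curve, WeierstrassCurve.Δ, WeierstrassCurve.b₂, WeierstrassCurve.b₄,
    WeierstrassCurve.b₆, WeierstrassCurve.b₈]
  ring

instance (τ : ℍ) : (periodPair τ).curve.IsElliptic := by
  rw [WeierstrassCurve.isElliptic_iff, curve_Δ]
  exact (discriminant_periodPair_ne_zero τ).isUnit

lemma j_eq_div (E : WeierstrassCurve ℂ) [E.IsElliptic] : E.j = E.c₄ ^ 3 / E.Δ := by
  rw [WeierstrassCurve.j, Units.val_inv_eq_inv_val, WeierstrassCurve.coe_Δ']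
  ring

lemma curve_j (τ : ℍ) : (periodPair τ).curve.j = jFunction τ := by
  rw [j_eq_div, curve_Δ, jFunction_eq]
  congr 1
  simp only [PeriodPair.curve, WeierstrassCurve.c₄, WeierstrassCurve.b₂, WeierstrassCurve.b₄]
  ring

lemma jFunction_smul (γ : SL(2, ℤ)) (τ : ℍ) : jFunction (γ • τ) = jFunction τ := by
  set d := UpperHalfPlane.denom (Matrix.SpecialLinearGroup.mapGL ℝ γ) τ with hd
  have hγ : Matrix.SpecialLinearGroup.mapGL ℝ γ ∈ 𝒮ℒ := ⟨γ, rfl⟩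
  have h1 : E₄ (γ • τ) = d ^ (4 : ℤ) * E₄ τ :=
    SlashInvariantForm.slash_action_eqn'' E₄ hγ τ
  have h2 : ModularForm.discriminant (γ • τ) = d ^ (12 : ℤ) * ModularForm.discriminant τ :=
    SlashInvariantForm.slash_action_eqn'' CuspForm.discriminant hγ τ
  have h3 : d ≠ 0 := UpperHalfPlane.denom_ne_zero _ _
  rw [jFunction, jFunction, h1, h2]
  have := ModularForm.discriminant_ne_zero τ
  have e4 : d ^ (4 : ℤ) = d ^ 4 := zpow_natCast d 4
  have e12 : d ^ (12 : ℤ) = d ^ 12 := zpow_natCast d 12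
  rw [e4, e12]
  field_simp

lemma norm_exp_two_pi_mul (τ : ℍ) :
    ‖Complex.exp (2 * π * Complex.I * τ)‖ = Real.exp (-(2 * π * τ.im)) := by
  rw [Complex.norm_exp]
  congr 1
  simp [Complex.mul_re]

/-- The crude estimate σ_{k-1}(n) ≤ n^k ≤ (2^k)^n dominates the q-expansion by a geometric series of
ratio 2^k|q| ≤ 1/2. -/
lemma norm_E_sub_one_le {k : ℕ} (hk : 3 ≤ k) (hk2 : Even k) (τ : ℍ)
    (hτ : 2 ^ k * Real.exp (-(2 * π * τ.im)) ≤ 1 / 2) :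
    ‖ModularForm.E hk τ - 1‖ ≤
      ‖(2 * k / bernoulli k : ℂ)‖ * (2 * (2 ^ k * Real.exp (-(2 * π * τ.im)))) := by
  rw [EisensteinSeries.q_expansion_bernoulli hk hk2, sub_sub_cancel_left, norm_neg, norm_mul]
  gcongr
  set x := 2 ^ k * Real.exp (-(2 * π * τ.im)) with hx
  have hx0 : 0 < x := by positivity
  have hgs : HasSum (fun n : ℕ => x * x ^ n) (x * (1 - x)⁻¹) :=
    (hasSum_geometric_of_lt_one hx0.le (by linarith)).mul_left x
  have hgs' : HasSum (fun n : ℕ+ => x ^ (n : ℕ)) (x * (1 - x)⁻¹) := by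
    rw [← Equiv.pnatEquivNat.symm.hasSum_iff]
    refine hgs.congr_fun fun n => ?_
    simp [pow_succ, mul_comm]
  refine (tsum_of_norm_bounded hgs' fun n => ?_).trans ?_
  · rw [norm_mul, norm_zpow, norm_exp_two_pi_mul, zpow_natCast, hx, mul_pow]
    refine mul_le_mul_of_nonneg_right ?_ (by positivity)
    rw [Complex.norm_natCast]
    have h1 : ArithmeticFunction.sigma (k - 1) (n : ℕ) ≤ (n : ℕ) ^ k := by
      have := ArithmeticFunction.sigma_le_pow_succ (k - 1) (n : ℕ)
      rwa [Nat.sub_add_cancel (by omega)] at this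
    have h2 : (n : ℕ) ^ k ≤ (2 ^ k) ^ (n : ℕ) := by
      rw [← pow_mul, mul_comm, pow_mul]
      exact Nat.pow_le_pow_left (Nat.lt_two_pow_self).le k
    exact_mod_cast h1.trans h2
  · rw [mul_comm 2 x]
    refine mul_le_mul_of_nonneg_left ?_ hx0.le
    rw [inv_le_comm₀ (by linarith) (by norm_num)]
    linarith

lemma exp_neg_le_of_two_le_im {τ : ℍ} (hτ : 2 ≤ τ.im) :
    Real.exp (-(2 * π * τ.im)) ≤ 1 / 100000 := by
  have h1 : -(2 * π * τ.im) ≤ -12 := by nlinarith [Real.pi_gt_three]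
  have h2 : (100000 : ℝ) ≤ Real.exp 12 := by
    have : Real.exp 12 = Real.exp 1 ^ 12 := by rw [← Real.exp_nat_mul]; norm_num
    rw [this]
    have h3 : (2.7 : ℝ) ^ 12 ≤ Real.exp 1 ^ 12 :=
      pow_le_pow_left₀ (by norm_num) (by linarith [Real.exp_one_gt_d9]) 12
    refine le_trans (by norm_num) h3
  calc Real.exp (-(2 * π * τ.im)) ≤ Real.exp (-12) := Real.exp_le_exp.mpr h1
    _ = (Real.exp 12)⁻¹ := Real.exp_neg 12
    _ ≤ 1 / 100000 := by
      rw [one_div]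
      exact inv_anti₀ (by norm_num) h2

/-- `|j(τ)|` grows like `|q|⁻¹`. -/
lemma exp_le_norm_jFunction {τ : ℍ} (hτ : 2 ≤ τ.im) :
    Real.exp (2 * π * τ.im) / 1000 ≤ ‖jFunction τ‖ := by
  have hx := exp_neg_le_of_two_le_im hτ
  have h4 := norm_E_sub_one_le (by norm_num : 3 ≤ 4) ⟨2, rfl⟩ τ (by norm_num; linarith)
  have h6 := norm_E_sub_one_le (by norm_num : 3 ≤ 6) ⟨3, rfl⟩ τ (by norm_num; linarith)
  rw [show bernoulli 4 = -1 / 30 by decide +kernel] at h4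
  rw [show bernoulli 6 = 1 / 42 by decide +kernel] at h6
  norm_num at h4 h6
  set x := Real.exp (-(2 * π * τ.im)) with hxdef
  have hx0 : 0 < x := Real.exp_pos _
  have hxinv : Real.exp (2 * π * τ.im) = x⁻¹ := by rw [hxdef, Real.exp_neg, inv_inv]
  obtain ⟨a, ha⟩ : ∃ a, E₄ τ = 1 + a := ⟨E₄ τ - 1, by ring⟩
  obtain ⟨b, hb⟩ : ∃ b, E₆ τ = 1 + b := ⟨E₆ τ - 1, by ring⟩
  -- Here 7680 = 240·2·2⁴ and, for E₆, 64512 = 504·2·2⁶. Below, (7·7680 + 3·64512)/1728 < 200 bounds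
  -- the discriminant.
  have ha' : ‖a‖ ≤ 7680 * x := by
    have : a = E₄ τ - 1 := by rw [ha]; ring
    rw [this]; linarith
  have hb' : ‖b‖ ≤ 64512 * x := by
    have : b = E₆ τ - 1 := by rw [hb]; ring
    rw [this]; linarith
  have hΔ : ‖ModularForm.discriminant τ‖ ≤ 200 * x := by
    rw [discriminant_eq_E₄_cube_sub_E₆_sq, ha, hb]
    have e : ((1 + a) ^ 3 - (1 + b) ^ 2) / 1728 =
        (3 * a + 3 * (a * a) + a * a * a - 2 * b - b * b) / 1728 := by ring
    rw [e, norm_div]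
    have h1 : ‖3 * a + 3 * (a * a) + a * a * a - 2 * b - b * b‖ ≤
        3 * ‖a‖ + 3 * (‖a‖ * ‖a‖) + ‖a‖ * ‖a‖ * ‖a‖ + 2 * ‖b‖ + ‖b‖ * ‖b‖ := by
      refine (norm_sub_le _ _).trans (add_le_add ((norm_sub_le _ _).trans (add_le_add
        ((norm_add_le _ _).trans (add_le_add ((norm_add_le _ _).trans (add_le_add ?_ ?_)) ?_))
        ?_)) ?_) <;> simp
    have a1 : ‖a‖ ≤ 1 := by linarith
    have b1 : ‖b‖ ≤ 1 := by linarith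
    have a2 : ‖a‖ * ‖a‖ ≤ ‖a‖ := mul_le_of_le_one_right (norm_nonneg _) a1
    have a3 : ‖a‖ * ‖a‖ * ‖a‖ ≤ ‖a‖ := (mul_le_of_le_one_right (by positivity) a1).trans a2
    have b2 : ‖b‖ * ‖b‖ ≤ ‖b‖ := mul_le_of_le_one_right (norm_nonneg _) b1
    have : ‖(1728 : ℂ)‖ = 1728 := by norm_num
    rw [this, div_le_iff₀ (by norm_num)]
    linarith
  have hE : 1 / 2 ≤ ‖E₄ τ‖ ^ 3 := by
    have h1 : 9 / 10 ≤ ‖E₄ τ‖ := by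
      rw [ha]
      have := norm_sub_norm_le (1 : ℂ) (-a)
      rw [norm_neg, norm_one, sub_neg_eq_add] at this
      linarith
    calc (1 / 2 : ℝ) ≤ (9 / 10) ^ 3 := by norm_num
      _ ≤ _ := pow_le_pow_left₀ (by norm_num) h1 3
  have hΔ0 : 0 < ‖ModularForm.discriminant τ‖ :=
    norm_pos_iff.mpr (ModularForm.discriminant_ne_zero τ)
  rw [jFunction, norm_div, norm_pow, hxinv, le_div_iff₀ hΔ0]
  calc x⁻¹ / 1000 * ‖ModularForm.discriminant τ‖ ≤ x⁻¹ / 1000 * (200 * x) := by gcongr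
    _ = 1 / 5 := by field_simp; norm_num
    _ ≤ _ := by linarith

lemma differentiableOn_jFunction :
    DifferentiableOn ℂ (jFunction ∘ ofComplex) {z : ℂ | 0 < z.im} := by
  have h1 : DifferentiableOn ℂ (E₄ ∘ ofComplex) {z : ℂ | 0 < z.im} :=
    UpperHalfPlane.mdifferentiable_iff.mp E₄.holo'
  have h2 : DifferentiableOn ℂ (ModularForm.discriminant ∘ ofComplex) {z : ℂ | 0 < z.im} :=
    UpperHalfPlane.mdifferentiable_iff.mp CuspForm.discriminant.holo'
  exact (h1.pow 3).div h2 fun z _ => ModularForm.discriminant_ne_zero _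

lemma continuous_jFunction : Continuous jFunction := by
  have h1 : Continuous E₄ := E₄.holo'.continuous
  have h2 : Continuous ModularForm.discriminant := CuspForm.discriminant.holo'.continuous
  exact (h1.pow 3).div h2 ModularForm.discriminant_ne_zero

lemma exists_im_jFunction_gt (c : ℝ) : ∃ M, 2 ≤ M ∧ ∀ τ : ℍ, M < τ.im → c < ‖jFunction τ‖ := by
  refine ⟨max 2 (1000 * c), le_max_left _ _, fun τ hτ => ?_⟩
  have h2 : 2 ≤ τ.im := (le_max_left _ _).trans hτ.le
  have h3 : 1000 * c < τ.im := (le_max_right _ _).trans_lt hτ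
  refine lt_of_lt_of_le ?_ (exp_le_norm_jFunction h2)
  have h4 := Real.add_one_le_exp (2 * π * τ.im)
  have h5 : τ.im ≤ 2 * π * τ.im := by nlinarith [Real.pi_gt_three]
  rw [lt_div_iff₀ (by norm_num)]
  linarith

lemma range_jFunction : Set.range jFunction = (jFunction ∘ ofComplex) '' {z : ℂ | 0 < z.im} := by
  ext c
  constructor
  · rintro ⟨τ, rfl⟩
    exact ⟨τ, τ.im_pos, by simp [ofComplex_apply]⟩
  · rintro ⟨z, _, rfl⟩
    exact ⟨_, rfl⟩

/-- This is the open mapping theorem; j is not constant because it is unbounded as Im τ grows. -/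
lemma isOpen_range_jFunction : IsOpen (Set.range jFunction) := by
  have hopen : IsOpen {z : ℂ | 0 < z.im} := isOpen_lt continuous_const Complex.continuous_im
  have hconn : IsPreconnected {z : ℂ | 0 < z.im} :=
    (convex_halfSpace_im_gt 0).isPreconnected
  have han := differentiableOn_jFunction.analyticOnNhd hopen
  rcases han.is_constant_or_isOpen hconn with ⟨w, hw⟩ | h
  · exfalso
    obtain ⟨M, hM, h⟩ := exists_im_jFunction_gt ‖w‖
    have hpos : 0 < ((M + 1 : ℝ) * Complex.I).im := by simp; linarith
    have h1 := hw ((M + 1 : ℝ) * Complex.I) hpos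
    have h2 := h ⟨(M + 1 : ℝ) * Complex.I, hpos⟩ (by
      change M < ((M + 1 : ℝ) * Complex.I).im
      simp)
    simp only [Function.comp_apply, ofComplex_apply_of_im_pos hpos] at h1
    rw [h1] at h2
    exact lt_irrefl _ h2
  · rw [range_jFunction]
    exact h _ subset_rfl hopen

/-- By invariance, values close to c are attained in the fundamental domain. Since |j| is large high
up, they are attained in a compact truncation of it, whose image is closed. -/
lemma isClosed_range_jFunction : IsClosed (Set.range jFunction) := by
  refine isClosed_of_closure_subset fun c hc => ?_
  obtain ⟨M, hM, h⟩ := exists_im_jFunction_gt (‖c‖ + 1)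
  have hK : IsCompact (jFunction '' truncatedFundamentalDomain M) :=
    (isCompact_truncatedFundamentalDomain M).image continuous_jFunction
  have hc' : c ∈ closure (jFunction '' truncatedFundamentalDomain M) := by
    rw [Metric.mem_closure_iff] at hc ⊢
    intro ε hε
    obtain ⟨_, ⟨τ, rfl⟩, hτ⟩ := hc (min ε 1) (by positivity)
    obtain ⟨γ, hγ⟩ := exists_smul_mem_fd τ
    refine ⟨jFunction τ, ⟨γ • τ, ⟨hγ, ?_⟩, jFunction_smul γ τ⟩, hτ.trans_le (min_le_left _ _)⟩
    by_contra! hcon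
    have h1 := h _ hcon
    rw [jFunction_smul] at h1
    have h2 : dist c (jFunction τ) < 1 := hτ.trans_le (min_le_right _ _)
    rw [dist_eq_norm, norm_sub_rev] at h2
    have := norm_sub_norm_le (jFunction τ) c
    linarith
  rw [hK.isClosed.closure_eq] at hc'
  exact Set.image_subset_range _ _ hc'

lemma jFunction_surjective : Function.Surjective jFunction := by
  rw [← Set.range_eq_univ]
  exact IsClopen.eq_univ ⟨isClosed_range_jFunction, isOpen_range_jFunction⟩
    (Set.range_nonempty _)

/-- The uniformization theorem. -/
theorem exists_isUniformization (E : WeierstrassCurve ℂ) [E.IsElliptic] :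
    ∃ τ : ℍ, ∃ e : Torus τ →+ E.toAffine.Point, IsUniformization e := by
  obtain ⟨τ, hτ⟩ := jFunction_surjective E.j
  obtain ⟨C, hC⟩ := E.exists_variableChange_of_j_eq (periodPair τ).curve
    (by rw [curve_j, hτ])
  exact ⟨τ, exists_isUniformization_of_smul_eq C hC⟩

lemma isUniformization_uniformization (E : WeierstrassCurve ℂ) [E.IsElliptic] :
    IsUniformization (uniformization E).2 := by
  obtain ⟨τ, e, he⟩ := exists_isUniformization E
  exact Classical.epsilon_spec (p := fun p : Σ τ : ℍ, Torus τ →+ E.toAffine.Point =>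
    IsUniformization p.2) ⟨⟨τ, e⟩, he⟩

end EllipticDiscrepancy

end

/-! ### Every uniformization by τ has j-invariant j(τ). -/

section

namespace EllipticDiscrepancy

lemma cubic_coefficients_of_roots {p q r t₁ t₂ t₃ : ℂ} (h12 : t₁ ≠ t₂) (h13 : t₁ ≠ t₃)
    (h23 : t₂ ≠ t₃) (h1 : 4 * t₁ ^ 3 + p * t₁ ^ 2 + q * t₁ + r = 0)
    (h2 : 4 * t₂ ^ 3 + p * t₂ ^ 2 + q * t₂ + r = 0)
    (h3 : 4 * t₃ ^ 3 + p * t₃ ^ 2 + q * t₃ + r = 0) :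
    p = -4 * (t₁ + t₂ + t₃) ∧ q = 4 * (t₁ * t₂ + t₁ * t₃ + t₂ * t₃) ∧ r = -4 * (t₁ * t₂ * t₃) := by
  have e12 : 4 * (t₁ ^ 2 + t₁ * t₂ + t₂ ^ 2) + p * (t₁ + t₂) + q = 0 := by
    apply mul_left_cancel₀ (sub_ne_zero.mpr h12)
    linear_combination h1 - h2
  have e13 : 4 * (t₁ ^ 2 + t₁ * t₃ + t₃ ^ 2) + p * (t₁ + t₃) + q = 0 := by
    apply mul_left_cancel₀ (sub_ne_zero.mpr h13)
    linear_combination h1 - h3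
  have hp : p = -4 * (t₁ + t₂ + t₃) := by
    apply mul_left_cancel₀ (sub_ne_zero.mpr h23)
    linear_combination e12 - e13
  subst hp
  have hq : q = 4 * (t₁ * t₂ + t₁ * t₃ + t₂ * t₃) := by linear_combination e12
  subst hq
  exact ⟨rfl, rfl, by linear_combination h1⟩

/-- The affine map t ↦ ct + d carries the roots of 4t³ - g₂t - g₃ to those of the 2-division
polynomial of E. Translation does not affect c₄ and Δ, and c scales them by c² and c⁶, so it drops
out of c₄³/Δ. -/
lemma j_of_two_torsion (E : WeierstrassCurve ℂ) [E.IsElliptic] {g₂ g₃ e₁ e₂ e₃ c d : ℂ}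
    (hc : c ≠ 0) (h12 : e₁ ≠ e₂) (h13 : e₁ ≠ e₃) (h23 : e₂ ≠ e₃)
    (hE : ∀ t ∈ ({e₁, e₂, e₃} : Set ℂ), 4 * t ^ 3 - g₂ * t - g₃ = 0 ∧
      4 * (c * t + d) ^ 3 + E.b₂ * (c * t + d) ^ 2 + 2 * E.b₄ * (c * t + d) + E.b₆ = 0) :
    E.j = 1728 * g₂ ^ 3 / (g₂ ^ 3 - 27 * g₃ ^ 2) := by
  obtain ⟨h1, k1⟩ := hE e₁ (by simp)
  obtain ⟨h2, k2⟩ := hE e₂ (by simp)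
  obtain ⟨h3, k3⟩ := hE e₃ (by simp)
  obtain ⟨hs, hg2, hg3⟩ := cubic_coefficients_of_roots (p := 0) (q := -g₂) (r := -g₃) h12 h13 h23
    (by linear_combination h1) (by linear_combination h2) (by linear_combination h3)
  have hinj : ∀ {a b : ℂ}, a ≠ b → c * a + d ≠ c * b + d := fun hab h =>
    hab (mul_left_cancel₀ hc (add_right_cancel h))
  obtain ⟨hb2, hb4, hb6⟩ := cubic_coefficients_of_roots (hinj h12) (hinj h13) (hinj h23) k1 k2 k3
  have he : e₃ = -e₁ - e₂ := by linear_combination (1 / 4) * hs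
  have hb8 := E.b_relation
  have hg2' : g₂ = 4 * (e₁ ^ 2 + e₁ * e₂ + e₂ ^ 2) := by rw [he] at hg2; linear_combination -hg2
  have hg3' : g₃ = -4 * (e₁ * e₂ * (e₁ + e₂)) := by rw [he] at hg3; linear_combination -hg3
  have hb4' : E.b₄ = 2 * ((c * e₁ + d) * (c * e₂ + d) + (c * e₁ + d) * (c * e₃ + d)
    + (c * e₂ + d) * (c * e₃ + d)) := by linear_combination hb4 / 2
  have hb8' : E.b₈ = (E.b₂ * E.b₆ - E.b₄ ^ 2) / 4 := by linear_combination hb8 / 4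
  have hc4 : E.c₄ = 12 * c ^ 2 * g₂ := by
    rw [WeierstrassCurve.c₄, hb2, hb4', hg2', he]; ring
  have hΔ : E.Δ = c ^ 6 * (g₂ ^ 3 - 27 * g₃ ^ 2) := by
    rw [WeierstrassCurve.Δ, hb8', hb2, hb4', hb6, hg2', hg3', he]; ring
  have hΔ0 : E.Δ ≠ 0 := E.isUnit_Δ.ne_zero
  rw [hΔ] at hΔ0
  have hD := right_ne_zero_of_mul hΔ0
  rw [j_eq_div, hc4, hΔ]
  field_simp
  ring

variable {E : WeierstrassCurve ℂ} {τ : ℍ} {X Y : ℂ → ℂ}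

/-- A function on the plane which separates points modulo `±1` and the lattice, is holomorphic
off the lattice and meromorphic, is an affine function of `℘`. -/
lemma exists_eq_weierstrassP (L : PeriodPair) {X : ℂ → ℂ} (hX : Meromorphic X)
    (hXd : ∀ z ∉ L.lattice, AnalyticAt ℂ X z)
    (hXe : ∀ z w, z ∉ L.lattice → w ∉ L.lattice →
      (X z = X w ↔ z + w ∈ L.lattice ∨ z - w ∈ L.lattice)) :
    ∃ c d : ℂ, c ≠ 0 ∧ ∀ z ∉ L.lattice, X z = c * L.weierstrassP z + d := by
  have hfreq : ∃ᶠ w in 𝓝[≠] (0 : ℂ), deriv X w ≠ 0 := by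
    intro hcon
    simp only [ne_eq, not_not] at hcon
    obtain ⟨ε, hε, hball⟩ := Metric.mem_nhdsWithin_iff.mp
      (hcon.and (L.eventually_notMem_lattice 0))
    have hsub : ∀ z ∈ Metric.ball ((ε / 2 : ℝ) : ℂ) (ε / 4), z ∈ Metric.ball (0 : ℂ) ε ∩ {0}ᶜ := by
      intro z hz
      rw [Metric.mem_ball, dist_eq_norm] at hz
      have hn : ‖((ε / 2 : ℝ) : ℂ)‖ = ε / 2 := by
        rw [Complex.norm_real, Real.norm_of_nonneg (by linarith)]
      have h1 := norm_sub_norm_le z ((ε / 2 : ℝ) : ℂ)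
      have h2 := norm_sub_norm_le ((ε / 2 : ℝ) : ℂ) z
      rw [norm_sub_rev] at h2
      rw [hn] at h1 h2
      refine ⟨by simp; linarith, ?_⟩
      simp only [Set.mem_compl_iff, Set.mem_singleton_iff]
      rintro rfl
      rw [zero_sub, norm_neg, hn] at hz
      linarith
    have hne : ∀ a : ℝ, 0 < a → a < ε → ((a : ℝ) : ℂ) ∉ L.lattice := by
      intro a ha ha'
      refine (hball ⟨?_, ?_⟩).2
      · simp [abs_of_pos ha, ha']
      · simpa using ha.ne'
    -- If X' vanished near 0, X would agree at 3ε/8 and 7ε/16. Their sum 13ε/16 and difference ε/16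
    -- lie in (0, ε), hence are not periods, against the separation hypothesis.
    have hc3 := Metric.isOpen_ball.is_const_of_deriv_eq_zero
      (f := X) (s := Metric.ball ((ε / 2 : ℝ) : ℂ) (ε / 4))
      (convex_ball _ _).isPreconnected
      (fun z hz => (hXd z (hball (hsub z hz)).2).differentiableAt.differentiableWithinAt)
      (fun z hz => (hball (hsub z hz)).1)
      (x := ((ε * 3 / 8 : ℝ) : ℂ)) (y := ((ε * 7 / 16 : ℝ) : ℂ)) (by
      rw [Metric.mem_ball, dist_eq_norm, ← Complex.ofReal_sub, Complex.norm_real, Real.norm_eq_abs,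
        abs_lt]
      constructor <;> linarith) (by
      rw [Metric.mem_ball, dist_eq_norm, ← Complex.ofReal_sub, Complex.norm_real, Real.norm_eq_abs,
        abs_lt]
      constructor <;> linarith)
    rcases (hXe _ _ (hne _ (by linarith) (by linarith)) (hne _ (by linarith) (by linarith))).mp hc3
      with h | h
    · rw [← Complex.ofReal_add] at h
      exact hne _ (by linarith) (by linarith) h
    · rw [← neg_mem_iff, neg_sub, ← Complex.ofReal_sub] at h
      exact hne _ (by linarith) (by linarith) h
  have t1 : ∀ᶠ v in 𝓝[≠] (0 : ℂ), v + v ∉ L.lattice := by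
    have : Tendsto (fun v : ℂ => v + v) (𝓝[≠] 0) (𝓝[≠] 0) := by
      refine tendsto_nhdsWithin_iff.mpr ⟨?_, ?_⟩
      · have : Tendsto (fun v : ℂ => v + v) (𝓝 0) (𝓝 (0 + 0)) :=
          Continuous.tendsto (by fun_prop) _
        rw [add_zero] at this
        exact this.mono_left nhdsWithin_le_nhds
      · filter_upwards [self_mem_nhdsWithin] with w hw
        simpa using hw
    exact this.eventually (L.eventually_notMem_lattice 0)
  obtain ⟨w, hdw, hw, h2w⟩ :=
    (hfreq.and_eventually ((L.eventually_notMem_lattice 0).and t1)).exists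
  have hw' : -w ∉ L.lattice := by simpa using hw
  have hXneg : ∀ z ∉ L.lattice, X (-z) = X z := fun z hz =>
    (hXe _ _ (by simpa using hz) hz).mpr (Or.inl (by simp))
  have hdw' : deriv X (-w) ≠ 0 := by
    have h1 : X =ᶠ[𝓝 (-w)] fun z => X (-z) := by
      filter_upwards [L.eventually_notMem_lattice_of_notMem hw'] with z hz
      exact (hXneg z hz).symm
    rw [h1.deriv_eq, deriv_comp_neg, neg_neg]
    simpa using hdw
  have hPw : L.derivWeierstrassP w ≠ 0 := L.derivWeierstrassP_ne_zero hw h2w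
  have hPw' : L.derivWeierstrassP (-w) ≠ 0 := by
    rw [L.derivWeierstrassP_neg]; simpa using hPw
  set α : ℂ → ℂ := fun z => X z - X w
  set β : ℂ → ℂ := fun z => L.weierstrassP z - L.weierstrassP w
  have hα : ∀ z ∉ L.lattice, AnalyticAt ℂ α z := fun z hz => (hXd z hz).sub analyticAt_const
  have hβ : ∀ z ∉ L.lattice, AnalyticAt ℂ β z := fun z hz =>
    (L.analyticAt_weierstrassP hz).sub analyticAt_const
  classical
  -- Off the lattice, numerator and denominator vanish only at the classes of ±w, simply at both by
  -- the choice of w, so the quotient has neither zeros nor poles there. The value 0 on the lattice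
  -- is harmless: only punctured neighbourhoods matter.
  set F : ℂ → ℂ := fun z => if z ∈ L.lattice then 0 else α z / β z with hF
  have hFeq : ∀ z, F =ᶠ[𝓝[≠] z] α / β := fun z => by
    filter_upwards [L.eventually_notMem_lattice z] with v hv
    simp [hF, hv]
  have hαm : Meromorphic α := fun z => (hX z).sub analyticAt_const.meromorphicAt
  have hβm : Meromorphic β := fun z =>
    (L.meromorphic_weierstrassP z).sub analyticAt_const.meromorphicAt
  have hFm : ∀ z, MeromorphicAt F z := fun z => ((hαm z).div (hβm z)).congr (hFeq z).symm
  have hper : ∀ z, ∀ l ∈ L.lattice, F (z + l) = F z := by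
    intro z l hl
    by_cases hz : z ∈ L.lattice
    · simp [hF, hz, add_mem hz hl]
    · have hzl : z + l ∉ L.lattice := fun h => hz (by simpa using sub_mem h hl)
      have e1 : X (z + l) = X z := (hXe _ _ hzl hz).mpr (Or.inr (by simpa using hl))
      have e2 : L.weierstrassP (z + l) = L.weierstrassP z := L.weierstrassP_add_coe z ⟨l, hl⟩
      simp [hF, hz, hzl, α, β, e1, e2]
  have hord1 : ∀ z ∉ L.lattice, X z = X w → L.weierstrassP z = L.weierstrassP w →
      deriv X z ≠ 0 → L.derivWeierstrassP z ≠ 0 → meromorphicOrderAt F z = 0 := by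
    intro z hz e1 e2 d1 d2
    rw [meromorphicOrderAt_congr (hFeq z), meromorphicOrderAt_div (hαm z) (hβm z),
      (hα z hz).meromorphicOrderAt_eq, (hβ z hz).meromorphicOrderAt_eq]
    have o1 : analyticOrderAt α z = 1 := by
      have := (hXd z hz).analyticOrderAt_sub_eq_one_of_deriv_ne_zero d1
      rwa [e1] at this
    have o2 : analyticOrderAt β z = 1 := by
      rw [← L.deriv_weierstrassP] at d2
      have := (L.analyticAt_weierstrassP hz).analyticOrderAt_sub_eq_one_of_deriv_ne_zero d2
      rwa [e2] at this
    rw [o1, o2]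
    rfl
  have hordw : meromorphicOrderAt F w = 0 := hord1 w hw rfl rfl hdw hPw
  have hordw' : meromorphicOrderAt F (-w) = 0 :=
    hord1 (-w) hw' (hXneg w hw) (L.weierstrassP_neg w) hdw' hPw'
  have hdef : ∀ z ∉ L.lattice, ¬(z + w ∈ L.lattice ∨ z - w ∈ L.lattice) →
      AnalyticAt ℂ F z ∧ F z ≠ 0 := by
    intro z hz hzw
    have e1 : α z ≠ 0 := sub_ne_zero.mpr (mt (hXe z w hz hw).mp hzw)
    have e2 : β z ≠ 0 := sub_ne_zero.mpr (mt (L.weierstrassP_eq_iff hw hz).mp hzw)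
    refine ⟨((hα z hz).div (hβ z hz) e2).congr ?_, by simp [hF, hz, e1, e2]⟩
    filter_upwards [L.eventually_notMem_lattice_of_notMem hz] with v hv
    simp [hF, hv]
  have main : ∀ F' : ℂ → ℂ, (∀ z, MeromorphicAt F' z) →
      (∀ z, ∀ l ∈ L.lattice, F' (z + l) = F' z) → 0 ≤ meromorphicOrderAt F' 0 →
      meromorphicOrderAt F' w = 0 → meromorphicOrderAt F' (-w) = 0 →
      (∀ z ∉ L.lattice, ¬(z + w ∈ L.lattice ∨ z - w ∈ L.lattice) → AnalyticAt ℂ F' z) →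
      ∃ c ≠ 0, ∀ z ∉ L.lattice, ¬(z + w ∈ L.lattice ∨ z - w ∈ L.lattice) → F' z = c := by
    intro F' hm hp h0 h1 h2 ha
    obtain ⟨c, hc⟩ := L.exists_tendsto_of_elliptic hp (by
      intro z
      by_cases hz : z ∈ L.lattice
      · simpa using L.exists_analytic_of_add hp hz ((hm 0).meromorphicOrderAt_nonneg_iff.mp h0)
      by_cases hzw : z + w ∈ L.lattice
      · have := L.exists_analytic_of_add hp hzw
          ((hm (-w)).meromorphicOrderAt_nonneg_iff.mp h2.ge)
        simpa [add_comm z w] using this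
      by_cases hzw' : z - w ∈ L.lattice
      · have := L.exists_analytic_of_add hp hzw'
          ((hm w).meromorphicOrderAt_nonneg_iff.mp h1.ge)
        simpa using this
      · exact ⟨F', ha z hz (by tauto), .rfl⟩)
    refine ⟨c, ?_, fun z hz hzw => ?_⟩
    · obtain ⟨c', hc', ht⟩ := tendsto_ne_zero_of_meromorphicOrderAt_eq_zero (hm w) h1
      rwa [tendsto_nhds_unique (hc w) ht]
    · exact tendsto_nhds_unique ((ha z hz hzw).continuousAt.tendsto.mono_left
        (nhdsWithin_le_nhds (s := {z}ᶜ))) (hc z)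
  have hFc : ∃ c ≠ 0, ∀ z ∉ L.lattice, ¬(z + w ∈ L.lattice ∨ z - w ∈ L.lattice) → F z = c := by
    -- The order of X at 0 is not known. But F or 1/F has no pole at 0, and since F has order 0 at
    -- ±w and no zeros or poles at other points off the lattice, the Liouville argument applies to
    -- one of them.
    rcases le_total 0 (meromorphicOrderAt F 0) with h0 | h0
    · exact main F hFm hper h0 hordw hordw' fun z hz hzw => (hdef z hz hzw).1
    · obtain ⟨c, hc, h⟩ := main F⁻¹ (fun z => (hFm z).inv)
        (fun z l hl => by simp [hper z l hl])
        (by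
          rw [meromorphicOrderAt_inv]
          cases ho : meromorphicOrderAt F 0 with
          | top => simp [ho] at h0
          | coe n =>
            rw [ho] at h0
            have : n ≤ 0 := by exact_mod_cast h0
            have h3 : (0 : ℤ) ≤ -n := by omega
            exact_mod_cast h3)
        (by rw [meromorphicOrderAt_inv, hordw]; rfl)
        (by rw [meromorphicOrderAt_inv, hordw']; rfl)
        (fun z hz hzw => (hdef z hz hzw).1.inv (hdef z hz hzw).2)
      refine ⟨c⁻¹, inv_ne_zero hc, fun z hz hzw => ?_⟩
      rw [← h z hz hzw, Pi.inv_apply, inv_inv]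
  obtain ⟨c, hc, h⟩ := hFc
  refine ⟨c, X w - c * L.weierstrassP w, hc, fun z hz => ?_⟩
  by_cases hzw : z + w ∈ L.lattice ∨ z - w ∈ L.lattice
  · rw [(hXe z w hz hw).mpr hzw, (L.weierstrassP_eq_iff hw hz).mpr hzw]; ring
  · have h1 := h z hz hzw
    have e2 : β z ≠ 0 := sub_ne_zero.mpr (mt (L.weierstrassP_eq_iff hw hz).mp hzw)
    simp only [hF, hz, if_false] at h1
    rw [div_eq_iff e2] at h1
    simp only [α, β] at h1
    linear_combination h1

/-- Points of E with equal x agree up to sign and e is injective, so X separates points exactly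
modulo ±1 and the lattice; thus X = c℘ + d with c ≠ 0. The three nonzero half periods map to
2-torsion, so their ℘-values are roots of one cubic and their X-values roots of the other. -/
theorem j_eq_jFunction [E.IsElliptic] {e : Torus τ →+ E.toAffine.Point}
    (he : IsUniformization e) : E.j = jFunction τ := by
  obtain ⟨X, Y, hX, -, hXd, -, hXY⟩ := he.holomorphic
  set L := periodPair τ with hL
  have hmem : ∀ z, z ∈ L.lattice ↔ z ∈ lattice τ := fun z => mem_periodPair_lattice
  have hmk : ∀ z w : ℂ, (z : Torus τ) = (w : Torus τ) ↔ z - w ∈ L.lattice := fun z w => by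
    rw [hmem, QuotientAddGroup.eq, ← neg_mem_iff]
    simp [neg_add_eq_sub]
  have hopen : IsOpen (lattice τ : Set ℂ)ᶜ := by
    have := L.isClosed_lattice.isOpen_compl
    convert this using 2
    ext z; exact (hmem z).symm
  obtain ⟨c, d, hc, hcd⟩ := exists_eq_weierstrassP L hX
    (fun z hz => hXd.analyticAt (hopen.mem_nhds (by rwa [hmem] at hz)))
    (by
      intro z w hz hw
      rw [hmem] at hz hw
      obtain ⟨hnz, hez⟩ := hXY z hz
      obtain ⟨hnw, hew⟩ := hXY w hw
      rw [WeierstrassCurve.Affine.Point.X_eq_iff (h₁ := hnz) (h₂ := hnw), ← hez, ← hew,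
        ← map_neg, he.bijective.injective.eq_iff, he.bijective.injective.eq_iff,
        ← QuotientAddGroup.mk_neg, hmk, hmk, sub_neg_eq_add, or_comm])
  have h2tors : ∀ w ∉ L.lattice, w + w ∈ L.lattice →
      4 * L.weierstrassP w ^ 3 - L.g₂ * L.weierstrassP w - L.g₃ = 0 ∧
      4 * (c * L.weierstrassP w + d) ^ 3 + E.b₂ * (c * L.weierstrassP w + d) ^ 2
        + 2 * E.b₄ * (c * L.weierstrassP w + d) + E.b₆ = 0 := by
    intro w hw h2w
    constructor
    · rw [← L.derivWeierstrassP_sq w hw]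
      have h1 := L.derivWeierstrassP_add_coe (-w) ⟨_, h2w⟩
      rw [L.derivWeierstrassP_neg] at h1
      simp only [neg_add_cancel_left] at h1
      have : L.derivWeierstrassP w = 0 := by linear_combination h1 / 2
      rw [this]; ring
    · rw [← hcd w hw]
      obtain ⟨hn, hew⟩ := hXY w (by rwa [hmem] at hw)
      have h0 : e (w : Torus τ) = -e (w : Torus τ) := by
        rw [← map_neg, ← QuotientAddGroup.mk_neg, (hmk w (-w)).mpr (by simpa using h2w)]
      rw [hew, WeierstrassCurve.Affine.Point.neg_some,
        WeierstrassCurve.Affine.Point.some.injEq] at h0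
      have hy : Y w = -Y w - E.a₁ * X w - E.a₃ := h0.2
      have heq := (WeierstrassCurve.Affine.equation_iff _ _).mp hn.1
      change Y w ^ 2 + E.a₁ * X w * Y w + E.a₃ * Y w =
        X w ^ 3 + E.a₂ * X w ^ 2 + E.a₄ * X w + E.a₆ at heq
      simp only [WeierstrassCurve.b₂, WeierstrassCurve.b₄, WeierstrassCurve.b₆]
      linear_combination (-4) * heq + (2 * Y w + E.a₁ * X w + E.a₃) * hy
  have n1 := L.ω₁_div_two_notMem_lattice
  have n2 := L.ω₂_div_two_notMem_lattice
  have n12 : L.ω₁ / 2 + L.ω₂ / 2 ∉ L.lattice := by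
    have := (L.mul_ω₁_add_mul_ω₂_mem_lattice (α := 1 / 2) (β := 1 / 2)).not.mpr (by norm_num)
    convert this using 2
    push_cast; ring
  have n12' : L.ω₁ / 2 - L.ω₂ / 2 ∉ L.lattice := fun h => n12 (by
    have := add_mem h L.ω₂_mem_lattice
    convert this using 1; ring)
  have d1 : L.ω₁ / 2 + L.ω₁ / 2 ∈ L.lattice := by
    have := L.ω₁_mem_lattice; convert this using 1; ring
  have d2 : L.ω₂ / 2 + L.ω₂ / 2 ∈ L.lattice := by
    have := L.ω₂_mem_lattice; convert this using 1; ring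
  have d12 : L.ω₁ / 2 + L.ω₂ / 2 + (L.ω₁ / 2 + L.ω₂ / 2) ∈ L.lattice := by
    have := add_mem d1 d2; convert this using 1; ring
  rw [jFunction_eq]
  refine j_of_two_torsion E (e₁ := L.weierstrassP (L.ω₁ / 2)) (e₂ := L.weierstrassP (L.ω₂ / 2))
    (e₃ := L.weierstrassP (L.ω₁ / 2 + L.ω₂ / 2)) (d := d) hc ?_ ?_ ?_ ?_
  · rw [Ne, L.weierstrassP_eq_iff n2 n1]; tauto
  · rw [Ne, L.weierstrassP_eq_iff n12 n1, not_or]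
    constructor
    · intro h
      exact n2 (by have := sub_mem h d1; convert this using 1; ring)
    · intro h
      rw [← neg_mem_iff] at h
      exact n2 (by convert h using 1; ring)
  · rw [Ne, L.weierstrassP_eq_iff n12 n2, not_or]
    constructor
    · intro h
      exact n1 (by have := sub_mem h d2; convert this using 1; ring)
    · intro h
      rw [← neg_mem_iff] at h
      exact n1 (by convert h using 1; ring)
  · rintro t (rfl | rfl | rfl)
    · exact h2tors _ n1 d1
    · exact h2tors _ n2 d2
    · exact h2tors _ n12 d12

end EllipticDiscrepancy

end

/-! ### One-variable Fourier series with the coefficients Im τ/(2π|mτ - n|²). -/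

section

namespace EllipticDiscrepancy

/-- The exponential `exp (2πiz)`. -/
def expTwoPi (z : ℂ) : ℂ := Complex.exp (2 * π * Complex.I * z)

lemma expTwoPi_add (z w : ℂ) : expTwoPi (z + w) = expTwoPi z * expTwoPi w := by
  rw [expTwoPi, mul_add, Complex.exp_add]; rfl

@[simp]
lemma expTwoPi_zero : expTwoPi 0 = 1 := by simp [expTwoPi]

lemma expTwoPi_neg (z : ℂ) : expTwoPi (-z) = (expTwoPi z)⁻¹ := by
  rw [expTwoPi, mul_neg, Complex.exp_neg]; rfl

lemma expTwoPi_ne_zero (z : ℂ) : expTwoPi z ≠ 0 := Complex.exp_ne_zero _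

lemma expTwoPi_intCast (n : ℤ) : expTwoPi n = 1 := by
  rw [expTwoPi, Complex.exp_eq_one_iff]
  exact ⟨n, by ring⟩

lemma expTwoPi_natCast_mul (n : ℕ) (z : ℂ) : expTwoPi (n * z) = expTwoPi z ^ n := by
  rw [expTwoPi, expTwoPi, ← Complex.exp_nat_mul]
  ring_nf

lemma expTwoPi_eq_one_iff {z : ℂ} : expTwoPi z = 1 ↔ ∃ n : ℤ, z = n := by
  rw [expTwoPi, Complex.exp_eq_one_iff]
  refine exists_congr fun n => ⟨fun h => ?_, fun h => by rw [h]; ring⟩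
  apply mul_left_cancel₀ Complex.two_pi_I_ne_zero
  rw [h]; ring

lemma norm_expTwoPi (z : ℂ) : ‖expTwoPi z‖ = Real.exp (-2 * π * z.im) := by
  rw [expTwoPi, Complex.norm_exp]
  congr 1
  simp

lemma norm_expTwoPi_int_mul_ofReal (n : ℤ) (x : ℝ) : ‖expTwoPi (n * x)‖ = 1 := by
  simp [norm_expTwoPi]

lemma conj_expTwoPi (z : ℂ) :
    (starRingEnd ℂ) (expTwoPi z) = expTwoPi (-(starRingEnd ℂ) z) := by
  rw [expTwoPi, ← Complex.exp_conj, expTwoPi]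
  congr 1
  simp [Complex.conj_ofNat]

@[fun_prop]
lemma continuous_expTwoPi : Continuous expTwoPi := by unfold expTwoPi; fun_prop

lemma fourier_eq_expTwoPi (n : ℤ) (x : ℝ) : fourier n (x : UnitAddCircle) = expTwoPi (n * x) := by
  rw [fourier_coe_apply, expTwoPi]
  congr 1
  push_cast
  ring

lemma integral_expTwoPi {ζ : ℂ} (hζ : ζ ≠ 0) :
    ∫ x in (0 : ℝ)..1, expTwoPi (ζ * x) = (expTwoPi ζ - 1) / (2 * π * Complex.I * ζ) := by
  have := integral_exp_mul_complex (a := 0) (b := 1) (c := 2 * π * Complex.I * ζ)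
    (mul_ne_zero Complex.two_pi_I_ne_zero hζ)
  simp only [Complex.ofReal_one, mul_one, Complex.ofReal_zero, mul_zero, Complex.exp_zero] at this
  rw [expTwoPi, ← this]
  congr 1 with x
  rw [expTwoPi]
  ring_nf

/-- Pointwise convergence of an absolutely convergent Fourier series on the unit interval. -/
lemma hasSum_fourier_unitInterval {f : ℝ → ℂ} {c : ℤ → ℂ} (hf : Continuous f) (h01 : f 0 = f 1)
    (hc : ∀ n : ℤ, ∫ x in (0 : ℝ)..1, expTwoPi (-n * x) * f x = c n) (hs : Summable c)
    {x : ℝ} (hx : x ∈ Set.Icc (0 : ℝ) 1) : HasSum (fun n : ℤ => c n * expTwoPi (n * x)) (f x) := by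
  suffices ∀ {y : ℝ}, y ∈ Set.Ico (0 : ℝ) 1 →
      HasSum (fun n : ℤ => c n * expTwoPi (n * y)) (f y) by
    rw [← Set.Ico_insert_right (zero_le_one' ℝ), Set.mem_insert_iff, or_comm] at hx
    rcases hx with (hx | rfl)
    · exact this hx
    · have h0 := this (Set.left_mem_Ico.mpr zero_lt_one)
      rw [h01] at h0
      simpa [expTwoPi_intCast] using h0
  intro y hy
  let B : C(UnitAddCircle, ℂ) := ContinuousMap.mk (AddCircle.liftIco 1 0 f)
    (AddCircle.liftIco_zero_continuous h01 hf.continuousOn)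
  have step1 : ∀ n : ℤ, fourierCoeff B n = c n := by
    intro n
    change fourierCoeff (AddCircle.liftIco 1 0 f) n = c n
    rw [fourierCoeff_liftIco_eq, fourierCoeffOn_eq_integral, ← hc n]
    simp only [zero_add, sub_zero, ne_eq, one_ne_zero, not_false_eq_true, div_self, one_smul,
      smul_eq_mul]
    refine intervalIntegral.integral_congr fun x _ => ?_
    rw [fourier_coe_apply, expTwoPi]
    congr 2
    push_cast
    ring
  have step2 := has_pointwise_sum_fourier_series_of_summable (f := B)
    (hs.congr fun n => (step1 n).symm) y
  simp_rw [step1, fourier_eq_expTwoPi] at step2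
  convert! step2 using 1
  change f y = AddCircle.liftIco 1 0 f y
  rw [AddCircle.liftIco_coe_apply]
  simpa using hy

/-- The Fourier coefficient of the Néron function at the character
`r₁ + r₂τ ↦ exp (2πi (m r₁ + n r₂))`; it is `0` for the trivial character. -/
def greenCoeff (τ : ℍ) (m n : ℤ) : ℝ := τ.im / (2 * π * ‖(m * τ - n : ℂ)‖ ^ 2)

lemma greenCoeff_zero (τ : ℍ) : greenCoeff τ 0 0 = 0 := by simp [greenCoeff]

lemma greenCoeff_neg (τ : ℍ) (m n : ℤ) : greenCoeff τ (-m) (-n) = greenCoeff τ m n := by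
  rw [greenCoeff, greenCoeff, ← norm_neg]
  congr 4
  push_cast; ring

lemma greenCoeff_nonneg (τ : ℍ) (m n : ℤ) : 0 ≤ greenCoeff τ m n := by
  have := τ.im_pos.le
  unfold greenCoeff
  positivity

lemma int_mul_sub_int_ne_zero (τ : ℍ) {m n : ℤ} (h : m ≠ 0 ∨ n ≠ 0) : (m * τ - n : ℂ) ≠ 0 := by
  intro h0
  have him := congrArg Complex.im h0
  simp only [Complex.sub_im, Complex.mul_im, Complex.intCast_re, Complex.intCast_im, zero_mul,
    add_zero, sub_zero, Complex.zero_im, mul_eq_zero, Int.cast_eq_zero] at him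
  have hm : m = 0 := him.resolve_right τ.im_pos.ne'
  subst hm
  simp at h0
  tauto

lemma greenCoeff_pos (τ : ℍ) {m n : ℤ} (h : m ≠ 0 ∨ n ≠ 0) : 0 < greenCoeff τ m n := by
  have h1 := τ.im_pos
  have h2 := norm_pos_iff.mpr (int_mul_sub_int_ne_zero τ h)
  unfold greenCoeff
  positivity

lemma summable_greenCoeff (τ : ℍ) (m : ℤ) : Summable (greenCoeff τ m) := by
  have h := (EisensteinSeries.linear_right_summable (τ : ℂ) m (k := 2) le_rfl).norm
  have h2 := ((Equiv.neg ℤ).summable_iff.mpr h).mul_left (τ.im / (2 * π))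
  refine h2.congr fun n => ?_
  simp only [Function.comp_apply, Equiv.neg_apply, greenCoeff, Int.cast_neg]
  rw [norm_inv, norm_zpow, ← sub_eq_add_neg, ← div_eq_mul_inv, div_div]
  rfl

/-- The Fourier coefficient, in the variable `r₁`, of the Néron function at `r₁ + r₂τ`. -/
def layer (τ : ℍ) (m : ℤ) (s : ℝ) : ℂ := ∑' n : ℤ, (greenCoeff τ m n : ℂ) * expTwoPi (n * s)

lemma summable_layer (τ : ℍ) (m : ℤ) (s : ℝ) :
    Summable fun n : ℤ => (greenCoeff τ m n : ℂ) * expTwoPi (n * s) := by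
  refine Summable.of_norm ((summable_greenCoeff τ m).congr fun n => ?_)
  rw [norm_mul, norm_expTwoPi_int_mul_ofReal, mul_one, Complex.norm_real,
    Real.norm_of_nonneg (greenCoeff_nonneg τ m n)]

lemma layer_neg (τ : ℍ) (m : ℤ) (s : ℝ) : layer τ (-m) s = (starRingEnd ℂ) (layer τ m s) := by
  rw [layer, layer, Complex.conj_tsum, ← (Equiv.neg ℤ).tsum_eq]
  congr 1 with n
  simp only [Equiv.neg_apply, greenCoeff_neg, map_mul, Complex.conj_ofReal, conj_expTwoPi]
  congr 2
  simp

/-- The row m = 0 is, up to a factor, the classical Fourier series of the second Bernoulli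
polynomial. -/
lemma hasSum_layer_zero (τ : ℍ) {s : ℝ} (hs : s ∈ Set.Icc (0 : ℝ) 1) :
    HasSum (fun n : ℤ => (greenCoeff τ 0 n : ℂ) * expTwoPi (n * s))
      (π * τ.im * bernoulliTwo s : ℝ) := by
  have h := (hasSum_one_div_pow_mul_fourier_mul_bernoulliFun le_rfl hs).mul_left
    ((τ.im / (2 * π) : ℝ) : ℂ)
  have hπ : (π : ℂ) ≠ 0 := by exact_mod_cast Real.pi_ne_zero
  convert! h using 1
  · ext n
    rw [fourier_eq_expTwoPi, greenCoeff]
    have : ‖((0 : ℤ) * (τ : ℂ) - n : ℂ)‖ ^ 2 = (n : ℝ) ^ 2 := by simp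
    rw [this]
    push_cast
    by_cases hn : n = 0
    · simp [hn]
    have : (n : ℂ) ≠ 0 := by exact_mod_cast hn
    field_simp
  · rw [bernoulliFun_two, bernoulliTwo]
    push_cast
    have hI : Complex.I ^ 2 = -1 := Complex.I_sq
    rw [mul_pow, hI]
    norm_num [Nat.factorial]
    field_simp

/-- The closed form of `layer` for a positive index. -/
def layerClosed (τ : ℍ) (k : ℕ) (s : ℝ) : ℂ :=
  1 / (2 * k) * (expTwoPi (k * τ * s) / (1 - expTwoPi (k * τ)) +
    (starRingEnd ℂ) (expTwoPi (k * τ * (1 - s)) / (1 - expTwoPi (k * τ))))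

lemma norm_expTwoPi_natCast_mul_lt_one (τ : ℍ) {k : ℕ} (hk : k ≠ 0) :
    ‖expTwoPi (k * τ)‖ < 1 := by
  rw [expTwoPi_natCast_mul, norm_pow]
  refine pow_lt_one₀ (norm_nonneg _) ?_ hk
  rw [norm_expTwoPi, Real.exp_lt_one_iff]
  have := τ.im_pos
  have := Real.pi_pos
  simp only [coe_im]
  nlinarith [mul_pos ‹0 < τ.im› ‹0 < π›]

lemma one_sub_expTwoPi_natCast_mul_ne_zero (τ : ℍ) {k : ℕ} (hk : k ≠ 0) :
    1 - expTwoPi (k * τ) ≠ 0 := by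
  intro h
  have := norm_expTwoPi_natCast_mul_lt_one τ hk
  rw [← sub_eq_zero.mp h] at this
  simp at this

/-- The closed form combines the exponentials e(kτs) and e(kτ̄s), weighted to agree at s = 0 and s =
1. Its n-th coefficient is a difference of 1/(kτ̄ - n) and 1/(kτ - n) over 4πik, that is Im τ/(2π|kτ
- n|²). -/
lemma hasSum_layerClosed (τ : ℍ) {k : ℕ} (hk : k ≠ 0) {s : ℝ} (hs : s ∈ Set.Icc (0 : ℝ) 1) :
    HasSum (fun n : ℤ => (greenCoeff τ k n : ℂ) * expTwoPi (n * s)) (layerClosed τ k s) := by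
  have hd := one_sub_expTwoPi_natCast_mul_ne_zero τ hk
  have hd' : 1 - expTwoPi (-(k * (starRingEnd ℂ) τ)) ≠ 0 := by
    have := (map_ne_zero (starRingEnd ℂ)).mpr hd
    simpa [conj_expTwoPi] using this
  have hform : ∀ s : ℝ, layerClosed τ k s = 1 / (2 * k) * (expTwoPi (k * τ * s) /
      (1 - expTwoPi (k * τ)) + expTwoPi (-(k * (starRingEnd ℂ) τ)) *
        expTwoPi (k * (starRingEnd ℂ) τ * s) / (1 - expTwoPi (-(k * (starRingEnd ℂ) τ)))) := by
    intro s
    rw [layerClosed, map_div₀, conj_expTwoPi, map_sub, conj_expTwoPi, ← expTwoPi_add]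
    simp only [map_mul, map_one, map_natCast, map_sub, Complex.conj_ofReal]
    congr 5
    ring
  have hk0 : (k : ℂ) ≠ 0 := by exact_mod_cast hk
  refine hasSum_fourier_unitInterval (f := layerClosed τ k) ?_ ?_ ?_ ?_ hs
  · rw [show layerClosed τ k = _ from funext hform]
    fun_prop
  · rw [hform, hform, expTwoPi_neg]
    have := expTwoPi_ne_zero (k * (starRingEnd ℂ) τ)
    rw [expTwoPi_neg] at hd'
    simp only [Complex.ofReal_zero, mul_zero, expTwoPi_zero, Complex.ofReal_one, mul_one]
    rw [inv_mul_cancel₀ this]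
    field_simp
    have hd'' : expTwoPi (k * (starRingEnd ℂ) τ) - 1 ≠ 0 := by
      intro h
      rw [sub_eq_zero] at h
      simp [h] at hd'
    field_simp
    ring
  · intro n
    have hζ1 : (k * τ - n : ℂ) ≠ 0 := by
      have := int_mul_sub_int_ne_zero τ (m := k) (n := n) (Or.inl (by exact_mod_cast hk))
      simpa using this
    have hζ2 : (k * (starRingEnd ℂ) τ - n : ℂ) ≠ 0 := by
      have := (map_ne_zero (starRingEnd ℂ)).mpr hζ1
      simpa using this
    have hint : ∀ x : ℝ, expTwoPi (-n * x) * layerClosed τ k x =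
        1 / (2 * k) / (1 - expTwoPi (k * τ)) * expTwoPi ((k * τ - n) * x) +
        1 / (2 * k) * expTwoPi (-(k * (starRingEnd ℂ) τ)) /
          (1 - expTwoPi (-(k * (starRingEnd ℂ) τ))) *
          expTwoPi ((k * (starRingEnd ℂ) τ - n) * x) := by
      intro x
      have e (w : ℂ) : expTwoPi ((w - n) * x) = expTwoPi (w * x) * expTwoPi (-n * x) := by
        rw [← expTwoPi_add]; ring_nf
      rw [hform, e, e]
      ring
    simp_rw [hint]
    rw [intervalIntegral.integral_add, intervalIntegral.integral_const_mul,
      intervalIntegral.integral_const_mul, integral_expTwoPi hζ1, integral_expTwoPi hζ2]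
    rotate_left
    · exact Continuous.intervalIntegrable (by fun_prop) _ _
    · exact Continuous.intervalIntegrable (by fun_prop) _ _
    have e1 : ∀ w : ℂ, expTwoPi (w - n) = expTwoPi w := fun w => by
      rw [sub_eq_add_neg, expTwoPi_add, expTwoPi_neg, expTwoPi_intCast, inv_one, mul_one]
    rw [e1, e1, greenCoeff]
    have hn : ((‖((k : ℤ) * (τ : ℂ) - n : ℂ)‖ ^ 2 : ℝ) : ℂ) =
        (k * τ - n) * (k * (starRingEnd ℂ) τ - n) := by
      rw [← Complex.normSq_eq_norm_sq, ← Complex.mul_conj]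
      simp
    have him : ((τ.im : ℝ) : ℂ) = ((τ : ℂ) - (starRingEnd ℂ) τ) / (2 * Complex.I) := by
      rw [Complex.sub_conj]
      have := Complex.I_ne_zero
      field_simp
      simp [mul_comm]
    have hπ : (π : ℂ) ≠ 0 := by exact_mod_cast Real.pi_ne_zero
    have hI := Complex.I_ne_zero
    have he := expTwoPi_ne_zero (k * (starRingEnd ℂ) τ)
    push_cast at hn ⊢
    rw [hn, him]
    rw [expTwoPi_neg] at hd' ⊢
    set Q := expTwoPi (k * τ)
    set R := expTwoPi (k * (starRingEnd ℂ) τ)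
    have hR : R⁻¹ / (1 - R⁻¹) = 1 / (R - 1) := by
      have hd'' : R - 1 ≠ 0 := by
        intro h
        rw [sub_eq_zero] at h
        simp [h] at hd'
      field_simp
    have hd'' : R - 1 ≠ 0 := by
      intro h
      rw [sub_eq_zero] at h
      simp [h] at hd'
    rw [mul_div_assoc, hR]
    have hQ : 1 / (2 * (k : ℂ)) / (1 - Q) * ((Q - 1) / (2 * π * Complex.I * (k * τ - n))) =
        -1 / (2 * k * (2 * π * Complex.I * (k * τ - n))) := by
      field_simp
      ring
    rw [hQ]
    field_simp
    ring
  · exact Complex.ofRealCLM.summable (summable_greenCoeff τ k)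

lemma layer_zero (τ : ℍ) {s : ℝ} (hs : s ∈ Set.Icc (0 : ℝ) 1) :
    layer τ 0 s = (π * τ.im * bernoulliTwo s : ℝ) := (hasSum_layer_zero τ hs).tsum_eq

lemma layer_natCast (τ : ℍ) {k : ℕ} (hk : k ≠ 0) {s : ℝ} (hs : s ∈ Set.Icc (0 : ℝ) 1) :
    layer τ k s = layerClosed τ k s := (hasSum_layerClosed τ hk hs).tsum_eq

end EllipticDiscrepancy

end

/-! ### The product formula for the Néron function: periodicity, Lambert series, continuity. -/

section

namespace EllipticDiscrepancy

variable {τ : ℍ} {z : ℂ}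

lemma log_norm_expTwoPi (z : ℂ) : Real.log ‖expTwoPi z‖ = -2 * π * z.im := by
  rw [norm_expTwoPi, Real.log_exp]

lemma neronFormula_eq (τ : ℍ) (z : ℂ) :
    neronFormula τ z = π * τ.im * bernoulliTwo (z.im / τ.im) - Real.log ‖1 - expTwoPi z‖
      - ∑' n : ℕ, Real.log ‖(1 - expTwoPi τ ^ (n + 1) * expTwoPi z) *
        (1 - expTwoPi τ ^ (n + 1) / expTwoPi z)‖ := by
  change (-1 / 2) * bernoulliTwo (Real.log ‖expTwoPi z‖ / Real.log ‖expTwoPi τ‖) *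
    Real.log ‖expTwoPi τ‖ - Real.log ‖1 - expTwoPi z‖
      - ∑' n : ℕ, Real.log ‖(1 - expTwoPi τ ^ (n + 1) * expTwoPi z) *
        (1 - expTwoPi τ ^ (n + 1) / expTwoPi z)‖ = _
  rw [log_norm_expTwoPi, log_norm_expTwoPi, mul_div_mul_left _ _ (by simp [Real.pi_ne_zero])]
  simp only [coe_im]
  ring

lemma norm_expTwoPi_lt_one (τ : ℍ) : ‖expTwoPi τ‖ < 1 := by
  simpa using norm_expTwoPi_natCast_mul_lt_one τ one_ne_zero

lemma summable_log_norm_one_sub (τ : ℍ) (w : ℂ) :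
    Summable fun n : ℕ => Real.log ‖1 - expTwoPi τ ^ (n + 1) * w‖ := by
  have h : Summable fun n : ℕ => -(expTwoPi τ ^ (n + 1) * w) := by
    refine (Summable.mul_right w ?_).neg
    exact (summable_nat_add_iff 1).mpr
      (summable_geometric_of_norm_lt_one (norm_expTwoPi_lt_one τ))
  have h2 := Complex.reCLM.summable (Complex.summable_log_one_add_of_summable h)
  refine h2.congr fun n => ?_
  simp [Complex.log_re, sub_eq_add_neg]

lemma one_sub_expTwoPi_ne_zero (hz : z ∉ lattice τ) (n : ℤ) : 1 - expTwoPi (n * τ + z) ≠ 0 := by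
  intro h
  obtain ⟨m, hm⟩ := expTwoPi_eq_one_iff.mp (sub_eq_zero.mp h).symm
  exact hz (mem_lattice_iff.mpr ⟨m, -n, by push_cast; linear_combination hm⟩)

lemma one_sub_expTwoPi_ne_zero' (hz : z ∉ lattice τ) : 1 - expTwoPi z ≠ 0 := by
  simpa using one_sub_expTwoPi_ne_zero hz 0

lemma one_sub_pow_mul_ne_zero (hz : z ∉ lattice τ) (n : ℕ) :
    1 - expTwoPi τ ^ n * expTwoPi z ≠ 0 := by
  rw [← expTwoPi_natCast_mul, ← expTwoPi_add]
  simpa using one_sub_expTwoPi_ne_zero hz n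

lemma one_sub_pow_mul_inv_ne_zero (hz : z ∉ lattice τ) (n : ℕ) :
    1 - expTwoPi τ ^ n * (expTwoPi z)⁻¹ ≠ 0 := by
  rw [← expTwoPi_neg]
  exact one_sub_pow_mul_ne_zero (by simpa using hz) n

lemma neronFormula_eq_sub_sub (hz : z ∉ lattice τ) :
    neronFormula τ z = π * τ.im * bernoulliTwo (z.im / τ.im) - Real.log ‖1 - expTwoPi z‖
      - (∑' n : ℕ, Real.log ‖1 - expTwoPi τ ^ (n + 1) * expTwoPi z‖ +
        ∑' n : ℕ, Real.log ‖1 - expTwoPi τ ^ (n + 1) * (expTwoPi z)⁻¹‖) := by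
  rw [neronFormula_eq, ← Summable.tsum_add (summable_log_norm_one_sub τ _)
    (summable_log_norm_one_sub τ _)]
  congr 2 with n
  rw [norm_mul, div_eq_mul_inv, Real.log_mul]
  · exact norm_ne_zero_iff.mpr (one_sub_pow_mul_ne_zero hz _)
  · exact norm_ne_zero_iff.mpr (one_sub_pow_mul_inv_ne_zero hz _)

lemma neronFormula_add_one (τ : ℍ) (z : ℂ) : neronFormula τ (z + 1) = neronFormula τ z := by
  have : expTwoPi (z + 1) = expTwoPi z := by
    have := expTwoPi_intCast 1
    rw [expTwoPi_add]; simp_all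
  rw [neronFormula_eq, neronFormula_eq, this]
  simp

/-- Replacing u by qu shifts the two products and leaves the factor (1 - u⁻¹) = -(1 - u)/u. The
resulting log|u| is cancelled by B₂(T+1) - B₂(T) = 2T. -/
lemma neronFormula_add_tau (hz : z ∉ lattice τ) : neronFormula τ (z + τ) = neronFormula τ z := by
  have hτ : (τ : ℂ) ∈ lattice τ := mem_lattice_iff.mpr ⟨0, 1, by simp⟩
  have hz' : z + τ ∉ lattice τ := fun h => hz (by simpa using sub_mem h hτ)
  have hq := expTwoPi_ne_zero τ
  have hu := expTwoPi_ne_zero z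
  rw [neronFormula_eq_sub_sub hz, neronFormula_eq_sub_sub hz', expTwoPi_add]
  have e1 := (summable_log_norm_one_sub τ (expTwoPi z)).tsum_eq_zero_add
  have e2 := (summable_log_norm_one_sub τ (expTwoPi z * expTwoPi τ)⁻¹).tsum_eq_zero_add
  have e3 : ∀ n : ℕ, expTwoPi τ ^ (n + 1 + 1) * (expTwoPi z * expTwoPi τ)⁻¹ =
      expTwoPi τ ^ (n + 1) * (expTwoPi z)⁻¹ := fun n => by field_simp; ring
  have e4 : ∀ n : ℕ, expTwoPi τ ^ (n + 1) * (expTwoPi z * expTwoPi τ) =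
      expTwoPi τ ^ (n + 1 + 1) * expTwoPi z := fun n => by ring
  simp_rw [e3] at e2
  simp_rw [e4]
  rw [e2, e1]
  have e5 : 1 - expTwoPi τ ^ (0 + 1) * (expTwoPi z * expTwoPi τ)⁻¹ =
      -(1 - expTwoPi z) / expTwoPi z := by field_simp; ring
  rw [e5, norm_div, norm_neg, Real.log_div (norm_ne_zero_iff.mpr (one_sub_expTwoPi_ne_zero' hz))
    (norm_ne_zero_iff.mpr hu), log_norm_expTwoPi]
  have hy := τ.im_pos.ne'
  simp only [bernoulliTwo, Complex.add_im, coe_im, zero_add, pow_one, mul_comm (expTwoPi τ)]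
  field_simp
  ring

lemma neronFormula_add_of_mem (hz : z ∉ lattice τ) {l : ℂ} (hl : l ∈ lattice τ) :
    neronFormula τ (z + l) = neronFormula τ z := by
  have hτ : (τ : ℂ) ∈ lattice τ := mem_lattice_iff.mpr ⟨0, 1, by simp⟩
  have h1 : (1 : ℂ) ∈ lattice τ := mem_lattice_iff.mpr ⟨1, 0, by simp⟩
  have key : ∀ l ∈ lattice τ, ∀ z ∉ lattice τ, neronFormula τ (z + l) = neronFormula τ z := by
    intro l hl
    induction hl using AddSubgroup.closure_induction with
    | mem x hx =>
      intro z hz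
      rcases hx with rfl | rfl
      · exact neronFormula_add_one τ z
      · exact neronFormula_add_tau hz
    | zero => simp
    | add x y hx hy ihx ihy =>
      intro z hz
      rw [← add_assoc, ihy _ (fun h => hz (by simpa using sub_mem h hx)), ihx z hz]
    | neg x hx ih =>
      intro z hz
      rw [← ih (z + -x) (fun h => hz (by simpa using add_mem h hx))]
      simp
  exact key l hl z hz

lemma torusNeron_coe (hz : z ∉ lattice τ) : torusNeron τ (z : Torus τ) = neronFormula τ z := by
  have h : ((Quotient.out (z : Torus τ) : ℂ) : Torus τ) = (z : Torus τ) :=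
    Quotient.out_eq (z : Torus τ)
  rw [QuotientAddGroup.eq] at h
  have h2 : Quotient.out (z : Torus τ) = z + -(-Quotient.out (z : Torus τ) + z) := by abel
  rw [torusNeron, h2]
  exact neronFormula_add_of_mem hz (neg_mem h)

lemma hasSum_neg_log_norm_one_sub {w : ℂ} (hw : ‖w‖ < 1) :
    HasSum (fun k : ℕ => (w ^ k / k).re) (-Real.log ‖1 - w‖) := by
  have := Complex.hasSum_re (Complex.hasSum_taylorSeries_neg_log hw)
  simpa [Complex.log_re] using this

lemma norm_expTwoPi_mul_lt_one (hz : |z.im| < τ.im) :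
    ‖expTwoPi τ‖ * ‖expTwoPi z‖ < 1 ∧ ‖expTwoPi τ‖ * ‖(expTwoPi z)⁻¹‖ < 1 := by
  obtain ⟨h1, h2⟩ := abs_lt.mp hz
  rw [← expTwoPi_neg, ← norm_mul, ← norm_mul, ← expTwoPi_add, ← expTwoPi_add, norm_expTwoPi,
    norm_expTwoPi, Real.exp_lt_one_iff, Real.exp_lt_one_iff]
  simp only [Complex.add_im, coe_im, Complex.neg_im]
  constructor <;> nlinarith [Real.pi_pos]

/-- Expand every logarithm in its power series and sum over the factor index first, which is a
geometric series in q^k. The strip |Im z| < Im τ gives absolute convergence; the k = 0 term is 0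
because of the division by k. -/
lemma hasSum_neronFormula_products (hz : |z.im| < τ.im) :
    HasSum (fun k : ℕ => (expTwoPi τ ^ k / (1 - expTwoPi τ ^ k) *
        (expTwoPi z ^ k + (expTwoPi z)⁻¹ ^ k) / k).re)
      (-∑' n : ℕ, Real.log ‖(1 - expTwoPi τ ^ (n + 1) * expTwoPi z) *
        (1 - expTwoPi τ ^ (n + 1) / expTwoPi z)‖) := by
  set q := expTwoPi τ
  set u := expTwoPi z
  have hq : ‖q‖ < 1 := norm_expTwoPi_lt_one τ
  obtain ⟨hu1, hu2⟩ := norm_expTwoPi_mul_lt_one hz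
  change ‖q‖ * ‖u‖ < 1 at hu1
  change ‖q‖ * ‖u⁻¹‖ < 1 at hu2
  set f : ℕ × ℕ → ℂ := fun p => (q ^ (p.1 + 1) * u) ^ p.2 / p.2 +
    (q ^ (p.1 + 1) * u⁻¹) ^ p.2 / p.2
  have hterm : ∀ (w : ℂ) (n k : ℕ),
      ‖(q ^ (n + 1) * w) ^ k / k‖ ≤ ‖q‖ ^ n * (‖q‖ * ‖w‖) ^ k := by
    intro w n k
    rcases Nat.eq_zero_or_pos k with rfl | hk
    · simp
    rw [norm_div, norm_pow, norm_mul, norm_pow, Complex.norm_natCast]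
    have hk1 : (1 : ℝ) ≤ k := by exact_mod_cast hk
    refine (div_le_self (by positivity) hk1).trans ?_
    rw [pow_succ, mul_assoc, mul_pow]
    refine mul_le_mul_of_nonneg_right ?_ (by positivity)
    rw [← pow_mul]
    exact pow_le_pow_of_le_one (norm_nonneg _) hq.le (Nat.le_mul_of_pos_right _ hk)
  have hfs : Summable f := by
    have g0 := summable_geometric_of_lt_one (norm_nonneg _) hq
    have g1 := summable_geometric_of_lt_one (by positivity) hu1
    have g2 := summable_geometric_of_lt_one (by positivity) hu2
    refine Summable.of_norm_bounded
      ((g0.mul_of_nonneg g1 (fun _ => by positivity) (fun _ => by positivity)).add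
        (g0.mul_of_nonneg g2 (fun _ => by positivity) (fun _ => by positivity))) ?_
    rintro ⟨n, k⟩
    exact (norm_add_le _ _).trans (add_le_add (hterm u n k) (hterm u⁻¹ n k))
  have hre : Summable fun p => (f p).re := Complex.reCLM.summable hfs
  have hlt : ∀ (w : ℂ), ‖q‖ * ‖w‖ < 1 → ∀ n : ℕ, ‖q ^ (n + 1) * w‖ < 1 := by
    intro w hw n
    rw [norm_mul, norm_pow, pow_succ, mul_assoc]
    exact mul_lt_one_of_nonneg_of_lt_one_right (pow_le_one₀ (norm_nonneg _) hq.le)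
      (by positivity) hw
  have hne : ∀ {w : ℂ}, ‖w‖ < 1 → ‖1 - w‖ ≠ 0 := by
    intro w hw h
    rw [norm_eq_zero, sub_eq_zero] at h
    rw [← h] at hw
    simp at hw
  have h1 := hre.hasSum.prod_fiberwise (g := fun n =>
      -Real.log ‖(1 - q ^ (n + 1) * u) * (1 - q ^ (n + 1) / u)‖) (by
    intro n
    rw [norm_mul, div_eq_mul_inv, Real.log_mul (hne (hlt u hu1 n)) (hne (hlt _ hu2 n)), neg_add]
    simpa [f] using (hasSum_neg_log_norm_one_sub (hlt u hu1 n)).add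
      (hasSum_neg_log_norm_one_sub (hlt _ hu2 n)))
  have h2 := ((Equiv.prodComm ℕ ℕ).hasSum_iff.mpr hre.hasSum).prod_fiberwise (g := fun k : ℕ =>
      (q ^ k / (1 - q ^ k) * (u ^ k + u⁻¹ ^ k) / k).re) (by
    intro k
    simp only [Function.comp_apply, Equiv.prodComm_apply, Prod.swap_prod_mk]
    refine Complex.hasSum_re (f := fun n => f (n, k)) ?_
    rcases Nat.eq_zero_or_pos k with rfl | hk
    · simp [f, hasSum_zero]
    have hqk : ‖q ^ k‖ < 1 := by
      rw [norm_pow]; exact pow_lt_one₀ (norm_nonneg _) hq hk.ne'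
    have := ((hasSum_geometric_of_norm_lt_one hqk).mul_left (q ^ k)).mul_right
      ((u ^ k + u⁻¹ ^ k) / k)
    convert! this using 1
    · ext n
      simp only [f, mul_pow, ← pow_mul]
      ring
    · ring)
  rw [tsum_neg.symm, h1.tsum_eq]
  exact h2

lemma neronFormula_eq_add_tsum (hz : |z.im| < τ.im) :
    neronFormula τ z = π * τ.im * bernoulliTwo (z.im / τ.im) - Real.log ‖1 - expTwoPi z‖ +
      ∑' k : ℕ, (expTwoPi τ ^ k / (1 - expTwoPi τ ^ k) *
        (expTwoPi z ^ k + (expTwoPi z)⁻¹ ^ k) / k).re := by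
  rw [(hasSum_neronFormula_products hz).tsum_eq, neronFormula_eq]
  ring

lemma norm_one_sub_pow_ge {q : ℂ} (hq : ‖q‖ < 1) {k : ℕ} (hk : k ≠ 0) :
    1 - ‖q‖ ≤ ‖1 - q ^ k‖ := by
  have h1 := norm_sub_norm_le 1 (q ^ k)
  rw [norm_one, norm_pow] at h1
  have h2 := pow_le_of_le_one (norm_nonneg q) hq.le hk
  linarith

/-- On a slightly narrower strip |Im w| < c the Lambert series is dominated by a geometric series of
ratio |q|e^{2πc} < 1. -/
lemma continuousAt_neronFormula_of_abs_lt (hz : z ∉ lattice τ) (him : |z.im| < τ.im) :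
    ContinuousAt (neronFormula τ) z := by
  obtain ⟨c, hc1, hc2⟩ := exists_between him
  have hc0 : 0 < c := (abs_nonneg _).trans_lt hc1
  set U : Set ℂ := {w | |w.im| < c}
  have hU : IsOpen U := isOpen_lt (by fun_prop) continuous_const
  have hq := norm_expTwoPi_lt_one τ
  set q := expTwoPi τ
  set ρ := ‖q‖ * Real.exp (2 * π * c)
  have hρ : ρ < 1 := by
    simp only [ρ, q]
    rw [norm_expTwoPi, ← Real.exp_add, Real.exp_lt_one_iff]
    simp only [coe_im]
    nlinarith [Real.pi_pos]
  have hcont : ContinuousOn (fun w : ℂ => ∑' k : ℕ, (q ^ k / (1 - q ^ k) *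
        (expTwoPi w ^ k + (expTwoPi w)⁻¹ ^ k) / k).re) U := by
    refine continuousOn_tsum (u := fun k => 2 / (1 - ‖q‖) * ρ ^ k) ?_ ?_ ?_
    · intro k
      refine Continuous.continuousOn ?_
      simp_rw [← expTwoPi_neg]
      fun_prop
    · exact (summable_geometric_of_lt_one (by positivity) hρ).mul_left _
    · intro k w hw
      have hq1 : 0 < 1 - ‖q‖ := by linarith
      rcases Nat.eq_zero_or_pos k with rfl | hk
      · simp; positivity
      refine (Complex.abs_re_le_norm _).trans ?_
      have hk1 : (1 : ℝ) ≤ k := by exact_mod_cast hk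
      rw [norm_div, Complex.norm_natCast]
      refine (div_le_self (norm_nonneg _) hk1).trans ?_
      obtain ⟨hw1, hw2⟩ := abs_lt.mp (show |w.im| < c from hw)
      have b1 : ‖expTwoPi w‖ ≤ Real.exp (2 * π * c) := by
        rw [norm_expTwoPi, Real.exp_le_exp]; nlinarith [Real.pi_pos]
      have b2 : ‖(expTwoPi w)⁻¹‖ ≤ Real.exp (2 * π * c) := by
        rw [← expTwoPi_neg, norm_expTwoPi, Real.exp_le_exp, Complex.neg_im]
        nlinarith [Real.pi_pos]
      have b3 : ‖expTwoPi w ^ k + (expTwoPi w)⁻¹ ^ k‖ ≤ 2 * Real.exp (2 * π * c) ^ k := by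
        refine (norm_add_le _ _).trans ?_
        rw [norm_pow, norm_pow, two_mul]
        gcongr
      have b4 := norm_one_sub_pow_ge hq hk.ne'
      rw [norm_mul, norm_div, norm_pow]
      calc ‖q‖ ^ k / ‖1 - q ^ k‖ * ‖expTwoPi w ^ k + (expTwoPi w)⁻¹ ^ k‖
          ≤ ‖q‖ ^ k / (1 - ‖q‖) * (2 * Real.exp (2 * π * c) ^ k) := by gcongr
        _ = 2 / (1 - ‖q‖) * ρ ^ k := by simp only [ρ, mul_pow]; ring
  have hzU : U ∈ 𝓝 z := hU.mem_nhds hc1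
  have hc := hcont.continuousAt hzU
  have heq : neronFormula τ =ᶠ[𝓝 z] fun w => π * τ.im * bernoulliTwo (w.im / τ.im)
      - Real.log ‖1 - expTwoPi w‖ + ∑' k : ℕ, (q ^ k / (1 - q ^ k) *
        (expTwoPi w ^ k + (expTwoPi w)⁻¹ ^ k) / k).re := by
    filter_upwards [hzU] with w hw
    exact neronFormula_eq_add_tsum (lt_trans hw hc2)
  refine ContinuousAt.congr (ContinuousAt.add (ContinuousAt.sub ?_ ?_) hc) heq.symm
  · unfold bernoulliTwo
    fun_prop
  · exact ContinuousAt.log (by fun_prop) (norm_ne_zero_iff.mpr (one_sub_expTwoPi_ne_zero' hz))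

lemma exists_add_mem_strip (τ : ℍ) (z : ℂ) :
    ∃ l ∈ lattice τ, 0 ≤ (z + l).im ∧ (z + l).im < τ.im := by
  refine ⟨-⌊z.im / τ.im⌋ * τ, mem_lattice_iff.mpr ⟨0, -⌊z.im / τ.im⌋, by push_cast; ring⟩, ?_⟩
  have hy := τ.im_pos
  have h1 := Int.floor_le (z.im / τ.im)
  have h2 := Int.lt_floor_add_one (z.im / τ.im)
  rw [le_div_iff₀ hy] at h1
  rw [div_lt_iff₀ hy] at h2
  simp only [Complex.add_im, Complex.mul_im, Complex.neg_re, Complex.neg_im, Complex.intCast_re,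
    Complex.intCast_im, coe_im]
  constructor <;> linarith

lemma isClosed_lattice (τ : ℍ) : IsClosed (lattice τ : Set ℂ) := by
  have := (periodPair τ).isClosed_lattice
  convert! this using 1
  ext z
  exact mem_periodPair_lattice.symm

lemma continuousAt_neronFormula (hz : z ∉ lattice τ) : ContinuousAt (neronFormula τ) z := by
  obtain ⟨l, hl, h1, h2⟩ := exists_add_mem_strip τ z
  have hzl : z + l ∉ lattice τ := fun h => hz (by simpa using sub_mem h hl)
  have h3 := continuousAt_neronFormula_of_abs_lt hzl (by rwa [abs_of_nonneg h1])
  have h4 : ContinuousAt (fun w => neronFormula τ (w + l)) z :=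
    ContinuousAt.comp (f := fun w => w + l) h3 (by fun_prop)
  refine h4.congr ?_
  filter_upwards [(isClosed_lattice τ).isOpen_compl.mem_nhds hz] with w hw
  exact neronFormula_add_of_mem hw hl

lemma torusNeron_comp_coe_continuousAt (hz : z ∉ lattice τ) :
    ContinuousAt (fun w : ℂ => torusNeron τ (w : Torus τ)) z := by
  refine (continuousAt_neronFormula hz).congr ?_
  filter_upwards [(isClosed_lattice τ).isOpen_compl.mem_nhds hz] with w hw
  exact (torusNeron_coe hw).symm

lemma measurable_torusNeron (τ : ℍ) : Measurable (torusNeron τ) := by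
  refine measurable_from_quotient.mpr ?_
  change Measurable fun w : ℂ => torusNeron τ (w : Torus τ)
  have hm : MeasurableSet (lattice τ : Set ℂ) := (isClosed_lattice τ).measurableSet
  have h2 : ∀ w ∈ lattice τ, torusNeron τ (w : Torus τ) = torusNeron τ 0 := fun w hw => by
    rw [(QuotientAddGroup.eq_zero_iff w).mpr hw]
  refine measurable_of_restrict_of_restrict_compl hm ?_ ?_
  · have : (lattice τ : Set ℂ).domRestrict (fun w : ℂ => torusNeron τ (w : Torus τ)) =
        fun _ => torusNeron τ 0 := by
      ext w
      exact h2 w w.2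
    rw [this]
    exact measurable_const
  · refine Continuous.measurable (continuousOn_iff_continuous_domRestrict.mp ?_)
    exact fun w hw => (torusNeron_comp_coe_continuousAt hw).continuousWithinAt

end EllipticDiscrepancy

end

/-! ### The Fourier coefficients of the Néron function. -/

section

/-- A series of functions with summable `L¹` norms converges almost everywhere to an integrable
function, and may be integrated term by term. -/
lemma MeasureTheory.integrable_and_hasSum_integral {α ι : Type*} [Countable ι]
    {mα : MeasurableSpace α} {μ : Measure α} {F : ι → α → ℂ} {f : α → ℂ}
    (hF : ∀ i, Integrable (F i) μ) (hs : Summable fun i => ∫ a, ‖F i a‖ ∂μ)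
    (hf : AEStronglyMeasurable f μ) (h : ∀ᵐ a ∂μ, HasSum (fun i => F i a) (f a)) :
    Integrable f μ ∧ HasSum (fun i => ∫ a, F i a ∂μ) (∫ a, f a ∂μ) := by
  constructor
  · refine ⟨hf, ?_⟩
    have h1 : ∫⁻ a, ‖f a‖ₑ ∂μ ≤ ∫⁻ a, ∑' i, ‖F i a‖ₑ ∂μ := by
      refine lintegral_mono_ae ?_
      filter_upwards [h] with a ha
      rw [← ha.tsum_eq]
      exact enorm_tsum_le_tsum_enorm
    refine lt_of_le_of_lt h1 ?_
    rw [lintegral_tsum fun i => (hF i).1.enorm]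
    have h2 : ∀ i, ∫⁻ a, ‖F i a‖ₑ ∂μ = ENNReal.ofReal (∫ a, ‖F i a‖ ∂μ) := fun i =>
      (ofReal_integral_norm_eq_lintegral_enorm (hF i)).symm
    simp_rw [h2]
    rw [← ENNReal.ofReal_tsum_of_nonneg (fun i => integral_nonneg fun _ => norm_nonneg _) hs]
    exact ENNReal.ofReal_lt_top
  · have h1 := hasSum_integral_of_summable_integral_norm hF hs
    rwa [integral_congr_ae (h.mono fun a ha => ha.tsum_eq)] at h1

namespace EllipticDiscrepancy

variable {τ : ℍ}

lemma norm_layer_natCast_le (τ : ℍ) {k : ℕ} (hk : k ≠ 0) {s : ℝ} (hs : s ∈ Set.Icc (0 : ℝ) 1) :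
    ‖layer τ k s‖ ≤ 1 / (2 * (1 - ‖expTwoPi τ‖)) *
      ((Real.exp (-(2 * π * τ.im * k) * s) + Real.exp (-(2 * π * τ.im * k) * (1 - s))) / k) := by
  have hq := norm_expTwoPi_lt_one τ
  have hq1 : 0 < 1 - ‖expTwoPi τ‖ := by linarith
  have h1 := norm_one_sub_pow_ge hq hk
  have e1 : ∀ t : ℝ, ‖expTwoPi (k * τ * t)‖ = Real.exp (-(2 * π * τ.im * k) * t) := fun t => by
    rw [norm_expTwoPi]; congr 1; simp; ring
  have e2 : (1 - s : ℂ) = ((1 - s : ℝ) : ℂ) := by push_cast; rfl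
  rw [layer_natCast τ hk hs, layerClosed, norm_mul]
  have hk0 : (0 : ℝ) < k := by positivity
  calc ‖(1 / (2 * k) : ℂ)‖ * ‖_‖ ≤ 1 / (2 * k) * (Real.exp (-(2 * π * τ.im * k) * s) /
        (1 - ‖expTwoPi τ‖) + Real.exp (-(2 * π * τ.im * k) * (1 - s)) / (1 - ‖expTwoPi τ‖)) := by
        refine mul_le_mul (by simp) ((norm_add_le _ _).trans ?_) (norm_nonneg _) (by positivity)
        rw [RCLike.norm_conj, norm_div, norm_div, e2, e1, e1, expTwoPi_natCast_mul]
        gcongr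
    _ = _ := by field_simp

lemma norm_layer_neg (τ : ℍ) (m : ℤ) (s : ℝ) : ‖layer τ (-m) s‖ = ‖layer τ m s‖ := by
  rw [layer_neg, RCLike.norm_conj]

/-- Strict inequalities are essential: inside the interval the layers decay exponentially in |m|, at
the endpoints only like 1/|m|. -/
lemma summable_norm_layer (τ : ℍ) {s : ℝ} (h0 : 0 < s) (h1 : s < 1) :
    Summable fun m : ℤ => ‖layer τ m s‖ := by
  have hs : s ∈ Set.Icc (0 : ℝ) 1 := ⟨h0.le, h1.le⟩
  have hnat : Summable fun k : ℕ => ‖layer τ k s‖ := by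
    have hy := τ.im_pos
    have hlt : ∀ t : ℝ, 0 < t → Real.exp (-(2 * π * τ.im) * t) < 1 := fun t ht => by
      rw [Real.exp_lt_one_iff]
      have : 0 < 2 * π * τ.im * t := by positivity
      linarith
    have g1 := summable_geometric_of_lt_one (Real.exp_pos _).le (hlt s h0)
    have g2 := summable_geometric_of_lt_one (Real.exp_pos _).le (hlt (1 - s) (by linarith))
    refine Summable.of_norm_bounded_eventually_nat
      ((g1.add g2).mul_left (1 / (2 * (1 - ‖expTwoPi τ‖)))) ?_
    filter_upwards [eventually_ge_atTop 1] with k hk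
    rw [norm_norm]
    refine (norm_layer_natCast_le τ (by omega) hs).trans ?_
    have hq1 : 0 < 1 - ‖expTwoPi τ‖ := by linarith [norm_expTwoPi_lt_one τ]
    refine mul_le_mul_of_nonneg_left ?_ (by positivity)
    have hk1 : (1 : ℝ) ≤ k := by exact_mod_cast hk
    refine (div_le_self (by positivity) hk1).trans (le_of_eq ?_)
    rw [← Real.exp_nat_mul, ← Real.exp_nat_mul]
    congr 2 <;> ring
  refine Summable.of_nat_of_neg hnat (hnat.congr fun k => ?_)
  rw [norm_layer_neg]

/-- For |u| < 1 the Taylor series of -log|1 - u| and the Lambert series combine to the coefficient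
u^k/(k(1 - q^k)) plus its counterpart in u⁻¹, and these are the closed forms of the layers k and -k.
The double series over (m, n) is not absolutely convergent, so it is summed over n first. -/
lemma hasSum_layer (τ : ℍ) (r : ℝ) {s : ℝ} (h0 : 0 < s) (h1 : s < 1) :
    HasSum (fun m : ℤ => layer τ m s * expTwoPi (m * r)) (neronFormula τ (r + s * τ) : ℂ) := by
  have hs : s ∈ Set.Icc (0 : ℝ) 1 := ⟨h0.le, h1.le⟩
  have hy := τ.im_pos
  set z : ℂ := r + s * τ with hz
  have hzim : z.im = s * τ.im := by simp [hz]
  have hsum : Summable fun m : ℤ => layer τ m s * expTwoPi (m * r) := by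
    refine Summable.of_norm ((summable_norm_layer τ h0 h1).congr fun m => ?_)
    rw [norm_mul, norm_expTwoPi_int_mul_ofReal, mul_one]
  have hnat : HasSum (fun k : ℕ => layer τ k s * expTwoPi (k * r))
      (∑' k : ℕ, layer τ k s * expTwoPi (k * r)) := by
    have := (hsum.comp_injective (i := fun k : ℕ => (k : ℤ)) Nat.cast_injective).hasSum
    simpa [Function.comp_def] using this
  have hconj : ∀ m : ℤ, layer τ (-m) s * expTwoPi ((-m : ℤ) * r) =
      (starRingEnd ℂ) (layer τ m s * expTwoPi (m * r)) := fun m => by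
    rw [layer_neg, map_mul, conj_expTwoPi]; congr 2; simp
  have hneg : HasSum (fun k : ℕ => layer τ (-k) s * expTwoPi ((-k : ℤ) * r))
      ((starRingEnd ℂ) (∑' k : ℕ, layer τ k s * expTwoPi (k * r))) := by
    have h := Complex.hasSum_conj'.mpr hnat
    convert! h using 2 with k
    rw [hconj]; simp
  have hZ := HasSum.of_nat_of_neg (f := fun m : ℤ => layer τ m s * expTwoPi (m * r))
    (by simpa using hnat) hneg
  convert! hZ using 1
  rw [Complex.add_conj]
  simp only [Int.cast_zero, zero_mul, expTwoPi_zero, mul_one]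
  rw [layer_zero τ hs]
  -- The terms of index m and -m are conjugate; the real term m = 0, counted twice, is subtracted
  -- once.
  suffices hreal : neronFormula τ z = 2 * (∑' k : ℕ, layer τ k s * expTwoPi (k * r)).re -
      π * τ.im * bernoulliTwo s by
    rw [hreal]
    push_cast
    ring
  have hq := norm_expTwoPi_lt_one τ
  have him : |z.im| < τ.im := by
    rw [hzim, abs_of_pos (by positivity)]; nlinarith
  have hu1 : ‖expTwoPi z‖ < 1 := by
    rw [norm_expTwoPi, Real.exp_lt_one_iff, hzim]
    have : 0 < π * (s * τ.im) := by positivity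
    linarith
  have hA := (hasSum_neg_log_norm_one_sub hu1).add (hasSum_neronFormula_products him)
  have hB := (Complex.hasSum_re hnat).mul_left 2
  have hB' := hB.tsum_eq
  rw [← hB', hB.summable.tsum_eq_zero_add]
  have hA' := hA.tsum_eq
  rw [hA.summable.tsum_eq_zero_add] at hA'
  have hterm : ∀ k : ℕ, 2 * (layer τ (k + 1 : ℕ) s * expTwoPi ((k + 1 : ℕ) * r)).re =
      (expTwoPi z ^ (k + 1) / (k + 1 : ℕ)).re +
        (expTwoPi τ ^ (k + 1) / (1 - expTwoPi τ ^ (k + 1)) *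
        (expTwoPi z ^ (k + 1) + (expTwoPi z)⁻¹ ^ (k + 1)) / (k + 1 : ℕ)).re := by
    intro k
    set n := k + 1
    have hn : n ≠ 0 := Nat.succ_ne_zero k
    have hd := one_sub_expTwoPi_natCast_mul_ne_zero τ hn
    rw [layer_natCast τ hn hs, layerClosed]
    have hu : expTwoPi z ^ n = expTwoPi (n * τ * s) * expTwoPi (n * r) := by
      rw [← expTwoPi_natCast_mul, ← expTwoPi_add, hz]; ring_nf
    have hu' : expTwoPi (n * τ) * (expTwoPi z)⁻¹ ^ n =
        expTwoPi (n * τ * (1 - s)) * expTwoPi (-(n * r)) := by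
      rw [← expTwoPi_neg, ← expTwoPi_natCast_mul, ← expTwoPi_add, ← expTwoPi_add, hz]; ring_nf
    have hc : expTwoPi (n * r) = (starRingEnd ℂ) (expTwoPi (-(n * r))) := by
      rw [conj_expTwoPi]; simp
    have key : 2 * (1 / (2 * n) * (expTwoPi (n * τ * s) / (1 - expTwoPi (n * τ)) +
        (starRingEnd ℂ) (expTwoPi (n * τ * (1 - s)) / (1 - expTwoPi (n * τ)))) *
          expTwoPi (n * r)) =
        expTwoPi z ^ n / (1 - expTwoPi (n * τ)) / n + (starRingEnd ℂ)
          (expTwoPi (n * τ) * (expTwoPi z)⁻¹ ^ n / (1 - expTwoPi (n * τ)) / n) := by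
      rw [hu', hu]
      simp only [map_mul, map_div₀, map_natCast, ← hc]
      have : (n : ℂ) ≠ 0 := by exact_mod_cast hn
      field_simp
    have h2 : 2 * (1 / (2 * n) * (expTwoPi (n * τ * s) / (1 - expTwoPi (n * τ)) +
        (starRingEnd ℂ) (expTwoPi (n * τ * (1 - s)) / (1 - expTwoPi (n * τ)))) *
          expTwoPi (n * r)).re = (2 * (1 / (2 * n) * (expTwoPi (n * τ * s) /
            (1 - expTwoPi (n * τ)) + (starRingEnd ℂ) (expTwoPi (n * τ * (1 - s)) /
              (1 - expTwoPi (n * τ)))) * expTwoPi (n * r))).re := by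
      rw [Complex.mul_re]; simp
    rw [h2, key, Complex.add_re, Complex.conj_re, ← Complex.add_re, ← Complex.add_re]
    congr 1
    rw [← expTwoPi_natCast_mul n (τ : ℂ)]
    have : (n : ℂ) ≠ 0 := by exact_mod_cast hn
    field_simp
    ring
  simp_rw [hterm]
  simp only [pow_zero, Nat.cast_zero, div_zero, Complex.zero_re, zero_add] at hA'
  rw [hA']
  simp only [Nat.cast_zero, zero_mul, expTwoPi_zero, mul_one]
  rw [neronFormula_eq, hzim, mul_div_cancel_right₀ _ hy.ne', layer_zero τ hs, Complex.ofReal_re]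
  ring

lemma continuous_layer (τ : ℍ) (m : ℤ) : Continuous (layer τ m) := by
  refine continuous_tsum (u := greenCoeff τ m) (fun n => by fun_prop) (summable_greenCoeff τ m) ?_
  intro n s
  rw [norm_mul, norm_expTwoPi_int_mul_ofReal, mul_one, Complex.norm_real,
    Real.norm_of_nonneg (greenCoeff_nonneg τ m n)]

lemma integral_expTwoPi_int_mul (k : ℤ) :
    ∫ s in Set.Icc (0 : ℝ) 1, expTwoPi (k * s) = if k = 0 then 1 else 0 := by
  rw [integral_Icc_eq_integral_Ioc, ← intervalIntegral.integral_of_le zero_le_one]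
  split_ifs with h
  · simp [h]
  · rw [integral_expTwoPi (by exact_mod_cast h), expTwoPi_intCast]
    simp

lemma integral_layer_mul (τ : ℍ) (m n : ℤ) :
    ∫ s in Set.Icc (0 : ℝ) 1, layer τ m s * expTwoPi (-(n * s)) = greenCoeff τ m n := by
  have h := (integrable_and_hasSum_integral
    (μ := volume.restrict (Set.Icc (0 : ℝ) 1))
    (F := fun (l : ℤ) (s : ℝ) => (greenCoeff τ m l : ℂ) * expTwoPi (((l - n : ℤ) : ℂ) * s))
    (f := fun s => layer τ m s * expTwoPi (-(n * s))) ?_ ?_ ?_ ?_).2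
  · simp_rw [integral_const_mul, integral_expTwoPi_int_mul] at h
    have h2 := hasSum_single (f := fun l : ℤ => (greenCoeff τ m l : ℂ) *
      (if l - n = 0 then 1 else 0)) n (fun l hl => by simp [sub_eq_zero, hl])
    rw [h.unique h2]
    simp
  · intro l
    exact Continuous.integrableOn_Icc (by fun_prop)
  · refine (summable_greenCoeff τ m).congr fun l => ?_
    simp_rw [norm_mul, norm_expTwoPi_int_mul_ofReal, mul_one]
    simp [abs_of_nonneg (greenCoeff_nonneg τ m l)]
  · exact ((continuous_layer τ m).mul (by fun_prop)).aestronglyMeasurable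
  · refine ae_of_all _ fun s => ?_
    have := (summable_layer τ m s).hasSum.mul_right (expTwoPi (-(n * s)))
    refine this.congr_fun fun l => ?_
    rw [mul_assoc, ← expTwoPi_add]
    push_cast
    ring_nf

lemma integral_exp_neg_mul_le {c : ℝ} (hc : 0 < c) :
    ∫ s in Set.Icc (0 : ℝ) 1, Real.exp (-c * s) ≤ 1 / c := by
  rw [integral_Icc_eq_integral_Ioc, ← intervalIntegral.integral_of_le zero_le_one,
    intervalIntegral.integral_comp_mul_left _ (by linarith : -c ≠ 0), integral_exp]
  simp only [mul_zero, mul_one, Real.exp_zero, smul_eq_mul]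
  rw [one_div, inv_neg, neg_mul, ← mul_neg, neg_sub]
  refine mul_le_of_le_one_right (by positivity) ?_
  linarith [Real.exp_pos (-c)]

lemma integral_exp_neg_mul_one_sub (c : ℝ) :
    ∫ s in Set.Icc (0 : ℝ) 1, Real.exp (-c * (1 - s)) =
      ∫ s in Set.Icc (0 : ℝ) 1, Real.exp (-c * s) := by
  rw [integral_Icc_eq_integral_Ioc, ← intervalIntegral.integral_of_le zero_le_one,
    integral_Icc_eq_integral_Ioc, ← intervalIntegral.integral_of_le zero_le_one,
    intervalIntegral.integral_comp_sub_left (fun s => Real.exp (-c * s))]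
  simp

/-- Uniformly in s the layers are only O(1/k). Integrating e^{-cks} over s gains a second factor
1/k, and ∑ 1/k² converges. -/
lemma summable_integral_norm_layer (τ : ℍ) :
    Summable fun m : ℤ => ∫ s in Set.Icc (0 : ℝ) 1, ‖layer τ m s‖ := by
  have hy := τ.im_pos
  have hq1 : 0 < 1 - ‖expTwoPi τ‖ := by linarith [norm_expTwoPi_lt_one τ]
  have hnat : Summable fun k : ℕ => ∫ s in Set.Icc (0 : ℝ) 1, ‖layer τ k s‖ := by
    refine Summable.of_norm_bounded_eventually_nat
      ((Real.summable_one_div_nat_pow.mpr one_lt_two).mul_left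
        (1 / (2 * (1 - ‖expTwoPi τ‖)) * (2 / (2 * π * τ.im)))) ?_
    filter_upwards [eventually_ge_atTop 1] with k hk
    have hk0 : (0 : ℝ) < k := by exact_mod_cast hk
    rw [Real.norm_of_nonneg (integral_nonneg fun _ => norm_nonneg _)]
    have hc : 0 < 2 * π * τ.im * k := by positivity
    have hi1 : IntegrableOn (fun s : ℝ => Real.exp (-(2 * π * τ.im * k) * s)) (Set.Icc 0 1) :=
      Continuous.integrableOn_Icc (by fun_prop)
    have hi2 : IntegrableOn (fun s : ℝ => Real.exp (-(2 * π * τ.im * k) * (1 - s)))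
      (Set.Icc 0 1) := Continuous.integrableOn_Icc (by fun_prop)
    calc ∫ s in Set.Icc (0 : ℝ) 1, ‖layer τ k s‖
        ≤ ∫ s in Set.Icc (0 : ℝ) 1, 1 / (2 * (1 - ‖expTwoPi τ‖)) *
          ((Real.exp (-(2 * π * τ.im * k) * s) +
            Real.exp (-(2 * π * τ.im * k) * (1 - s))) / k) := by
          refine setIntegral_mono_on ?_ ?_ measurableSet_Icc
            fun s hs => norm_layer_natCast_le τ (by omega) hs
          · exact (continuous_layer τ k).norm.integrableOn_Icc
          · exact Continuous.integrableOn_Icc (by fun_prop)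
      _ ≤ 1 / (2 * (1 - ‖expTwoPi τ‖)) * ((1 / (2 * π * τ.im * k) + 1 / (2 * π * τ.im * k)) / k) := by
          rw [integral_const_mul, integral_div, integral_add hi1 hi2, integral_exp_neg_mul_one_sub]
          gcongr <;> exact integral_exp_neg_mul_le hc
      _ = _ := by field_simp; ring
  refine Summable.of_nat_of_neg hnat (hnat.congr fun k => ?_)
  simp_rw [norm_layer_neg]

/-- The uniform measure on the unit square. -/
abbrev squareMeasure : Measure (ℝ × ℝ) :=
  (volume : Measure (ℝ × ℝ)).restrict (Set.Icc 0 1 ×ˢ Set.Icc 0 1)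

lemma squareMeasure_eq_prod : squareMeasure =
    (volume.restrict (Set.Icc (0 : ℝ) 1)).prod (volume.restrict (Set.Icc (0 : ℝ) 1)) := by
  rw [Measure.prod_restrict, ← Measure.volume_eq_prod]

/-- The point of the torus with real coordinates `r`. -/
def torusPoint (τ : ℍ) (r : ℝ × ℝ) : Torus τ := (((r.1 : ℂ) + (r.2 : ℂ) * (τ : ℂ) : ℂ) : Torus τ)

lemma measurable_coe_torus (τ : ℍ) : Measurable fun z : ℂ => (z : Torus τ) :=
  measurable_quotient_mk''

lemma measurable_torusPoint (τ : ℍ) : Measurable (torusPoint τ) :=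
  (measurable_coe_torus τ).comp (by fun_prop)

lemma notMem_lattice_of_pos_of_lt_one (r : ℝ) {s : ℝ} (h0 : 0 < s) (h1 : s < 1) :
    (r + s * τ : ℂ) ∉ lattice τ := by
  intro h
  obtain ⟨m, n, h⟩ := mem_lattice_iff.mp h
  have him := congrArg Complex.im h
  simp at him
  have hs : s = n := by
    rcases him with h | h
    · exact h
    · exact absurd h τ.im_pos.ne'
  rw [hs] at h0 h1
  have h2 : 0 < n := by exact_mod_cast h0
  have h3 : n < 1 := by exact_mod_cast h1
  omega

lemma ae_squareMeasure : ∀ᵐ r ∂squareMeasure, 0 < r.2 ∧ r.2 < 1 := by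
  rw [squareMeasure_eq_prod]
  have h : ∀ᵐ s ∂(volume.restrict (Set.Icc (0 : ℝ) 1)), 0 < s ∧ s < 1 := by
    rw [← restrict_Ioo_eq_restrict_Icc]
    exact ae_restrict_mem measurableSet_Ioo
  exact Measure.quasiMeasurePreserving_snd.ae h

lemma torusNeron_torusPoint {r : ℝ × ℝ} (h0 : 0 < r.2) (h1 : r.2 < 1) :
    torusNeron τ (torusPoint τ r) = neronFormula τ (r.1 + r.2 * τ) :=
  torusNeron_coe (notMem_lattice_of_pos_of_lt_one r.1 h0 h1)

/-- The expansion in r₁ holds off the null set of edges and its L¹ norms are summable, so it may be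
integrated termwise. Orthogonality in r₁ keeps the layer m, and the integral in r₂ extracts its n-th
coefficient. -/
lemma integrable_and_integral_torusNeron (τ : ℍ) (m n : ℤ) :
    Integrable (fun r => (torusNeron τ (torusPoint τ r) : ℂ) * expTwoPi (-(m * r.1 + n * r.2)))
      squareMeasure ∧
    ∫ r, (torusNeron τ (torusPoint τ r) : ℂ) * expTwoPi (-(m * r.1 + n * r.2)) ∂squareMeasure
      = greenCoeff τ m n := by
  have hc : ∀ j : ℤ, Continuous fun r : ℝ × ℝ =>
      expTwoPi (((j - m : ℤ) : ℂ) * r.1) * (layer τ j r.2 * expTwoPi (-(n * r.2))) := fun j => by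
    have := continuous_layer τ j
    fun_prop
  have h := integrable_and_hasSum_integral (μ := squareMeasure)
    (F := fun (j : ℤ) (r : ℝ × ℝ) =>
      expTwoPi (((j - m : ℤ) : ℂ) * r.1) * (layer τ j r.2 * expTwoPi (-(n * r.2))))
    (f := fun r => (torusNeron τ (torusPoint τ r) : ℂ) * expTwoPi (-(m * r.1 + n * r.2)))
    ?_ ?_ ?_ ?_
  · refine ⟨h.1, ?_⟩
    have h2 := h.2
    rw [squareMeasure_eq_prod] at h2 ⊢
    have h3 : ∀ j : ℤ, ∫ r : ℝ × ℝ, expTwoPi (((j - m : ℤ) : ℂ) * r.1) *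
        (layer τ j r.2 * expTwoPi (-(n * r.2)))
        ∂((volume.restrict (Set.Icc (0 : ℝ) 1)).prod (volume.restrict (Set.Icc (0 : ℝ) 1))) =
        (if j - m = 0 then 1 else 0) * greenCoeff τ j n := fun j => by
      rw [integral_prod_mul (fun s : ℝ => expTwoPi (((j - m : ℤ) : ℂ) * s))
        (fun s : ℝ => layer τ j s * expTwoPi (-(n * s))), integral_expTwoPi_int_mul,
        integral_layer_mul]
    simp_rw [h3] at h2
    have h4 := hasSum_single (f := fun j : ℤ => (if j - m = 0 then (1 : ℂ) else 0) *
      greenCoeff τ j n) m (fun j hj => by simp [sub_eq_zero, hj])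
    rw [h2.unique h4]
    simp
  · intro j
    exact (hc j).continuousOn.integrableOn_compact (isCompact_Icc.prod isCompact_Icc)
  · refine (summable_integral_norm_layer τ).congr fun j => ?_
    have e : ∀ r : ℝ × ℝ, ‖expTwoPi (((j - m : ℤ) : ℂ) * r.1) *
        (layer τ j r.2 * expTwoPi (-(n * r.2)))‖ = 1 * ‖layer τ j r.2‖ := fun r => by
      rw [norm_mul, norm_mul, norm_expTwoPi_int_mul_ofReal]
      have : (-(n * r.2) : ℂ) = ((-n : ℤ) : ℂ) * r.2 := by push_cast; ring
      rw [this, norm_expTwoPi_int_mul_ofReal]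
      simp
    simp_rw [e]
    rw [squareMeasure_eq_prod, integral_prod_mul (fun _ : ℝ => (1 : ℝ)) (fun s => ‖layer τ j s‖)]
    simp
  · refine AEStronglyMeasurable.mul ?_ (by fun_prop)
    exact (Complex.measurable_ofReal.comp
      ((measurable_torusNeron τ).comp (measurable_torusPoint τ))).aestronglyMeasurable
  · filter_upwards [ae_squareMeasure] with r hr
    rw [torusNeron_torusPoint hr.1 hr.2]
    have := (hasSum_layer τ r.1 hr.1 hr.2).mul_right (expTwoPi (-(m * r.1 + n * r.2)))
    refine this.congr_fun fun j => ?_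
    have e : expTwoPi (((j - m : ℤ) : ℂ) * r.1) * expTwoPi (-(n * r.2)) =
        expTwoPi (j * r.1) * expTwoPi (-(m * r.1 + n * r.2)) := by
      rw [← expTwoPi_add, ← expTwoPi_add]; push_cast; ring_nf
    linear_combination layer τ j r.2 * e

end EllipticDiscrepancy

end

/-! ### Characters of the torus, the heat kernel, and the expansion of λ_t. -/

section

namespace EllipticDiscrepancy

variable {τ : ℍ}

lemma exists_torusPoint (τ : ℍ) (P : Torus τ) : ∃ r, torusPoint τ r = P := by
  obtain ⟨z, rfl⟩ := QuotientAddGroup.mk_surjective P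
  refine ⟨(z.re - z.im / τ.im * τ.re, z.im / τ.im), ?_⟩
  rw [torusPoint]
  congr 1
  have hy := τ.im_pos.ne'
  apply Complex.ext
  · simp
  · simp [hy]

lemma torusPoint_add (r s : ℝ × ℝ) :
    torusPoint τ (r + s) = torusPoint τ r + torusPoint τ s := by
  simp only [torusPoint, ← QuotientAddGroup.mk_add, Prod.fst_add, Prod.snd_add]
  congr 1
  push_cast
  ring

lemma torusPoint_sub (r s : ℝ × ℝ) :
    torusPoint τ (r - s) = torusPoint τ r - torusPoint τ s := by
  rw [eq_sub_iff_add_eq, ← torusPoint_add, sub_add_cancel]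

lemma continuous_torusPoint (τ : ℍ) : Continuous (torusPoint τ) :=
  (QuotientAddGroup.continuous_mk).comp (by fun_prop)

lemma torusPoint_intCast (m n : ℤ) : torusPoint τ (m, n) = 0 := by
  rw [torusPoint, QuotientAddGroup.eq_zero_iff]
  exact mem_lattice_iff.mpr ⟨m, n, by simp⟩

/-- The real number `m r₁ + n r₂` attached to `r₁ + r₂τ`. -/
def phase (τ : ℍ) (m n : ℤ) : ℂ →+ ℝ where
  toFun z := 2 * π * (m * (z.re - z.im / τ.im * τ.re) + n * (z.im / τ.im))
  map_zero' := by simp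
  map_add' z w := by simp only [Complex.add_re, Complex.add_im]; ring

lemma phase_apply (m n : ℤ) (r : ℝ × ℝ) :
    phase τ m n (r.1 + r.2 * τ) = 2 * π * (m * r.1 + n * r.2) := by
  have hy := τ.im_pos.ne'
  simp [phase, hy]

/-- The character `r₁ + r₂τ ↦ exp (2πi (m r₁ + n r₂))` of the torus. -/
def charOf (τ : ℍ) (m n : ℤ) : Dual τ := by
  let f : Torus τ →+ Additive Circle := QuotientAddGroup.lift (lattice τ)
    (Circle.expHom.comp (phase τ m n)) (by
      intro z hz
      obtain ⟨a, b, rfl⟩ := mem_lattice_iff.mp hz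
      have := phase_apply (τ := τ) m n (a, b)
      push_cast at this
      change Circle.exp (phase τ m n _) = 1
      rw [this, Circle.exp_eq_one]
      exact ⟨m * a + n * b, by push_cast; ring⟩)
  refine ⟨AddChar.toAddMonoidHomEquiv.symm f, ?_⟩
  refine continuous_quot_lift _ ?_
  change Continuous fun z => Circle.exp (phase τ m n z)
  refine Circle.exp.continuous.comp ?_
  simp only [phase, AddMonoidHom.coe_mk, ZeroHom.coe_mk]
  fun_prop

lemma charOf_torusPoint (m n : ℤ) (r : ℝ × ℝ) :
    ((charOf τ m n).1 (torusPoint τ r) : ℂ) = expTwoPi (m * r.1 + n * r.2) := by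
  change (Circle.exp (phase τ m n (r.1 + r.2 * τ)) : ℂ) = _
  rw [phase_apply, Circle.coe_exp, expTwoPi]
  congr 1
  push_cast
  ring

lemma eq_zero_of_forall_expTwoPi {k : ℤ} (h : ∀ x : ℝ, expTwoPi (k * x) = 1) : k = 0 := by
  by_contra hk
  obtain ⟨n, hn⟩ := expTwoPi_eq_one_iff.mp (h (1 / (2 * k)))
  have hk0 : (k : ℂ) ≠ 0 := by exact_mod_cast hk
  push_cast at hn
  field_simp at hn
  have h2 : (1 : ℤ) = 2 * n := by
    have h3 : ((1 : ℤ) : ℂ) = ((2 * n : ℤ) : ℂ) := by push_cast; exact hn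
    exact_mod_cast h3
  omega

lemma charOf_injective {m n m' n' : ℤ} (h : charOf τ m n = charOf τ m' n') : m = m' ∧ n = n' := by
  have key : ∀ r : ℝ × ℝ, expTwoPi (m * r.1 + n * r.2) = expTwoPi (m' * r.1 + n' * r.2) := fun r => by
    rw [← charOf_torusPoint (τ := τ), h, charOf_torusPoint]
  have aux : ∀ {a b : ℤ}, (∀ x : ℝ, expTwoPi (a * x) = expTwoPi (b * x)) → a = b := by
    intro a b hab
    rw [← sub_eq_zero]
    refine eq_zero_of_forall_expTwoPi fun x => ?_
    have := hab x
    push_cast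
    rw [sub_mul, sub_eq_add_neg, expTwoPi_add, expTwoPi_neg, this,
      mul_inv_cancel₀ (expTwoPi_ne_zero _)]
  exact ⟨aux fun x => by simpa using key (x, 0), aux fun x => by simpa using key (0, x)⟩

/-- A continuous character of `ℝ / ℤ` is an exponential. -/
lemma exists_eq_expTwoPi {f : ℝ → ℂ} (hf : Continuous f) (hadd : ∀ x y, f (x + y) = f x * f y)
    (h0 : f 0 = 1) (h1 : f 1 = 1) : ∃ n : ℤ, ∀ x, f x = expTwoPi (n * x) := by
  by_contra! hcon
  -- If f differs from e(nx) at a, then g(x) = e(-nx)f(x) is multiplicative with g(a) ≠ 1.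
  -- Translation by a multiplies its integral over a period by g(a), so the integral is 0. With all
  -- Fourier coefficients 0, f would vanish, yet f(0) = 1.
  have hzero : ∀ n : ℤ, ∫ x in (0 : ℝ)..1, expTwoPi (-n * x) * f x = 0 := by
    intro n
    obtain ⟨a, ha⟩ := hcon n
    set g : ℝ → ℂ := fun x => expTwoPi (-n * x) * f x with hg
    have hgadd : ∀ x y, g (x + y) = g x * g y := fun x y => by
      simp only [hg, hadd]
      push_cast
      rw [mul_add, expTwoPi_add]; ring
    have hper : Function.Periodic g 1 := fun x => by
      rw [hgadd]
      have := expTwoPi_intCast (-n)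
      push_cast at this
      simp [hg, h1, this]
    have e1 : ∫ x in (0 : ℝ)..1, g x = g a * ∫ x in (0 : ℝ)..1, g x := by
      rw [← intervalIntegral.integral_const_mul]
      simp_rw [← hgadd]
      rw [intervalIntegral.integral_comp_add_left]
      have := hper.intervalIntegral_add_eq 0 a
      simpa using this
    have hga : g a ≠ 1 := by
      intro h
      apply ha
      simp only [hg] at h
      have e2 : expTwoPi (n * a) * expTwoPi (-n * a) = 1 := by
        rw [← expTwoPi_add]; simp
      linear_combination expTwoPi (n * a) * h - f a * e2
    have e3 : (g a - 1) * ∫ x in (0 : ℝ)..1, g x = 0 := by linear_combination -e1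
    exact (mul_eq_zero.mp e3).resolve_left (sub_ne_zero.mpr hga)
  have := hasSum_fourier_unitInterval hf (h0.trans h1.symm) hzero summable_zero
    (Set.left_mem_Icc.mpr zero_le_one)
  simp only [zero_mul] at this
  rw [h0] at this
  exact one_ne_zero (this.unique hasSum_zero)

lemma exists_charOf (γ : Dual τ) : ∃ m n, charOf τ m n = γ := by
  have hc : Continuous fun r : ℝ × ℝ => (γ.1 (torusPoint τ r) : ℂ) :=
    continuous_subtype_val.comp (γ.2.comp (continuous_torusPoint τ))
  have hz : ∀ m n : ℤ, γ.1 (torusPoint τ (m, n)) = 1 := fun m n => by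
    rw [torusPoint_intCast, AddChar.map_zero_eq_one]
  obtain ⟨m, hm⟩ := exists_eq_expTwoPi (f := fun x => (γ.1 (torusPoint τ (x, 0)) : ℂ))
    (hc.comp (by fun_prop : Continuous fun x : ℝ => (x, (0 : ℝ))))
    (fun x y => by
      rw [← Circle.coe_mul, ← AddChar.map_add_eq_mul, ← torusPoint_add, Prod.mk_add_mk, add_zero])
    (by simpa using congrArg Subtype.val (hz 0 0)) (by simpa using congrArg Subtype.val (hz 1 0))
  obtain ⟨n, hn⟩ := exists_eq_expTwoPi (f := fun x => (γ.1 (torusPoint τ (0, x)) : ℂ))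
    (hc.comp (by fun_prop : Continuous fun x : ℝ => ((0 : ℝ), x)))
    (fun x y => by
      rw [← Circle.coe_mul, ← AddChar.map_add_eq_mul, ← torusPoint_add, Prod.mk_add_mk, add_zero])
    (by simpa using congrArg Subtype.val (hz 0 0)) (by simpa using congrArg Subtype.val (hz 0 1))
  refine ⟨m, n, Subtype.ext (DFunLike.ext _ _ fun P => ?_)⟩
  obtain ⟨r, rfl⟩ := exists_torusPoint τ P
  apply Circle.ext
  rw [charOf_torusPoint, expTwoPi_add, ← hm, ← hn, ← Circle.coe_mul, ← AddChar.map_add_eq_mul,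
    ← torusPoint_add]
  simp

/-- The dual group of the torus is `ℤ × ℤ`. -/
def dualEquiv (τ : ℍ) : ℤ × ℤ ≃ Dual τ :=
  Equiv.ofBijective (fun p => charOf τ p.1 p.2)
    ⟨fun _ _ h => Prod.ext (charOf_injective h).1 (charOf_injective h).2, fun γ => by
      obtain ⟨m, n, h⟩ := exists_charOf γ
      exact ⟨(m, n), h⟩⟩

lemma measurable_of_continuous_torus {X : Type*} [TopologicalSpace X] [MeasurableSpace X]
    [BorelSpace X] {f : Torus τ → X} (hf : Continuous f) : Measurable f :=
  measurable_from_quotient.mpr (hf.comp continuous_quotient_mk').measurable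

lemma integral_haar {f : Torus τ → ℂ} (hf : Measurable f) :
    ∫ P, f P ∂(haar τ) = ∫ r, f (torusPoint τ r) ∂squareMeasure :=
  integral_map (measurable_torusPoint τ).aemeasurable hf.aestronglyMeasurable

lemma continuous_dual_coe (γ : Dual τ) : Continuous fun P => (γ.1 P : ℂ) :=
  continuous_subtype_val.comp γ.2

lemma fourierCoefficient_torusNeron (m n : ℤ) :
    fourierCoefficient (torusNeron τ) (charOf τ m n) = greenCoeff τ m n := by
  rw [fourierCoefficient, integral_haar, ← (integrable_and_integral_torusNeron τ m n).2]
  · congr 1 with r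
    rw [charOf_torusPoint, conj_expTwoPi]
    simp
  · exact (Complex.measurable_ofReal.comp (measurable_torusNeron τ)).mul
      (measurable_of_continuous_torus (Complex.continuous_conj.comp (continuous_dual_coe _)))

/-- The trivial character needs no exception: its coefficient is 0, and 0⁻¹ = 0 is the prescribed
eigenvalue. -/
lemma eigenvalue_charOf (m n : ℤ) :
    eigenvalue (charOf τ m n) = (((greenCoeff τ m n)⁻¹ : ℝ) : ℂ) := by
  have h1 : (charOf τ 0 0).1 = 1 := by
    refine DFunLike.ext _ _ fun P => ?_
    obtain ⟨r, rfl⟩ := exists_torusPoint τ P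
    apply Circle.ext
    rw [charOf_torusPoint]
    simp
  rw [eigenvalue, fourierCoefficient_torusNeron]
  split_ifs with h
  · obtain ⟨rfl, rfl⟩ := charOf_injective (τ := τ) (Subtype.ext (h.trans h1.symm))
    simp [greenCoeff_zero]
  · simp

/-- The weight `exp (-t c)` of the character `(m, n)` in the heat kernel. -/
def heatWeight (τ : ℍ) (t : ℝ) (p : ℤ × ℤ) : ℝ := Real.exp (-t * (greenCoeff τ p.1 p.2)⁻¹)

lemma heatWeight_pos (τ : ℍ) (t : ℝ) (p : ℤ × ℤ) : 0 < heatWeight τ t p := Real.exp_pos _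

lemma inv_greenCoeff (τ : ℍ) (m n : ℤ) :
    (greenCoeff τ m n)⁻¹ = 2 * π / τ.im * ((m * τ.re - n) ^ 2 + m ^ 2 * τ.im ^ 2) := by
  have hy := τ.im_pos.ne'
  have : ‖(m * τ - n : ℂ)‖ ^ 2 = (m * τ.re - n) ^ 2 + m ^ 2 * τ.im ^ 2 := by
    rw [← Complex.normSq_eq_norm_sq, Complex.normSq_apply]
    simp
    ring
  rw [greenCoeff, this, inv_div]
  field_simp

lemma summable_exp_neg_mul_int_sq {T : ℝ} (hT : 0 < T) :
    Summable fun n : ℤ => Real.exp (-π * T * n ^ 2) := by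
  refine (summable_pow_mul_jacobiTheta₂_term_bound 0 hT 0).congr fun n => ?_
  simp
  ring_nf

lemma summable_exp_neg_mul_int_sub_sq {T : ℝ} (hT : 0 < T) (θ : ℝ) :
    Summable fun n : ℤ => Real.exp (-π * T * (n - θ) ^ 2) := by
  have h := (summable_pow_mul_jacobiTheta₂_term_bound (T * |θ|) hT 0).mul_left
    (Real.exp (-π * T * θ ^ 2))
  refine Summable.of_nonneg_of_le (fun _ => (Real.exp_pos _).le) (fun n => ?_) h
  rw [pow_zero, one_mul, ← Real.exp_add, Real.exp_le_exp]
  have h1 : (n : ℝ) * θ ≤ |(n : ℝ)| * |θ| := by rw [← abs_mul]; exact le_abs_self _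
  push_cast
  nlinarith [mul_le_mul_of_nonneg_left h1 (mul_pos Real.pi_pos hT).le]

lemma summable_heatWeight (τ : ℍ) {t : ℝ} (ht : 0 < t) : Summable (heatWeight τ t) := by
  have hy := τ.im_pos
  -- K is chosen so that m² + n² ≤ K|mτ - n|²; the weights are then bounded by a product of two
  -- Gaussians.
  set K := 2 + 3 * (τ.re ^ 2 + 1) / τ.im ^ 2 with hK
  have hK0 : 0 < K := by positivity
  have hT : 0 < 2 * t / (τ.im * K) := by positivity
  have h := summable_exp_neg_mul_int_sq hT
  refine Summable.of_nonneg_of_le (fun _ => (Real.exp_pos _).le) ?_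
    (h.mul_of_nonneg h (fun _ => (Real.exp_pos _).le) (fun _ => (Real.exp_pos _).le))
  rintro ⟨m, n⟩
  rw [heatWeight, inv_greenCoeff, ← Real.exp_add, Real.exp_le_exp]
  have key : (m : ℝ) ^ 2 + n ^ 2 ≤ K * ((m * τ.re - n) ^ 2 + m ^ 2 * τ.im ^ 2) := by
    have e1 : (2 * τ.re ^ 2 + 1) * (m : ℝ) ^ 2 ≤
        3 * (τ.re ^ 2 + 1) / τ.im ^ 2 * (m ^ 2 * τ.im ^ 2) := by
      rw [div_mul_eq_mul_div, le_div_iff₀ (by positivity)]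
      nlinarith [sq_nonneg ((m : ℝ) * τ.im), sq_nonneg ((m : ℝ) * τ.im * τ.re)]
    have e2 : 0 ≤ 3 * (τ.re ^ 2 + 1) / τ.im ^ 2 * (m * τ.re - n) ^ 2 := by positivity
    have e3 : 0 ≤ (m : ℝ) ^ 2 * τ.im ^ 2 := by positivity
    rw [hK]
    nlinarith [sq_nonneg (2 * ((m : ℝ) * τ.re) - n)]
  have e : -t * (2 * π / τ.im * ((m * τ.re - n) ^ 2 + m ^ 2 * τ.im ^ 2)) =
      -(π * (2 * t / (τ.im * K))) * (K * ((m * τ.re - n) ^ 2 + m ^ 2 * τ.im ^ 2)) := by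
    field_simp
  simp only
  rw [e]
  have : 0 < π * (2 * t / (τ.im * K)) := by positivity
  nlinarith

lemma heatKernel_eq (τ : ℍ) (t : ℝ) (P : Torus τ) :
    heatKernel τ t P = ∑' p : ℤ × ℤ, (heatWeight τ t p : ℂ) * ((charOf τ p.1 p.2).1 P : ℂ) := by
  rw [heatKernel, ← (dualEquiv τ).tsum_eq]
  congr 1 with p
  change Complex.exp (-(t : ℂ) * eigenvalue (charOf τ p.1 p.2)) * ((charOf τ p.1 p.2).1 P : ℂ) = _
  rw [eigenvalue_charOf, heatWeight]
  push_cast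
  rfl

lemma norm_heatWeight_mul (τ : ℍ) (t : ℝ) (p : ℤ × ℤ) (P : Torus τ) :
    ‖(heatWeight τ t p : ℂ) * ((charOf τ p.1 p.2).1 P : ℂ)‖ = heatWeight τ t p := by
  rw [norm_mul, Circle.norm_coe, mul_one, Complex.norm_real,
    Real.norm_of_nonneg (heatWeight_pos τ t p).le]

lemma continuous_heatKernel (τ : ℍ) {t : ℝ} (ht : 0 < t) : Continuous (heatKernel τ t) := by
  rw [show heatKernel τ t = _ from funext (heatKernel_eq τ t)]
  refine continuous_tsum (u := heatWeight τ t)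
    (fun p => continuous_const.mul (continuous_dual_coe _)) (summable_heatWeight τ ht) ?_
  intro p P
  exact (norm_heatWeight_mul τ t p P).le

lemma greenCoeff_le (τ : ℍ) : ∃ C, ∀ m n, greenCoeff τ m n ≤ C := by
  have hy := τ.im_pos
  refine ⟨1 / (2 * π * τ.im) + greenCoeff τ 0 1, fun m n => ?_⟩
  have h01 := greenCoeff_nonneg τ 0 1
  by_cases hm : m = 0
  · subst hm
    have : greenCoeff τ 0 n ≤ greenCoeff τ 0 1 := by
      by_cases hn : n = 0
      · subst hn; rw [greenCoeff_zero]; exact h01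
      · unfold greenCoeff
        have h1 : (1 : ℝ) ≤ |(n : ℝ)| := by exact_mod_cast Int.one_le_abs hn
        simp only [Int.cast_zero, zero_mul, zero_sub, norm_neg, Complex.norm_intCast, Int.cast_one,
          norm_one]
        gcongr
    have : 0 ≤ 1 / (2 * π * τ.im) := by positivity
    linarith
  · have h1 : (1 : ℝ) ≤ |(m : ℝ)| := by exact_mod_cast Int.one_le_abs hm
    have h2 : 1 ≤ (m : ℝ) ^ 2 := by rw [← sq_abs]; nlinarith
    have h3 : 2 * π * τ.im ≤ (greenCoeff τ m n)⁻¹ := by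
      rw [inv_greenCoeff, div_mul_eq_mul_div, le_div_iff₀ hy, mul_assoc]
      refine mul_le_mul_of_nonneg_left ?_ (by positivity)
      nlinarith [sq_nonneg (m * τ.re - n), sq_nonneg τ.im]
    have h4 := inv_anti₀ (by positivity) h3
    rw [inv_inv] at h4
    rw [one_div]
    linarith

lemma summable_greenCoeff_mul_heatWeight (τ : ℍ) {t : ℝ} (ht : 0 < t) :
    Summable fun p : ℤ × ℤ => greenCoeff τ p.1 p.2 * heatWeight τ t p := by
  obtain ⟨C, hC⟩ := greenCoeff_le τ
  refine Summable.of_nonneg_of_le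
    (fun p => mul_nonneg (greenCoeff_nonneg τ _ _) (heatWeight_pos τ t p).le)
    (fun p => ?_) ((summable_heatWeight τ ht).mul_left C)
  exact mul_le_mul_of_nonneg_right (hC _ _) (heatWeight_pos τ t p).le

/-- The heat kernel converges normally and λ is integrable, so the convolution is computed term by
term. -/
lemma hasSum_torusNeronHeat_integral (τ : ℍ) {t : ℝ} (ht : 0 < t) (P : Torus τ) :
    HasSum (fun p : ℤ × ℤ => ((greenCoeff τ p.1 p.2 * heatWeight τ t p : ℝ) : ℂ) *
      ((charOf τ p.1 p.2).1 P : ℂ))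
      (∫ Q, (torusNeron τ Q : ℂ) * heatKernel τ t (P - Q) ∂(haar τ)) := by
  have hcont : Continuous fun Q => heatKernel τ t (P - Q) :=
    (continuous_heatKernel τ ht).comp (continuous_const.sub continuous_id)
  have hmeas : Measurable fun Q => (torusNeron τ Q : ℂ) * heatKernel τ t (P - Q) :=
    (Complex.measurable_ofReal.comp (measurable_torusNeron τ)).mul
      (measurable_of_continuous_torus hcont)
  rw [integral_haar hmeas]
  obtain ⟨s, rfl⟩ := exists_torusPoint τ P
  have hsplit : ∀ (p : ℤ × ℤ) (r : ℝ × ℝ),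
      ((charOf τ p.1 p.2).1 (torusPoint τ s - torusPoint τ r) : ℂ) =
      ((charOf τ p.1 p.2).1 (torusPoint τ s) : ℂ) * expTwoPi (-(p.1 * r.1 + p.2 * r.2)) := by
    intro p r
    rw [← torusPoint_sub, charOf_torusPoint, charOf_torusPoint, ← expTwoPi_add]
    congr 1
    simp only [Prod.fst_sub, Prod.snd_sub]
    push_cast
    ring
  have h := (integrable_and_hasSum_integral (μ := squareMeasure)
    (F := fun (p : ℤ × ℤ) (r : ℝ × ℝ) => (heatWeight τ t p : ℂ) *
      ((charOf τ p.1 p.2).1 (torusPoint τ s) : ℂ) *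
        ((torusNeron τ (torusPoint τ r) : ℂ) * expTwoPi (-(p.1 * r.1 + p.2 * r.2))))
    (f := fun r => (torusNeron τ (torusPoint τ r) : ℂ) *
      heatKernel τ t (torusPoint τ s - torusPoint τ r)) ?_ ?_ ?_ ?_).2
  · refine h.congr_fun fun p => ?_
    rw [integral_const_mul, (integrable_and_integral_torusNeron τ p.1 p.2).2]
    push_cast
    ring
  · intro p
    exact (integrable_and_integral_torusNeron τ p.1 p.2).1.const_mul _
  · refine ((summable_heatWeight τ ht).mul_right
      (∫ r, ‖(torusNeron τ (torusPoint τ r) : ℂ)‖ ∂squareMeasure)).congr fun p => ?_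
    rw [← integral_const_mul]
    congr 1 with r
    rw [norm_mul, norm_heatWeight_mul, norm_mul, norm_expTwoPi]
    simp
  · exact (hmeas.comp (measurable_torusPoint τ)).aestronglyMeasurable
  · refine ae_of_all _ fun r => ?_
    rw [heatKernel_eq]
    have hs : Summable fun p : ℤ × ℤ => (heatWeight τ t p : ℂ) *
        ((charOf τ p.1 p.2).1 (torusPoint τ s - torusPoint τ r) : ℂ) :=
      Summable.of_norm ((summable_heatWeight τ ht).congr fun p =>
        (norm_heatWeight_mul τ t p _).symm)
    refine (hs.hasSum.mul_left (torusNeron τ (torusPoint τ r) : ℂ)).congr_fun fun p => ?_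
    rw [hsplit]
    ring

lemma hasSum_torusNeronHeat (τ : ℍ) {t : ℝ} (ht : 0 < t) (P : Torus τ) :
    HasSum (fun p : ℤ × ℤ => greenCoeff τ p.1 p.2 * heatWeight τ t p *
      ((charOf τ p.1 p.2).1 P : ℂ).re) (torusNeronHeat τ t P) := by
  have := Complex.hasSum_re (hasSum_torusNeronHeat_integral τ ht P)
  simp only [Complex.re_ofReal_mul] at this
  exact this

end EllipticDiscrepancy

end

/-! ### Positivity of the heat kernel and the comparison of λ with λ_t. -/

section

namespace EllipticDiscrepancy

variable {τ : ℍ}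

lemma one_div_cpow_half {a : ℝ} (ha : 0 < a) :
    (1 / (a : ℂ) ^ (1 / 2 : ℂ)) = ((1 / a ^ (1 / 2 : ℝ) : ℝ) : ℂ) := by
  rw [Complex.ofReal_div, Complex.ofReal_cpow ha.le]
  push_cast
  rfl

/-- Poisson summation for a shifted Gaussian. -/
lemma tsum_gaussian_mul_expTwoPi {a : ℝ} (ha : 0 < a) (x r : ℝ) :
    ∑' n : ℤ, (Real.exp (-π * a * (n - x) ^ 2) : ℂ) * expTwoPi (n * r) =
      ((1 / a ^ (1 / 2 : ℝ) : ℝ) : ℂ) *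
        ∑' k : ℤ, (Real.exp (-π / a * (k - r) ^ 2) : ℂ) * expTwoPi (-(x * (k - r))) := by
  have h := Complex.tsum_exp_neg_quadratic (a := a) (by simpa using ha) (a * x + Complex.I * r)
  rw [one_div_cpow_half ha] at h
  have e1 : ∀ n : ℤ, (Real.exp (-π * a * (n - x) ^ 2) : ℂ) * expTwoPi (n * r) =
      Complex.exp (-π * a * x ^ 2) * Complex.exp (-π * a * n ^ 2 +
        2 * π * (a * x + Complex.I * r) * n) := by
    intro n
    rw [expTwoPi, Complex.ofReal_exp, ← Complex.exp_add, ← Complex.exp_add]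
    push_cast
    ring_nf
  have ha' : (a : ℂ) ≠ 0 := by exact_mod_cast ha.ne'
  have e2 : ∀ k : ℤ, (Real.exp (-π / a * (k - r) ^ 2) : ℂ) * expTwoPi (-(x * (k - r))) =
      Complex.exp (-π * a * x ^ 2) *
        Complex.exp (-π / a * (k + Complex.I * (a * x + Complex.I * r)) ^ 2) := by
    intro k
    rw [expTwoPi, Complex.ofReal_exp, ← Complex.exp_add, ← Complex.exp_add]
    congr 1
    push_cast
    field_simp
    linear_combination (2 * a * x * r * Complex.I + 2 * k * r
      + r ^ 2 * (Complex.I ^ 2 - 1) + a ^ 2 * x ^ 2) * Complex.I_sq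
  simp_rw [e1, e2]
  rw [tsum_mul_left, tsum_mul_left, h]
  ring

lemma tsum_gaussian_mul_expTwoPi_eq_ofReal {b : ℝ} (hb : 0 < b) (θ : ℝ) :
    ∃ g : ℝ, 0 ≤ g ∧ ∑' m : ℤ, (Real.exp (-π * b * m ^ 2) : ℂ) * expTwoPi (m * θ) = g := by
  refine ⟨1 / b ^ (1 / 2 : ℝ) * ∑' k : ℤ, Real.exp (-π / b * (k - θ) ^ 2), ?_, ?_⟩
  · have : 0 ≤ ∑' k : ℤ, Real.exp (-π / b * (k - θ) ^ 2) := tsum_nonneg fun _ => (Real.exp_pos _).le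
    positivity
  · have := tsum_gaussian_mul_expTwoPi hb 0 θ
    simp only [Complex.ofReal_zero, sub_zero, zero_mul, neg_zero, expTwoPi_zero, mul_one] at this
    rw [this]
    push_cast
    rfl

/-- The heat kernel, damped in the first variable, is nonnegative. -/
lemma theta_nonneg (τ : ℍ) {s ε : ℝ} (hs : 0 < s) (hε : 0 ≤ ε) (r : ℝ × ℝ) :
    0 ≤ ∑' p : ℤ × ℤ, Real.exp (-π * ε * p.1 ^ 2) * heatWeight τ s p *
      (expTwoPi (p.1 * r.1 + p.2 * r.2)).re := by
  have hy := τ.im_pos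
  -- The heat weight is a Gaussian e^{-πa(n - m Re τ)²} in n times a Gaussian in m with parameter 2s
  -- Im τ, to which the damping adds ε.
  set a := 2 * s / τ.im with ha_def
  set b := 2 * s * τ.im + ε with hb_def
  have ha : 0 < a := by positivity
  have hb : 0 < b := by positivity
  have hw : ∀ m n : ℤ, Real.exp (-π * ε * m ^ 2) * heatWeight τ s (m, n) =
      Real.exp (-π * b * m ^ 2) * Real.exp (-π * a * (n - m * τ.re) ^ 2) := by
    intro m n
    rw [heatWeight, inv_greenCoeff, ← Real.exp_add, ← Real.exp_add]
    congr 1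
    simp only [ha_def, hb_def]
    field_simp
    ring
  have hsum : Summable fun p : ℤ × ℤ => ((Real.exp (-π * ε * p.1 ^ 2) * heatWeight τ s p : ℝ) : ℂ) *
      expTwoPi (p.1 * r.1 + p.2 * r.2) := by
    refine Summable.of_norm_bounded (summable_heatWeight τ hs) fun p => ?_
    have : ‖expTwoPi (p.1 * r.1 + p.2 * r.2)‖ = 1 := by simp [norm_expTwoPi]
    rw [norm_mul, this, mul_one, Complex.norm_real, Real.norm_of_nonneg
      (mul_nonneg (Real.exp_pos _).le (heatWeight_pos τ s p).le)]
    refine mul_le_of_le_one_left (heatWeight_pos τ s p).le (Real.exp_le_one_iff.mpr ?_)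
    have : 0 ≤ π * ε * (p.1 : ℝ) ^ 2 := by positivity
    linarith
  have hre : ∑' p : ℤ × ℤ, Real.exp (-π * ε * p.1 ^ 2) * heatWeight τ s p *
      (expTwoPi (p.1 * r.1 + p.2 * r.2)).re = (∑' p : ℤ × ℤ,
        ((Real.exp (-π * ε * p.1 ^ 2) * heatWeight τ s p : ℝ) : ℂ) *
          expTwoPi (p.1 * r.1 + p.2 * r.2)).re := by
    rw [Complex.re_tsum hsum]
    simp only [Complex.re_ofReal_mul]
  rw [hre, hsum.tsum_prod]
  have h1 : ∀ m : ℤ, ∑' n : ℤ, ((Real.exp (-π * ε * m ^ 2) * heatWeight τ s (m, n) : ℝ) : ℂ) *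
      expTwoPi (m * r.1 + n * r.2) = ∑' k : ℤ, ((1 / a ^ (1 / 2 : ℝ) : ℝ) : ℂ) *
        (Real.exp (-π / a * (k - r.2) ^ 2) : ℂ) * ((Real.exp (-π * b * m ^ 2) : ℂ) *
          expTwoPi (m * (r.1 - τ.re * (k - r.2) : ℝ))) := by
    intro m
    have e := tsum_gaussian_mul_expTwoPi ha (m * τ.re) r.2
    have e1 : ∀ n : ℤ, ((Real.exp (-π * ε * m ^ 2) * heatWeight τ s (m, n) : ℝ) : ℂ) *
        expTwoPi (m * r.1 + n * r.2) = (Real.exp (-π * b * m ^ 2) : ℂ) * expTwoPi (m * r.1) *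
          ((Real.exp (-π * a * (n - m * τ.re) ^ 2) : ℂ) * expTwoPi (n * r.2)) := fun n => by
      rw [hw, expTwoPi_add]
      push_cast
      ring
    have e2 : ∀ k : ℤ, expTwoPi (m * (r.1 - τ.re * (k - r.2) : ℝ)) =
        expTwoPi (m * r.1) * expTwoPi (-((m * τ.re : ℝ) * (k - r.2))) := fun k => by
      rw [← expTwoPi_add]
      push_cast
      ring_nf
    simp_rw [e1, e2]
    rw [tsum_mul_left, e, ← mul_assoc, ← tsum_mul_left]
    refine tsum_congr fun k => ?_
    ring
  simp_rw [h1]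
  -- After Poisson summation in n the remaining phase is linear in m. Exchanging the sums allows a
  -- second Poisson summation, now in m, which leaves only positive Gaussians.
  rw [Summable.tsum_comm]
  · have h2 : ∀ k : ℤ, ∃ g : ℝ, 0 ≤ g ∧ ∑' m : ℤ, ((1 / a ^ (1 / 2 : ℝ) : ℝ) : ℂ) *
        (Real.exp (-π / a * (k - r.2) ^ 2) : ℂ) * ((Real.exp (-π * b * m ^ 2) : ℂ) *
          expTwoPi (m * (r.1 - τ.re * (k - r.2) : ℝ))) = g := by
      intro k
      obtain ⟨g, hg, hg2⟩ := tsum_gaussian_mul_expTwoPi_eq_ofReal hb (r.1 - τ.re * (k - r.2))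
      refine ⟨1 / a ^ (1 / 2 : ℝ) * Real.exp (-π / a * (k - r.2) ^ 2) * g, by positivity, ?_⟩
      rw [tsum_mul_left, hg2]
      push_cast
      rfl
    choose g hg hg2 using h2
    simp_rw [hg2]
    rw [← Complex.ofReal_tsum, Complex.ofReal_re]
    exact tsum_nonneg hg
  · have s1 := summable_exp_neg_mul_int_sq hb
    have s2 := summable_exp_neg_mul_int_sub_sq (T := 1 / a) (by positivity) r.2
    have s3 := (s2.mul_of_nonneg s1 (fun _ => (Real.exp_pos _).le)
      (fun _ => (Real.exp_pos _).le)).mul_left (1 / a ^ (1 / 2 : ℝ))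
    refine Summable.of_norm (s3.congr ?_)
    rintro ⟨k, m⟩
    simp only [Function.uncurry_apply_pair]
    rw [norm_mul, norm_mul, norm_mul, norm_expTwoPi_int_mul_ofReal, Complex.norm_real,
      Complex.norm_real, Complex.norm_real, Real.norm_of_nonneg (by positivity),
      Real.norm_of_nonneg (Real.exp_pos _).le, Real.norm_of_nonneg (Real.exp_pos _).le]
    rw [show -π * (1 / a) = -π / a by ring]
    ring

/-- The coefficients of `λ - λ_t + t`. -/
def gapCoeff (τ : ℍ) (t : ℝ) (p : ℤ × ℤ) : ℝ :=
  (greenCoeff τ p.1 p.2 - greenCoeff τ p.1 p.2 * heatWeight τ t p) + if p = 0 then t else 0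

/-- For c = λ̂ ≠ 0 the integral of e^{-s/c} is c - ce^{-t/c}. At the trivial character the weight is
constantly 1, which produces the extra t. -/
lemma integral_heatWeight (τ : ℍ) {t : ℝ} (ht : 0 < t) (p : ℤ × ℤ) :
    ∫ s in Set.Ioc 0 t, heatWeight τ s p = gapCoeff τ t p := by
  rw [← intervalIntegral.integral_of_le ht.le]
  by_cases hp : p = 0
  · subst hp
    simp [heatWeight, gapCoeff, greenCoeff_zero]
  · have hp' : p.1 ≠ 0 ∨ p.2 ≠ 0 := by
      by_contra! h
      exact hp (Prod.ext h.1 h.2)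
    have hg := (greenCoeff_pos τ hp').ne'
    have e : ∀ s : ℝ, heatWeight τ s p = Real.exp (-(greenCoeff τ p.1 p.2)⁻¹ * s) := fun s => by
      rw [heatWeight]; ring_nf
    simp_rw [gapCoeff, e, hp, if_false]
    rw [intervalIntegral.integral_comp_mul_left _ (neg_ne_zero.mpr (inv_ne_zero hg)), integral_exp]
    simp only [mul_zero, Real.exp_zero, smul_eq_mul, inv_neg, inv_inv]
    ring

lemma gapCoeff_nonneg (τ : ℍ) {t : ℝ} (ht : 0 < t) (p : ℤ × ℤ) : 0 ≤ gapCoeff τ t p := by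
  rw [← integral_heatWeight τ ht]
  exact integral_nonneg fun s => (heatWeight_pos τ s p).le

/-- The row sum is the layer at s = 0, where the closed form bounds it uniformly in m. So damping in
m alone makes the double series absolutely convergent. -/
lemma exists_tsum_greenCoeff_le (τ : ℍ) : ∃ C, ∀ m, ∑' n, greenCoeff τ m n ≤ C := by
  have e : ∀ m, ∑' n, greenCoeff τ m n = ‖layer τ m 0‖ := fun m => by
    simp only [layer, Complex.ofReal_zero, mul_zero, expTwoPi_zero, mul_one]
    rw [← Complex.ofReal_tsum, Complex.norm_real, Real.norm_of_nonneg
      (tsum_nonneg fun n => greenCoeff_nonneg τ m n)]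
  have hy := τ.im_pos
  have hq1 : 0 < 1 - ‖expTwoPi τ‖ := by linarith [norm_expTwoPi_lt_one τ]
  have hk : ∀ k : ℕ, ‖layer τ k 0‖ ≤ 1 / (2 * (1 - ‖expTwoPi τ‖)) * 2 + ‖layer τ 0 0‖ := by
    intro k
    rcases Nat.eq_zero_or_pos k with rfl | hk
    · have : 0 ≤ 1 / (2 * (1 - ‖expTwoPi τ‖)) * 2 := by positivity
      simpa using this
    · refine (norm_layer_natCast_le τ hk.ne' ⟨le_rfl, zero_le_one⟩).trans ?_
      have hk1 : (1 : ℝ) ≤ k := by exact_mod_cast hk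
      have h1 : Real.exp (-(2 * π * τ.im * k) * (1 - 0)) ≤ 1 := by
        rw [Real.exp_le_one_iff]
        have : 0 < 2 * π * τ.im * k := by positivity
        linarith
      have h2 : (Real.exp (-(2 * π * τ.im * k) * 0) + Real.exp (-(2 * π * τ.im * k) * (1 - 0))) / k
          ≤ 2 := by
        refine (div_le_self (by positivity) hk1).trans ?_
        simp only [mul_zero, Real.exp_zero]
        linarith
      have := mul_le_mul_of_nonneg_left h2 (by positivity : 0 ≤ 1 / (2 * (1 - ‖expTwoPi τ‖)))
      linarith [norm_nonneg (layer τ 0 0)]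
  refine ⟨1 / (2 * (1 - ‖expTwoPi τ‖)) * 2 + ‖layer τ 0 0‖, fun m => ?_⟩
  rw [e]
  obtain ⟨k, rfl | rfl⟩ := m.eq_nat_or_neg
  · exact hk k
  · rw [norm_layer_neg]; exact hk k

lemma summable_damped_greenCoeff (τ : ℍ) {ε : ℝ} (hε : 0 < ε) :
    Summable fun p : ℤ × ℤ => Real.exp (-π * ε * p.1 ^ 2) * greenCoeff τ p.1 p.2 := by
  obtain ⟨C, hC⟩ := exists_tsum_greenCoeff_le τ
  have h0 : ∀ p : ℤ × ℤ, 0 ≤ Real.exp (-π * ε * p.1 ^ 2) * greenCoeff τ p.1 p.2 := fun p =>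
    mul_nonneg (Real.exp_pos _).le (greenCoeff_nonneg τ _ _)
  rw [summable_prod_of_nonneg h0]
  refine ⟨fun m => (summable_greenCoeff τ m).mul_left (Real.exp (-π * ε * m ^ 2)), ?_⟩
  refine Summable.of_nonneg_of_le (fun m => tsum_nonneg fun n => mul_nonneg (Real.exp_pos _).le
    (greenCoeff_nonneg τ _ _)) (fun m => ?_) ((summable_exp_neg_mul_int_sq hε).mul_right C)
  simp only
  rw [tsum_mul_left]
  exact mul_le_mul_of_nonneg_left (hC m) (Real.exp_pos _).le

lemma summable_damped_gapCoeff (τ : ℍ) {t ε : ℝ} (ht : 0 < t) (hε : 0 < ε) :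
    Summable fun p : ℤ × ℤ => Real.exp (-π * ε * p.1 ^ 2) * gapCoeff τ t p := by
  have h1 : Summable fun p : ℤ × ℤ => if p = 0 then t else (0 : ℝ) := (hasSum_ite_eq 0 t).summable
  refine Summable.of_nonneg_of_le (fun p => mul_nonneg (Real.exp_pos _).le
    (gapCoeff_nonneg τ ht p)) (fun p => ?_) ((summable_damped_greenCoeff τ hε).add h1)
  have h2 := mul_nonneg (greenCoeff_nonneg τ p.1 p.2) (heatWeight_pos τ t p).le
  have h3 : 0 ≤ if p = 0 then t else (0 : ℝ) := by split_ifs <;> linarith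
  have h4 : Real.exp (-π * ε * p.1 ^ 2) ≤ 1 := by
    rw [Real.exp_le_one_iff]
    have : 0 ≤ π * ε * (p.1 : ℝ) ^ 2 := by positivity
    linarith
  have h5 := (Real.exp_pos (-π * ε * p.1 ^ 2))
  rw [gapCoeff]
  nlinarith [mul_nonneg h5.le h2]

/-- The sum is the integral over 0 < s ≤ t of the nonnegative damped heat kernels; damping
legitimizes the termwise integration. -/
lemma damped_gap_nonneg (τ : ℍ) {t ε : ℝ} (ht : 0 < t) (hε : 0 < ε) (r : ℝ × ℝ) :
    0 ≤ ∑' p : ℤ × ℤ, Real.exp (-π * ε * p.1 ^ 2) * gapCoeff τ t p *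
      (expTwoPi (p.1 * r.1 + p.2 * r.2)).re := by
  have hcont : ∀ p, Continuous fun s => heatWeight τ s p := fun p => by
    unfold heatWeight; fun_prop
  have hint : ∀ p, IntegrableOn (fun s => heatWeight τ s p) (Set.Ioc 0 t) := fun p =>
    ((hcont p).integrableOn_Icc (a := 0) (b := t)).mono_set Set.Ioc_subset_Icc_self
  have h := hasSum_integral_of_summable_integral_norm (μ := volume.restrict (Set.Ioc 0 t))
    (F := fun (p : ℤ × ℤ) (s : ℝ) => Real.exp (-π * ε * p.1 ^ 2) * heatWeight τ s p *
      (expTwoPi (p.1 * r.1 + p.2 * r.2)).re)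
    (fun p => ((hint p).const_mul _).mul_const _) ?_
  · have e : ∀ p : ℤ × ℤ, ∫ s in Set.Ioc 0 t, Real.exp (-π * ε * p.1 ^ 2) * heatWeight τ s p *
        (expTwoPi (p.1 * r.1 + p.2 * r.2)).re = Real.exp (-π * ε * p.1 ^ 2) * gapCoeff τ t p *
        (expTwoPi (p.1 * r.1 + p.2 * r.2)).re := fun p => by
      rw [integral_mul_const, integral_const_mul, integral_heatWeight τ ht]
    simp_rw [e] at h
    rw [h.tsum_eq]
    exact setIntegral_nonneg measurableSet_Ioc fun s hs => theta_nonneg τ hs.1 hε.le r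
  · refine Summable.of_nonneg_of_le (fun p => integral_nonneg fun _ => norm_nonneg _)
      (fun p => ?_) (summable_damped_gapCoeff τ ht hε)
    rw [← integral_heatWeight τ ht, ← integral_const_mul]
    refine integral_mono (((hint p).const_mul _).mul_const _).norm ((hint p).const_mul _)
      fun s => ?_
    have h1 : |(expTwoPi (p.1 * r.1 + p.2 * r.2)).re| ≤ 1 :=
      (Complex.abs_re_le_norm _).trans (by simp [norm_expTwoPi])
    have h2 := (heatWeight_pos τ s p)
    simp only
    rw [Real.norm_eq_abs, abs_mul, abs_of_pos (by positivity)]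
    exact mul_le_of_le_one_right (by positivity) h1

/-- Summed over n first, λ - λ_t + t becomes a series in m which converges absolutely because 0 < r₂
< 1. Dominated convergence as ε → 0 then removes the damping from the nonnegative sums. -/
lemma torusNeronHeat_sub_le_of_pos (τ : ℍ) {t : ℝ} (ht : 0 < t) {r : ℝ × ℝ} (h0 : 0 < r.2)
    (h1 : r.2 < 1) :
    torusNeronHeat τ t (torusPoint τ r) - t ≤ torusNeron τ (torusPoint τ r) := by
  -- the coefficients of the expansion in the first variable
  set heatTerm : ℤ × ℤ → ℂ := fun p => ((greenCoeff τ p.1 p.2 * heatWeight τ t p : ℝ) : ℂ) *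
    expTwoPi (p.1 * r.1 + p.2 * r.2) with hheat
  have hunit : ∀ p : ℤ × ℤ, ‖expTwoPi (p.1 * r.1 + p.2 * r.2)‖ = 1 := fun p => by
    simp [norm_expTwoPi]
  have hheatn : Summable fun p => ‖heatTerm p‖ := by
    refine (summable_greenCoeff_mul_heatWeight τ ht).congr fun p => ?_
    rw [hheat, norm_mul, hunit, mul_one, Complex.norm_real, Real.norm_of_nonneg
      (mul_nonneg (greenCoeff_nonneg τ _ _) (heatWeight_pos τ t p).le)]
  set b : ℤ → ℂ := fun m => layer τ m r.2 * expTwoPi (m * r.1) - ∑' n, heatTerm (m, n) +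
    if m = 0 then (t : ℂ) else 0 with hb
  have hbn : Summable fun m => ‖b m‖ := by
    have s1 : Summable fun m : ℤ => ‖layer τ m r.2 * expTwoPi (m * r.1)‖ :=
      (summable_norm_layer τ h0 h1).congr fun m => by
        rw [norm_mul, norm_expTwoPi_int_mul_ofReal, mul_one]
    have s2 : Summable fun m : ℤ => ‖∑' n, heatTerm (m, n)‖ :=
      Summable.of_nonneg_of_le (fun _ => norm_nonneg _)
        (fun m => norm_tsum_le_tsum_norm (hheatn.prod_factor m)) hheatn.prod
    have s3 : Summable fun m : ℤ => if m = 0 then t else (0 : ℝ) := (hasSum_ite_eq 0 t).summable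
    refine Summable.of_nonneg_of_le (fun _ => norm_nonneg _) (fun m => ?_) ((s1.add s2).add s3)
    refine (norm_add_le _ _).trans (add_le_add (norm_sub_le _ _) (le_of_eq ?_))
    split_ifs
    · rw [Complex.norm_real, Real.norm_of_nonneg ht.le]
    · simp
  have hbsum : HasSum b ((torusNeron τ (torusPoint τ r) : ℂ) - ∑' p, heatTerm p + t) := by
    rw [torusNeron_torusPoint h0 h1]
    exact ((hasSum_layer τ r.1 h0 h1).sub (hheatn.of_norm.hasSum.prod_fiberwise
      fun m => (hheatn.of_norm.prod_factor m).hasSum)).add (hasSum_ite_eq 0 (t : ℂ))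
  have hheatre : torusNeronHeat τ t (torusPoint τ r) = (∑' p, heatTerm p).re := by
    rw [← (hasSum_torusNeronHeat τ ht (torusPoint τ r)).tsum_eq, Complex.re_tsum hheatn.of_norm]
    refine tsum_congr fun p => ?_
    rw [charOf_torusPoint, hheat, Complex.re_ofReal_mul]
  have hlim : Tendsto (fun ε : ℝ => ∑' m : ℤ, (Real.exp (-π * ε * m ^ 2) : ℂ) * b m) (𝓝[>] 0)
      (𝓝 (∑' m, b m)) := by
    refine tendsto_tsum_of_dominated_convergence hbn (fun m => ?_) ?_
    · have : Tendsto (fun ε : ℝ => (Real.exp (-π * ε * m ^ 2) : ℂ) * b m) (𝓝 0)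
          (𝓝 ((Real.exp (-π * 0 * m ^ 2) : ℂ) * b m)) := Continuous.tendsto (by fun_prop) 0
      simpa using this.mono_left nhdsWithin_le_nhds
    · filter_upwards [self_mem_nhdsWithin] with ε hε m
      rw [norm_mul, Complex.norm_real, Real.norm_of_nonneg (Real.exp_pos _).le]
      refine mul_le_of_le_one_left (norm_nonneg _) (Real.exp_le_one_iff.mpr ?_)
      have : 0 ≤ π * ε * (m : ℝ) ^ 2 := by
        have : (0 : ℝ) < ε := hε
        positivity
      linarith
  have hnonneg : ∀ᶠ ε : ℝ in 𝓝[>] 0, 0 ≤ (∑' m : ℤ, (Real.exp (-π * ε * m ^ 2) : ℂ) * b m).re := by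
    filter_upwards [self_mem_nhdsWithin] with ε hε
    have hε' : (0 : ℝ) < ε := hε
    have hs : Summable fun p : ℤ × ℤ => ((Real.exp (-π * ε * p.1 ^ 2) * gapCoeff τ t p : ℝ) : ℂ) *
        expTwoPi (p.1 * r.1 + p.2 * r.2) := by
      refine Summable.of_norm ((summable_damped_gapCoeff τ ht hε').congr fun p => ?_)
      rw [norm_mul, hunit, mul_one, Complex.norm_real, Real.norm_of_nonneg
        (mul_nonneg (Real.exp_pos _).le (gapCoeff_nonneg τ ht p))]
    have hrow : ∀ m : ℤ, HasSum (fun n : ℤ => ((Real.exp (-π * ε * m ^ 2) *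
        gapCoeff τ t (m, n) : ℝ) : ℂ) * expTwoPi (m * r.1 + n * r.2))
        ((Real.exp (-π * ε * m ^ 2) : ℂ) * b m) := by
      intro m
      have d1 := (summable_layer τ m r.2).hasSum.mul_right (expTwoPi (m * r.1))
      have d2 := (hheatn.of_norm.prod_factor m).hasSum
      have d3 : HasSum (fun n : ℤ => if n = 0 then (if m = 0 then (t : ℂ) else 0) else 0)
          (if m = 0 then (t : ℂ) else 0) := hasSum_ite_eq 0 _
      refine (((d1.sub d2).add d3).mul_left (Real.exp (-π * ε * m ^ 2) : ℂ)).congr_fun fun n => ?_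
      simp only [gapCoeff, hheat, Prod.mk_eq_zero]
      rw [expTwoPi_add]
      by_cases hm : m = 0
      · by_cases hn : n = 0
        · subst hm hn
          simp
        · simp [hm, hn]
          ring
      · simp [hm]
        ring
    have := damped_gap_nonneg τ ht hε' r
    have hre := Complex.re_tsum hs
    simp only [Complex.re_ofReal_mul] at hre
    rw [← hre] at this
    rwa [(hs.hasSum.prod_fiberwise hrow).tsum_eq]
  have hfin := ge_of_tendsto (Complex.continuous_re.continuousAt.tendsto.comp hlim) hnonneg
  rw [hbsum.tsum_eq] at hfin
  simp only [Complex.add_re, Complex.sub_re, Complex.ofReal_re] at hfin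
  rw [hheatre]
  linarith

lemma continuous_torusNeronHeat (τ : ℍ) {t : ℝ} (ht : 0 < t) :
    Continuous (torusNeronHeat τ t) := by
  rw [show torusNeronHeat τ t = _ from funext fun P => (hasSum_torusNeronHeat τ ht P).tsum_eq.symm]
  refine continuous_tsum (fun p => continuous_const.mul
    (Complex.continuous_re.comp (continuous_dual_coe _)))
    (summable_greenCoeff_mul_heatWeight τ ht) ?_
  intro p P
  rw [norm_mul, Real.norm_of_nonneg
    (mul_nonneg (greenCoeff_nonneg τ _ _) (heatWeight_pos τ t p).le)]
  refine mul_le_of_le_one_right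
    (mul_nonneg (greenCoeff_nonneg τ _ _) (heatWeight_pos τ t p).le) ?_
  exact (Complex.abs_re_le_norm _).trans (Circle.norm_coe _).le

/-- The Néron function dominates its smoothing up to the time parameter. -/
theorem torusNeronHeat_sub_le (τ : ℍ) {t : ℝ} (ht : 0 < t) {P : Torus τ} (hP : P ≠ 0) :
    torusNeronHeat τ t P - t ≤ torusNeron τ P := by
  obtain ⟨z, rfl⟩ := QuotientAddGroup.mk_surjective P
  have hy := τ.im_pos
  obtain ⟨l, hl, hl0, hl1⟩ := exists_add_mem_strip τ z
  have hzl : ((z + l : ℂ) : Torus τ) = (z : Torus τ) := by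
    rw [QuotientAddGroup.mk_add, (QuotientAddGroup.eq_zero_iff l).mpr hl, add_zero]
  rw [← hzl] at hP ⊢
  set w := z + l
  have hw : w ∉ lattice τ := fun h => hP ((QuotientAddGroup.eq_zero_iff w).mpr h)
  obtain ⟨r, hr⟩ : ∃ r : ℝ × ℝ, (r.1 + r.2 * τ : ℂ) = w := by
    refine ⟨(w.re - w.im / τ.im * τ.re, w.im / τ.im), ?_⟩
    apply Complex.ext
    · simp
    · simp [hy.ne']
  have hr2 : w.im = r.2 * τ.im := by rw [← hr]; simp
  rw [hr2] at hl0 hl1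
  have h0 : 0 ≤ r.2 := nonneg_of_mul_nonneg_left hl0 hy
  have h1 : r.2 < 1 := by nlinarith
  -- The edge r₂ = 0 is reached by moving slightly into the strip: both sides are continuous at w,
  -- which is off the lattice.
  have hpath : Tendsto (fun h : ℝ => (r.1 + (r.2 + h : ℝ) * τ : ℂ)) (𝓝[>] 0) (𝓝 w) := by
    have : Tendsto (fun h : ℝ => (r.1 + (r.2 + h : ℝ) * τ : ℂ)) (𝓝 0)
        (𝓝 (r.1 + (r.2 + 0 : ℝ) * τ : ℂ)) := Continuous.tendsto (by fun_prop) 0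
    rw [add_zero, hr] at this
    exact this.mono_left nhdsWithin_le_nhds
  have t1 := (torusNeron_comp_coe_continuousAt hw).tendsto.comp hpath
  have t2 := ((continuous_torusNeronHeat τ ht).comp
    (QuotientAddGroup.continuous_mk (N := lattice τ))).continuousAt.tendsto.comp hpath
  refine le_of_tendsto_of_tendsto (t2.sub_const t) t1 ?_
  filter_upwards [Ioo_mem_nhdsGT (show (0 : ℝ) < 1 - r.2 by linarith)] with h hh
  exact torusNeronHeat_sub_le_of_pos τ ht (r := (r.1, r.2 + h)) (by simp; linarith [hh.1])
    (by simp; linarith [hh.2])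

end EllipticDiscrepancy

end

/-! ### The upper bound for λ_{1/N} at the origin. -/

section

open scoped MatrixGroups

namespace EllipticDiscrepancy

variable {τ : ℍ}

/-- Both Im τ and |mτ - n|² acquire the factor |cτ + d|⁻², up to a unimodular change of (m, n).
Hence the value at the origin, a sum over all (m, n), is modular invariant. -/
lemma greenCoeff_smul (γ : SL(2, ℤ)) (τ : ℍ) (m n : ℤ) :
    greenCoeff (γ • τ) m n = greenCoeff τ (m * γ 0 0 - n * γ 1 0) (n * γ 1 1 - m * γ 0 1) := by
  have hd : ((γ 1 0 : ℂ) * τ + γ 1 1) ≠ 0 := by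
    rw [← ModularGroup.denom_apply]
    exact UpperHalfPlane.denom_ne_zero _ _
  have hc : ((γ • τ : ℍ) : ℂ) = (γ 0 0 * τ + γ 0 1) / (γ 1 0 * τ + γ 1 1) := by
    rw [UpperHalfPlane.coe_specialLinearGroup_apply]
    simp
  have e : (m * ((γ • τ : ℍ) : ℂ) - n : ℂ) = (((m * γ 0 0 - n * γ 1 0 : ℤ) : ℂ) * τ -
      ((n * γ 1 1 - m * γ 0 1 : ℤ) : ℂ)) / (γ 1 0 * τ + γ 1 1) := by
    rw [hc, eq_div_iff hd, sub_mul, mul_assoc, div_mul_cancel₀ _ hd]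
    push_cast
    ring
  rw [greenCoeff, greenCoeff, e, ModularGroup.im_smul_eq_div_normSq, ModularGroup.denom_apply,
    Complex.normSq_eq_norm_sq, norm_div, div_pow]
  have := norm_ne_zero_iff.mpr hd
  by_cases h0 : ‖(((m * γ 0 0 - n * γ 1 0 : ℤ) : ℂ) * τ - ((n * γ 1 1 - m * γ 0 1 : ℤ) : ℂ))‖ = 0
  · rw [h0]; simp
  · field_simp

/-- The action of a unimodular matrix on the characters of the torus. -/
def charEquiv (γ : SL(2, ℤ)) : ℤ × ℤ ≃ ℤ × ℤ where
  toFun p := (p.1 * γ 0 0 - p.2 * γ 1 0, p.2 * γ 1 1 - p.1 * γ 0 1)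
  invFun p := (p.1 * γ 1 1 + p.2 * γ 1 0, p.1 * γ 0 1 + p.2 * γ 0 0)
  left_inv p := by
    have h := Matrix.SpecialLinearGroup.det_coe γ
    rw [Matrix.det_fin_two] at h
    ext
    · simp only; linear_combination p.1 * h
    · simp only; linear_combination p.2 * h
  right_inv p := by
    have h := Matrix.SpecialLinearGroup.det_coe γ
    rw [Matrix.det_fin_two] at h
    ext
    · simp only; linear_combination p.1 * h
    · simp only; linear_combination p.2 * h

/-- The value at the origin of the smoothed Néron function. -/
def heatAtZero (τ : ℍ) (t : ℝ) : ℝ := ∑' p : ℤ × ℤ, greenCoeff τ p.1 p.2 * heatWeight τ t p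

lemma heatAtZero_smul (γ : SL(2, ℤ)) (τ : ℍ) (t : ℝ) :
    heatAtZero (γ • τ) t = heatAtZero τ t := by
  rw [heatAtZero, heatAtZero, 
    ← (charEquiv γ).tsum_eq fun p => greenCoeff τ p.1 p.2 * heatWeight τ t p]
  refine tsum_congr fun p => ?_
  simp only [heatWeight, greenCoeff_smul]
  rfl

lemma torusNeronHeat_zero (τ : ℍ) {t : ℝ} (ht : 0 < t) :
    torusNeronHeat τ t 0 = heatAtZero τ t := by
  rw [← (hasSum_torusNeronHeat τ ht 0).tsum_eq, heatAtZero]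
  refine tsum_congr fun p => ?_
  rw [AddChar.map_zero_eq_one]
  simp

/-- Since e^{-y} ≤ 1/(1+y), the term is at most the value at k + 2 of 1/(x(1 + sx²)), and -½log(1 +
1/(sx²)) is a primitive of this function. The comparison with its increment comes from log(1+x) ≥
2x/(x+2), and it telescopes. -/
lemma one_div_mul_le_log_sub_log {s : ℝ} (hs : 0 < s) (k : ℕ) :
    1 / (k + 2) * Real.exp (-s * (k + 2) ^ 2) ≤
      Real.log (1 + 1 / (s * (k + 1) ^ 2)) / 2 - Real.log (1 + 1 / (s * (k + 2) ^ 2)) / 2 := by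
  have hk : (0 : ℝ) ≤ k := k.cast_nonneg
  have h1 : Real.exp (-s * (k + 2) ^ 2) ≤ 1 / (1 + s * (k + 2) ^ 2) := by
    rw [neg_mul, Real.exp_neg, one_div]
    refine inv_anti₀ (by positivity) ?_
    linarith [Real.add_one_le_exp (s * ((k : ℝ) + 2) ^ 2)]
  have h2 : 1 + 1 / (s * ((k : ℝ) + 1) ^ 2) = (1 + 1 / (s * ((k : ℝ) + 2) ^ 2)) *
      (1 + (2 * k + 3) / ((k + 1) ^ 2 * (1 + s * (k + 2) ^ 2))) := by
    field_simp
    ring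
  have h3 := Real.le_log_one_add_of_nonneg
    (x := (2 * k + 3) / ((k + 1) ^ 2 * (1 + s * (k + 2) ^ 2))) (by positivity)
  rw [h2, Real.log_mul (by positivity) (by positivity)]
  have h4 : 2 * (1 / (k + 2) * (1 / (1 + s * (k + 2) ^ 2))) ≤
      2 * ((2 * k + 3) / ((k + 1) ^ 2 * (1 + s * (k + 2) ^ 2))) /
        ((2 * k + 3) / ((k + 1) ^ 2 * (1 + s * (k + 2) ^ 2)) + 2) := by
    have e : 2 * ((2 * k + 3) / ((k + 1) ^ 2 * (1 + s * (k + 2) ^ 2))) /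
        ((2 * k + 3) / ((k + 1) ^ 2 * (1 + s * (k + 2) ^ 2)) + 2) =
        2 * (2 * k + 3) / (2 * k + 3 + 2 * ((k + 1) ^ 2 * (1 + s * (k + 2) ^ 2))) := by
      field_simp
    have e' : 2 * (1 / ((k : ℝ) + 2) * (1 / (1 + s * (k + 2) ^ 2))) =
        2 / ((k + 2) * (1 + s * (k + 2) ^ 2)) := by field_simp
    rw [e, e', div_le_div_iff₀ (by positivity) (by positivity)]
    have : 0 ≤ s * ((k : ℝ) + 2) ^ 2 := by positivity
    nlinarith [mul_nonneg hk this, mul_nonneg hk hk]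
  have h5 : 1 / ((k : ℝ) + 2) * Real.exp (-s * (k + 2) ^ 2) ≤
      1 / (k + 2) * (1 / (1 + s * (k + 2) ^ 2)) := by gcongr
  linarith

lemma sum_one_div_mul_exp_le {s : ℝ} (hs : 0 < s) (K : ℕ) :
    ∑ k ∈ Finset.range K, 1 / ((k : ℝ) + 1) * Real.exp (-s * (k + 1) ^ 2) ≤
      1 + Real.log (1 + 1 / s) / 2 := by
  have hpos : ∀ x : ℝ, 0 ≤ Real.log (1 + 1 / (s * x ^ 2)) := fun x =>
    Real.log_nonneg (by have : 0 ≤ 1 / (s * x ^ 2) := by positivity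
                        linarith)
  rcases K with _ | K
  · have := hpos 1
    simp only [one_pow, mul_one] at this
    simp only [Finset.range_zero, Finset.sum_empty]
    linarith
  have key : ∑ k ∈ Finset.range (K + 1), 1 / ((k : ℝ) + 1) * Real.exp (-s * (k + 1) ^ 2) ≤
      1 + Real.log (1 + 1 / s) / 2 - Real.log (1 + 1 / (s * (K + 1) ^ 2)) / 2 := by
    induction K with
    | zero =>
      have : Real.exp (-s) ≤ 1 := by rw [Real.exp_le_one_iff]; linarith
      simpa using this
    | succ K ih =>
      rw [Finset.sum_range_succ]
      have := one_div_mul_le_log_sub_log hs K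
      push_cast
      rw [show (K : ℝ) + 1 + 1 = K + 2 by ring]
      linarith
  have := hpos (K + 1)
  linarith

lemma tsum_greenCoeff_zero (τ : ℍ) : ∑' n, greenCoeff τ 0 n = π * τ.im / 6 := by
  have h := layer_zero τ (s := 0) ⟨le_rfl, zero_le_one⟩
  simp only [layer, Complex.ofReal_zero, mul_zero, expTwoPi_zero, mul_one] at h
  rw [← Complex.ofReal_tsum] at h
  have h2 : ∑' n, greenCoeff τ 0 n = π * τ.im * bernoulliTwo 0 := by exact_mod_cast h
  rw [h2, bernoulliTwo]
  ring

/-- The closed form at s = 0 has real part Re(1 + 2Q/(1 - Q))/(2k) with Q = q^k, and |1 - Q| ≥ 1 -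
|q|. -/
lemma tsum_greenCoeff_le (τ : ℍ) {k : ℕ} (hk : k ≠ 0) : ∑' n, greenCoeff τ k n ≤
    1 / (2 * k) * (1 + 2 * ‖expTwoPi τ‖ ^ k / (1 - ‖expTwoPi τ‖)) := by
  have h := layer_natCast τ hk (s := 0) ⟨le_rfl, zero_le_one⟩
  have hd := one_sub_expTwoPi_natCast_mul_ne_zero τ hk
  have hq := norm_expTwoPi_lt_one τ
  simp only [layer, Complex.ofReal_zero, mul_zero, expTwoPi_zero, mul_one] at h
  rw [← Complex.ofReal_tsum] at h
  have h2 : ∑' n, greenCoeff τ k n = (layerClosed τ k 0).re := by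
    rw [← h, Complex.ofReal_re]
  rw [h2, layerClosed]
  have e1 : (1 / (2 * k) : ℂ) = ((1 / (2 * k) : ℝ) : ℂ) := by push_cast; rfl
  simp only [Complex.ofReal_zero, mul_zero, expTwoPi_zero, sub_zero, mul_one]
  rw [e1, Complex.re_ofReal_mul, Complex.add_re, Complex.conj_re, ← Complex.add_re]
  refine mul_le_mul_of_nonneg_left ?_ (by positivity)
  have e2 : 1 / (1 - expTwoPi (k * τ)) + expTwoPi (k * τ) / (1 - expTwoPi (k * τ)) =
      1 + 2 * expTwoPi (k * τ) / (1 - expTwoPi (k * τ)) := by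
    field_simp
    ring
  rw [e2, Complex.add_re, Complex.one_re]
  refine add_le_add_right ((Complex.re_le_norm _).trans ?_) 1
  have h3 := norm_one_sub_pow_ge hq hk
  have hq1 : 0 < 1 - ‖expTwoPi τ‖ := by linarith
  rw [expTwoPi_natCast_mul, norm_div, norm_mul, norm_pow, Complex.norm_ofNat]
  gcongr

lemma heatWeight_le (τ : ℍ) {t : ℝ} (ht : 0 < t) (m n : ℤ) :
    heatWeight τ t (m, n) ≤ Real.exp (-(2 * π * τ.im * t) * m ^ 2) := by
  have hy := τ.im_pos
  rw [heatWeight, inv_greenCoeff, Real.exp_le_exp]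
  have e : 2 * π / τ.im * ((m * τ.re - n) ^ 2 + m ^ 2 * τ.im ^ 2) =
      2 * π / τ.im * (m * τ.re - n) ^ 2 + 2 * π * τ.im * m ^ 2 := by
    field_simp
  have h : 0 ≤ t * (2 * π / τ.im * (m * τ.re - n) ^ 2) := by positivity
  simp only
  rw [e]
  linarith

/-- The weights in row m are at most e^{-sm²}, with s = 2πt Im τ. Row 0 is then controlled by B₂(0)
= 1/6, the main parts e^{-sk²}/k of the rows ±k by the logarithmic estimate, and their q-corrections
by a geometric series. -/
lemma heatAtZero_le (τ : ℍ) {t : ℝ} (ht : 0 < t) : heatAtZero τ t ≤ π * τ.im / 6 + 1 +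
    Real.log (1 + 1 / (2 * π * τ.im * t)) / 2 + 2 * ‖expTwoPi τ‖ / (1 - ‖expTwoPi τ‖) ^ 2 := by
  have hy := τ.im_pos
  have hq := norm_expTwoPi_lt_one τ
  have hq0 := norm_nonneg (expTwoPi τ)
  set ρ := ‖expTwoPi τ‖ with hρ
  have hq1 : 0 < 1 - ρ := by linarith
  set s := 2 * π * τ.im * t with hs
  have hs0 : 0 < s := by positivity
  have hsum := summable_greenCoeff_mul_heatWeight τ ht
  set R : ℤ → ℝ := fun m => ∑' n, greenCoeff τ m n * heatWeight τ t (m, n) with hR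
  have hRsum : Summable R := hsum.prod
  have hR0 : ∀ m, 0 ≤ R m := fun m => tsum_nonneg fun n =>
    mul_nonneg (greenCoeff_nonneg τ _ _) (heatWeight_pos τ t _).le
  have hneg : ∀ m, R (-m) = R m := by
    intro m
    simp only [hR]
    rw [← (Equiv.neg ℤ).tsum_eq fun n => greenCoeff τ (-m) n * heatWeight τ t (-m, n)]
    simp only [heatWeight, Equiv.neg_apply, greenCoeff_neg]
  have hle : ∀ m : ℤ, R m ≤ Real.exp (-s * m ^ 2) * ∑' n, greenCoeff τ m n := by
    intro m
    rw [← tsum_mul_left]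
    refine Summable.tsum_le_tsum (fun n => ?_) (hsum.prod_factor m)
      ((summable_greenCoeff τ m).mul_left _)
    rw [mul_comm]
    exact mul_le_mul_of_nonneg_right (heatWeight_le τ ht m n) (greenCoeff_nonneg τ m n)
  have h0 : R 0 ≤ π * τ.im / 6 := by
    have := hle 0
    rw [tsum_greenCoeff_zero] at this
    simpa using this
  have hk : ∀ k : ℕ, 2 * R (k + 1 : ℕ) ≤ 1 / ((k : ℝ) + 1) * Real.exp (-s * (k + 1) ^ 2) +
      2 * ρ / (1 - ρ) * ρ ^ k := by
    intro k
    have h1 := hle (k + 1 : ℕ)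
    have h2 := tsum_greenCoeff_le τ (k := k + 1) (Nat.succ_ne_zero k)
    have h3 := mul_le_mul_of_nonneg_left h2 (Real.exp_pos (-s * ((k + 1 : ℕ) : ℤ) ^ 2)).le
    have h4 : Real.exp (-s * (k + 1) ^ 2) ≤ 1 := by
      rw [Real.exp_le_one_iff]
      have : 0 ≤ s * ((k : ℝ) + 1) ^ 2 := by positivity
      linarith
    have h5 : 1 / ((k : ℝ) + 1) ≤ 1 := by
      rw [div_le_one (by positivity)]
      linarith [(k.cast_nonneg : (0 : ℝ) ≤ k)]
    have h6 : 1 / ((k : ℝ) + 1) * Real.exp (-s * (k + 1) ^ 2) ≤ 1 :=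
      mul_le_one₀ h5 (Real.exp_pos _).le h4
    have h7 : 0 ≤ 2 * ρ ^ (k + 1) / (1 - ρ) := by positivity
    have h8 := mul_le_mul_of_nonneg_right h6 h7
    push_cast at h1 h3 ⊢
    rw [← hρ] at h3
    have e1 : 2 * (Real.exp (-s * (k + 1) ^ 2) * (1 / (2 * (k + 1)) *
        (1 + 2 * ρ ^ (k + 1) / (1 - ρ)))) = 1 / ((k : ℝ) + 1) * Real.exp (-s * (k + 1) ^ 2) +
        1 / ((k : ℝ) + 1) * Real.exp (-s * (k + 1) ^ 2) * (2 * ρ ^ (k + 1) / (1 - ρ)) := by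
      field_simp
    have e2 : 1 * (2 * ρ ^ (k + 1) / (1 - ρ)) = 2 * ρ / (1 - ρ) * ρ ^ k := by ring
    linarith
  have hnatR : Summable fun k : ℕ => R k := hRsum.comp_injective Nat.cast_injective
  have hZ := HasSum.of_nat_of_neg (f := R) hnatR.hasSum
    (by simpa only [hneg] using hnatR.hasSum)
  have hS : heatAtZero τ t = R 0 + ∑' k : ℕ, 2 * R (k + 1 : ℕ) := by
    rw [heatAtZero, hsum.tsum_prod]
    change ∑' m, R m = _
    rw [hZ.tsum_eq, hnatR.tsum_eq_zero_add, tsum_mul_left]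
    push_cast
    ring
  have htail : ∑' k : ℕ, 2 * R (k + 1 : ℕ) ≤
      1 + Real.log (1 + 1 / s) / 2 + 2 * ρ / (1 - ρ) ^ 2 := by
    refine Real.tsum_le_of_sum_range_le (fun k => mul_nonneg zero_le_two (hR0 _)) fun K => ?_
    refine (Finset.sum_le_sum fun k _ => hk k).trans ?_
    rw [Finset.sum_add_distrib, ← Finset.mul_sum]
    refine add_le_add (sum_one_div_mul_exp_le hs0 K) ?_
    have := (summable_geometric_of_lt_one hq0 hq).sum_le_tsum (Finset.range K)
      (fun _ _ => by positivity)
    rw [tsum_geometric_of_lt_one hq0 hq] at this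
    calc 2 * ρ / (1 - ρ) * ∑ k ∈ Finset.range K, ρ ^ k ≤ 2 * ρ / (1 - ρ) * (1 - ρ)⁻¹ := by gcongr
      _ = _ := by field_simp
  rw [hS]
  linarith

/-- For Im τ ≤ 2 the left side is at most π/3 < 1.048. For Im τ ≥ 2 it follows from |j| ≥ e^{2π Im
τ}/1000, as (log 1000)/12 ≤ 7/12. -/
lemma im_div_le_log_jFunction (τ : ℍ) :
    π * τ.im / 6 ≤ 1 / 12 * Real.posLog ‖jFunction τ‖ + 1.048 := by
  have hpos : 0 ≤ Real.posLog ‖jFunction τ‖ := Real.posLog_nonneg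
  have hπ := Real.pi_lt_d6
  have hy := τ.im_pos
  rcases le_total τ.im 2 with h | h
  · nlinarith
  · have h1 := exp_le_norm_jFunction h
    have h2 := Real.log_le_log (by positivity) h1
    rw [Real.log_div (Real.exp_pos _).ne' (by norm_num), Real.log_exp] at h2
    have h3 : Real.log ‖jFunction τ‖ ≤ Real.posLog ‖jFunction τ‖ := by
      rw [Real.posLog]; exact le_max_right _ _
    have h4 : Real.log 1000 ≤ 7 := by
      have : (1000 : ℝ) ≤ 2 ^ 10 := by norm_num
      have h5 := Real.log_le_log (by norm_num) this
      rw [Real.log_pow] at h5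
      have := Real.log_two_lt_d9
      push_cast at h5
      linarith
    linarith

lemma heatAtZero_le_of_three_le {N : ℕ} (hN : 1 ≤ N) (hτ : 3 ≤ 4 * τ.im ^ 2) :
    heatAtZero τ (1 / N) ≤
      Real.log N / 2 + 1 / 12 * Real.posLog ‖jFunction τ‖ + 11 / 5 + 1 / N := by
  have hN1 : (1 : ℝ) ≤ N := by exact_mod_cast hN
  have hy := τ.im_pos
  have hy2 : 0.86 ≤ τ.im := by nlinarith
  have hπ := Real.pi_gt_d2
  have hx : 5.4 ≤ 2 * π * τ.im := by nlinarith
  have h := heatAtZero_le τ (t := 1 / N) (by positivity)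
  have h2 := im_div_le_log_jFunction τ
  -- With log x ≤ x - 1 and 1/N ≤ 1, the excess over log N is at most 1/(2π Im τ) ≤ 0.186. The
  -- constants then total 1.048 + 1 + 0.093 + 0.021 < 11/5.
  have hlog : Real.log (1 + 1 / (2 * π * τ.im * (1 / N))) ≤ Real.log N + 1 / N + 0.186 - 1 / N := by
    have e : 1 + 1 / (2 * π * τ.im * (1 / N)) = N * (1 / N + 1 / (2 * π * τ.im)) := by
      field_simp
    rw [e, Real.log_mul (by positivity) (by positivity)]
    have h3 := Real.log_le_sub_one_of_pos (x := 1 / N + 1 / (2 * π * τ.im)) (by positivity)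
    have h4 : (1 : ℝ) / N ≤ 1 := by rw [div_le_one (by positivity)]; exact hN1
    have h5 : 1 / (2 * π * τ.im) ≤ 0.186 := by
      rw [div_le_iff₀ (by positivity)]; linarith
    linarith
  have hρ : ‖expTwoPi τ‖ ≤ 0.01 := by
    rw [norm_expTwoPi]
    have h6 : Real.exp (-2 * π * (τ : ℂ).im) ≤ Real.exp (-5) := by
      rw [Real.exp_le_exp, coe_im]; linarith
    refine h6.trans ?_
    rw [Real.exp_neg, show (5 : ℝ) = (5 : ℕ) * 1 by norm_num, Real.exp_nat_mul]
    have h7 := Real.exp_one_gt_d9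
    have h8 : (100 : ℝ) ≤ Real.exp 1 ^ 5 :=
      le_trans (by norm_num) (pow_le_pow_left₀ (by norm_num : (0 : ℝ) ≤ 2.7) (by linarith) 5)
    rw [inv_le_comm₀ (by positivity) (by norm_num)]
    linarith
  have hρ' : 2 * ‖expTwoPi τ‖ / (1 - ‖expTwoPi τ‖) ^ 2 ≤ 0.021 := by
    have h9 : 0.98 ≤ (1 - ‖expTwoPi τ‖) ^ 2 := by nlinarith [norm_nonneg (expTwoPi τ)]
    rw [div_le_iff₀ (by linarith)]
    linarith
  have : (0 : ℝ) < 1 / N := by positivity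
  linarith

theorem heatAtZero_le_log (τ : ℍ) {N : ℕ} (hN : 1 ≤ N) : heatAtZero τ (1 / N) ≤
    Real.log N / 2 + 1 / 12 * Real.posLog ‖jFunction τ‖ + 11 / 5 + 1 / N := by
  obtain ⟨γ, hγ⟩ := ModularGroup.exists_smul_mem_fd τ
  rw [← heatAtZero_smul γ, ← jFunction_smul γ]
  exact heatAtZero_le_of_three_le hN (ModularGroup.three_le_four_mul_im_sq_of_mem_fd hγ)

end EllipticDiscrepancy

end

/-! ### Positivity of the discrepancy and transfer to the elliptic curve. -/

section

/-- The positive power sums of a nonempty family of nonzero numbers do not all vanish. -/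
lemma exists_sum_pow_ne_zero {ι K : Type*} [Field K] [CharZero K] (s : Finset ι)
    (hs : s.Nonempty) (ζ : ι → K) (hζ : ∀ i, ζ i ≠ 0) : ∃ k : ℕ, k ≠ 0 ∧ ∑ i ∈ s, ζ i ^ k ≠ 0 := by
  classical
  by_contra! hcon
  obtain ⟨i₀, hi₀⟩ := hs
  -- A polynomial without constant term that vanishes at every value of ζ except ζ i₀. The sum of
  -- f(ζ i) is a combination of positive power sums, yet it equals f(ζ i₀) ≠ 0 times a multiplicity,
  -- nonzero in characteristic 0.
  set f : Polynomial K :=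
    Polynomial.X * ∏ v ∈ (s.image ζ).erase (ζ i₀), (Polynomial.X - Polynomial.C v) with hf
  have h1 : ∑ i ∈ s, f.eval (ζ i) = 0 := by
    simp_rw [Polynomial.eval_eq_sum_range]
    rw [Finset.sum_comm]
    refine Finset.sum_eq_zero fun k _ => ?_
    rw [← Finset.mul_sum]
    rcases eq_or_ne k 0 with rfl | hk
    · simp [hf]
    · rw [hcon k hk, mul_zero]
  have h2 : f.eval (ζ i₀) ≠ 0 := by
    rw [hf, Polynomial.eval_mul, Polynomial.eval_X, Polynomial.eval_prod]
    refine mul_ne_zero (hζ i₀) (Finset.prod_ne_zero_iff.mpr fun v hv => ?_)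
    simpa [sub_eq_zero] using (Finset.ne_of_mem_erase hv).symm
  have h3 : ∑ i ∈ s, f.eval (ζ i) = ∑ i ∈ s with ζ i = ζ i₀, f.eval (ζ i₀) := by
    rw [Finset.sum_filter]
    refine Finset.sum_congr rfl fun i hi => ?_
    split_ifs with h
    · rw [h]
    · rw [hf, Polynomial.eval_mul, Polynomial.eval_prod]
      refine mul_eq_zero_of_right _ (Finset.prod_eq_zero (i := ζ i) ?_ (by simp))
      exact Finset.mem_erase.mpr ⟨h, Finset.mem_image_of_mem ζ hi⟩
  rw [h3, Finset.sum_const, nsmul_eq_mul] at h1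
  rcases mul_eq_zero.mp h1 with h | h
  · have h4 : (s.filter fun i => ζ i = ζ i₀).card = 0 := by exact_mod_cast h
    rw [Finset.card_eq_zero] at h4
    have h5 : i₀ ∈ s.filter fun i => ζ i = ζ i₀ := Finset.mem_filter.mpr ⟨hi₀, rfl⟩
    rw [h4] at h5
    exact absurd h5 (Finset.notMem_empty i₀)
  · exact h2 h

namespace EllipticDiscrepancy

variable {τ : ℍ}

/-- The double sum is ∑ λ̂(γ)e^{-t/λ̂(γ)}|∑γ(x_i)|², with nonnegative terms. One term is positive:
the sums over the powers γ^k, k ≥ 1, of the character (1, 0) are power sums of nonzero numbers, and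
these powers are nontrivial. -/
lemma sum_sum_torusNeronHeat_pos {ι : Type*} (Z : Finset ι) (hZ : Z.Nonempty) (x : ι → Torus τ)
    {t : ℝ} (ht : 0 < t) : 0 < ∑ i ∈ Z, ∑ j ∈ Z, torusNeronHeat τ t (x i - x j) := by
  have hsum : HasSum (fun p : ℤ × ℤ => greenCoeff τ p.1 p.2 * heatWeight τ t p *
      ‖∑ i ∈ Z, ((charOf τ p.1 p.2).1 (x i) : ℂ)‖ ^ 2)
      (∑ i ∈ Z, ∑ j ∈ Z, torusNeronHeat τ t (x i - x j)) := by
    have h := hasSum_sum (s := Z) fun i _ => hasSum_sum (s := Z) fun j _ =>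
      hasSum_torusNeronHeat τ ht (x i - x j)
    refine h.congr_fun fun p => ?_
    simp_rw [← Finset.mul_sum]
    congr 1
    have e : ((‖∑ i ∈ Z, ((charOf τ p.1 p.2).1 (x i) : ℂ)‖ ^ 2 : ℝ) : ℂ) =
        ∑ i ∈ Z, ∑ j ∈ Z, ((charOf τ p.1 p.2).1 (x i - x j) : ℂ) := by
      rw [← Complex.normSq_eq_norm_sq, ← Complex.mul_conj, map_sum, Finset.sum_mul_sum]
      refine Finset.sum_congr rfl fun i _ => Finset.sum_congr rfl fun j _ => ?_
      rw [sub_eq_add_neg, AddChar.map_add_eq_mul, AddChar.map_neg_eq_inv, Circle.coe_mul,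
        Circle.coe_inv_eq_conj]
    have e2 := congrArg Complex.re e
    rw [Complex.ofReal_re] at e2
    rw [e2]
    simp [Complex.re_sum]
  have hnn : ∀ p : ℤ × ℤ, 0 ≤ greenCoeff τ p.1 p.2 * heatWeight τ t p *
      ‖∑ i ∈ Z, ((charOf τ p.1 p.2).1 (x i) : ℂ)‖ ^ 2 := fun p =>
    mul_nonneg (mul_nonneg (greenCoeff_nonneg τ _ _) (heatWeight_pos τ t p).le) (sq_nonneg _)
  obtain ⟨k, hk, hne⟩ := exists_sum_pow_ne_zero Z hZ
    (fun i => ((charOf τ 1 0).1 (x i) : ℂ)) fun i => Circle.coe_ne_zero _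
  have hpow : ∀ i, ((charOf τ 1 0).1 (x i) : ℂ) ^ k = ((charOf τ k 0).1 (x i) : ℂ) := by
    intro i
    obtain ⟨r, hr⟩ := exists_torusPoint τ (x i)
    rw [← hr, charOf_torusPoint, charOf_torusPoint, ← expTwoPi_natCast_mul]
    simp
  simp_rw [hpow] at hne
  rw [← hsum.tsum_eq]
  refine hsum.summable.tsum_pos hnn ((k : ℤ), 0) ?_
  have h1 := greenCoeff_pos τ (m := k) (n := 0) (Or.inl (by exact_mod_cast hk))
  have h2 := norm_pos_iff.mpr hne
  have h3 := heatWeight_pos τ t ((k : ℤ), 0)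
  positivity

variable (E : WeierstrassCurve ℂ) [E.IsElliptic]

lemma uniformization_toTorus (P : E.toAffine.Point) : (uniformization E).2 (toTorus E P) = P :=
  Function.rightInverse_invFun (isUniformization_uniformization E).bijective.surjective P

lemma toTorus_sub (P Q : E.toAffine.Point) : toTorus E (P - Q) = toTorus E P - toTorus E Q := by
  apply (isUniformization_uniformization E).bijective.injective
  rw [map_sub, uniformization_toTorus, uniformization_toTorus, uniformization_toTorus]

lemma toTorus_zero : toTorus E 0 = 0 := by
  simpa using toTorus_sub E 0 0

lemma toTorus_injective : Function.Injective (toTorus E) := fun P Q h => by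
  rw [← uniformization_toTorus E P, h, uniformization_toTorus]

lemma neronHeat_sub_le_neron {t : ℝ} (ht : 0 < t) {P : E.toAffine.Point} (hP : P ≠ 0) :
    neronHeat E t P - t ≤ neron E P :=
  torusNeronHeat_sub_le _ ht fun h => hP (toTorus_injective E (h.trans (toTorus_zero E).symm))

lemma neronHeat_zero_le {N : ℕ} (hN : 1 ≤ N) : neronHeat E (1 / N) 0 ≤
    Real.log N / 2 + 1 / 12 * Real.posLog ‖E.j‖ + 11 / 5 + 1 / N := by
  rw [neronHeat, toTorus_zero, torusNeronHeat_zero _ (by positivity),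
    j_eq_jFunction (isUniformization_uniformization E)]
  exact heatAtZero_le_log _ hN

lemma discrepancy_pos (Z : Finset E.toAffine.Point) (hZ : Z.Nonempty) : 0 < discrepancy E Z := by
  have hN : (0 : ℝ) < Z.card := by exact_mod_cast hZ.card_pos
  unfold discrepancy neronHeat
  simp_rw [toTorus_sub]
  exact mul_pos (by positivity) (sum_sum_torusNeronHeat_pos Z hZ (toTorus E) (by positivity))

end EllipticDiscrepancy

end

end

theorem mainTheorem3 (E : WeierstrassCurve ℂ) [E.IsElliptic]
    (Z : Finset E.toAffine.Point) (hZ : Z.Nonempty) :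
    0 < EllipticDiscrepancy.discrepancy E Z ∧
    ∑ p ∈ Z.offDiag, EllipticDiscrepancy.neron E (p.1 - p.2) ≥
      (Z.card : ℝ) ^ 2 * EllipticDiscrepancy.discrepancy E Z
        - (Z.card : ℝ) * Real.log (Z.card : ℝ) / 2
        - (Z.card : ℝ) / 12 * Real.posLog ‖E.j‖
        - 16 * (Z.card : ℝ) / 5 := by
  refine ⟨EllipticDiscrepancy.discrepancy_pos E Z hZ, ?_⟩
  have hN : (0 : ℝ) < Z.card := by exact_mod_cast hZ.card_pos
  have hsq : (Z.card : ℝ) ^ 2 * EllipticDiscrepancy.discrepancy E Z =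
      ∑ p ∈ Z.offDiag, EllipticDiscrepancy.neronHeat E (1 / Z.card) (p.1 - p.2) +
        Z.card * EllipticDiscrepancy.neronHeat E (1 / Z.card) 0 := by
    rw [EllipticDiscrepancy.discrepancy, ← mul_assoc, mul_one_div_cancel (by positivity), one_mul,
      ← Finset.sum_product', ← Finset.diag_union_offDiag,
      Finset.sum_union (Finset.disjoint_diag_offDiag Z), Finset.sum_diag, add_comm]
    simp
  have hle : ∑ p ∈ Z.offDiag, (EllipticDiscrepancy.neronHeat E (1 / Z.card) (p.1 - p.2) -
      1 / Z.card) ≤ ∑ p ∈ Z.offDiag, EllipticDiscrepancy.neron E (p.1 - p.2) :=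
    Finset.sum_le_sum fun p hp => EllipticDiscrepancy.neronHeat_sub_le_neron E (by positivity)
      (sub_ne_zero.mpr (Finset.mem_offDiag.mp hp).2.2)
  rw [Finset.sum_sub_distrib, Finset.sum_const, Finset.offDiag_card, nsmul_eq_mul,
    Nat.cast_sub (Nat.le_mul_self _), Nat.cast_mul] at hle
  have h0 := mul_le_mul_of_nonneg_left
    (EllipticDiscrepancy.neronHeat_zero_le E (N := Z.card) hZ.card_pos) hN.le
  -- The loss 1/N over N² - N ordered pairs totals N - 1, and the diagonal adds the constant part
  -- 11N/5 + 1; together these make 16N/5.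
  have e1 : ((Z.card : ℝ) * Z.card - Z.card) * (1 / Z.card) = Z.card - 1 := by field_simp
  have e2 : (Z.card : ℝ) * (Real.log Z.card / 2 + 1 / 12 * Real.posLog ‖E.j‖ + 11 / 5 +
      1 / Z.card) = Z.card * Real.log Z.card / 2 + Z.card / 12 * Real.posLog ‖E.j‖ +
        11 * Z.card / 5 + 1 := by field_simp
  rw [e1] at hle
  rw [e2] at h0
  rw [hsq]
  linarith
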